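/- Let $d,N\ge 1$ and let $X_j=\mathcal N(\mu_j,\Sigma_j)$, $j\in[N]=\{1,\dots,N\}$, be Gaussian measures on $\mathbb R^d$ such that the eigenvalues of every $\Sigma_j$ lie in $[\lambda_{\min},\lambda_{\max}]$, where $\lambda_{\min}>0$, and $\Sigma_j\Sigma_k=\Sigma_k\Sigma_j$ for all $j,k\in[N]$. Let $\mathcal P_2(\mathbb R^d)$ be the set of probability measures on $\mathbb R^d$ with finite second moment, let $W_2(\mu,\nu)=\big(\inf_\gamma\int\|x-y\|^2\,d\gamma(x,y)\big)^{1/2}$ (infimum over the couplings $\gamma$ of $\mu$ and $\nu$) be the 2-Wasserstein distance, and put $M_W:=\max_{j}W_2(\delta_0,X_j)$. Let $\langle X_j,X_k\rangle_{L^2}$ be the integral over $\mathbb R^d$ of the product of the Lebesgue densities of $X_j$ and $X_k$. Let $\beta>0$, and for $\xi\in\mathcal P_2(\mathbb R^d)$ let $$w_j(\xi)=\frac{\exp(-\beta W_2^2(X_j,\xi))}{\sum_{k=1}^N\exp(-\beta W_2^2(X_k,\xi))},\qquad \Phi(\xi)=\Big(\sum_{j=1}^N w_j(\xi)\,T_j\Big)_{\#}\xi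 ,$$ where $T_j$ is the optimal transport map from $\xi$ to $X_j$ for the quadratic cost (it exists and is $\xi$-a.e. unique if $\xi$ is absolutely continuous with respect to Lebesgue measure). Fix $i\in[N]$ and assume that (a) $-\log\langle X_i,X_j\rangle_{L^2}\ \ge\ \frac d2\log(4\pi\lambda_{\max})+\frac1{\beta\lambda_{\min}}\log\!\big(N^3\beta(4M_W^2+2d(\lambda_{\max}+\lambda_{\min}))\big)$ for all $j\ne i$, (b) $\displaystyle \beta>\frac{e^2}{(4M_W^2+2d(\lambda_{\max}+\lambda_{\min}))N^3}$, (c) $\displaystyle \kappa:=\frac{144\,\beta M_W^2}{N}<1$. Let $r=1/\sqrt{\beta N}$ and $B_i=\{\nu\in\mathcal P_2(\mathbb R^d):W_2(\nu,X_i)<r\}$. Then: (1) Among the absolutely continuous measures in $B_i$ there is exactly one fixed point $X_i^\ast$ of $\Phi$. (2) For every $\xi=\mathcal N(m,\Omega)$ with $\Omega$ positive definite, $\Sigma_j\Omega=\Omega\Sigma_j$ for all $j\in[N]$ and $W_2(X_i,\xi)<r$, and for every $0<\varepsilon<r$, $$W_2(\Phi^n(\xi),X_i^\ast)<\varepsilon\qquad\text{for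 all integers } n\ge\max\left\{0,\left\lceil\frac{\log\left(\frac{\varepsilon}{2}\sqrt{\beta N}\right)}{\log\left(\frac{144\,\beta M_W^2}{N}\right)}\right\rceil\right\}.$$ -/

import Mathlib

open MeasureTheory ProbabilityTheory
open scoped ENNReal

noncomputable section

/-- `ℝᵈ` with the Euclidean norm. -/
abbrev RSpace (d : ℕ) : Type := EuclideanSpace ℝ (Fin d)

/-- The couplings of `μ` and `ν`: measures on the product with marginals `μ` and `ν`. -/
def couplings {d : ℕ} (μ ν : Measure (RSpace d)) : Set (Measure (RSpace d × RSpace d)) :=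
  {γ | γ.map Prod.fst = μ ∧ γ.map Prod.snd = ν}

/-- The 2-Wasserstein distance `(inf_γ ∫ ‖x - y‖² dγ)^(1/2)`. It takes values in `[0, ∞]` and is
finite on probability measures with finite second moment; it is `∞` if there is no coupling. -/
def W2 {d : ℕ} (μ ν : Measure (RSpace d)) : ℝ≥0∞ :=
  (⨅ γ ∈ couplings μ ν, ∫⁻ p, edist p.1 p.2 ^ 2 ∂γ) ^ (1 / 2 : ℝ)

/-- `ν` belongs to `𝒫₂(ℝᵈ)`: it is a probability measure with finite second moment. -/
def InP2 {d : ℕ} (ν : Measure (RSpace d)) : Prop :=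
  IsProbabilityMeasure ν ∧ ∫⁻ x, ‖x‖ₑ ^ 2 ∂ν < ∞

/-- The open ball `{ν ∈ 𝒫₂(ℝᵈ) : W₂(ν, X) < r}`. -/
def wassersteinBall {d : ℕ} (X : Measure (RSpace d)) (r : ℝ) : Set (Measure (RSpace d)) :=
  {ν | InP2 ν ∧ W2 ν X < ENNReal.ofReal r}

/-- `T` is an optimal transport map from `ξ` to `X` for the quadratic cost. -/
def IsOptimalTransportMap {d : ℕ} (T : RSpace d → RSpace d) (ξ X : Measure (RSpace d)) : Prop :=
  Measurable T ∧ ξ.map T = X ∧ ∫⁻ x, edist x (T x) ^ 2 ∂ξ = W2 ξ X ^ 2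

/-- The Gibbs weights
`w_j(ξ) = exp (-β W₂(X_j, ξ)²) / ∑ k, exp (-β W₂(X_k, ξ)²)`. -/
def gibbsWeight {d N : ℕ} (β : ℝ) (X : Fin N → Measure (RSpace d)) (ξ : Measure (RSpace d))
    (j : Fin N) : ℝ :=
  Real.exp (-β * (W2 (X j) ξ).toReal ^ 2) / ∑ k, Real.exp (-β * (W2 (X k) ξ).toReal ^ 2)

open Classical in
/-- The retrieval operator `Φ(ξ) = (∑ j, w_j(ξ) T_j)_# ξ`, where `T_j` is the optimal transport
map from `ξ` to `X_j`. If some `T_j` does not exist, then the value is the zero measure, which is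
not a probability measure and has distance `∞` to every probability measure. -/
def retrieval {d N : ℕ} (β : ℝ) (X : Fin N → Measure (RSpace d)) (ξ : Measure (RSpace d)) :
    Measure (RSpace d) :=
  if h : ∃ T : Fin N → RSpace d → RSpace d, ∀ j, IsOptimalTransportMap (T j) ξ (X j) then
    ξ.map (fun x => ∑ j, gibbsWeight β X ξ j • h.choose j x)
  else 0

/-- The `L²` inner product of two measures: the integral of the product of their densities with
respect to Lebesgue measure. -/
def l2Inner {d : ℕ} (μ ν : Measure (RSpace d)) : ℝ :=
  ∫ x, (μ.rnDeriv volume x).toReal * (ν.rnDeriv volume x).toReal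

/-- `M_W = max_j W₂(δ₀, X_j)`. -/
def maxW2 {d N : ℕ} (X : Fin N → Measure (RSpace d)) : ℝ :=
  (⨆ j, W2 (Measure.dirac 0) (X j)).toReal

end

/-!
A Gaussian measure `m + P g`, with `g` a standard Gaussian vector and `P` positive definite, is
encoded by the point `(m, P)` of a Hilbert space (`gaussianParam`). For commuting `P` the coupling
through a common `g` is optimal, so the Wasserstein distance is the distance of these points
(`W2_affineGaussian`), the optimal maps are affine and almost everywhere unique
(`ae_eq_affine_of_optimal`), and the retrieval operator acts on the points as the softmax map
`x ↦ ∑ w_j(x) p_j` (`retrieval_affineGaussian`).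

In a Hilbert space the derivative of the softmax map is `2β` times the covariance of the patterns
under the weights, at most `8βM² (1 - w_i)`. The overlap of two Gaussian measures is at least
`(4π lmax)^(-d/2) exp (-‖μ_i - μ_j‖² / (4 lmin))` (`le_l2Inner_affineGaussian`), so the separation
condition makes the means, and hence the patterns, so far apart that `1 - w_i` is tiny on the ball
around `p_i`. There the softmax map is a contraction with the stated constant, and Banach's theorem
gives the fixed point and the rate (`exists_softmaxMap_fixedPoint`).

Uniqueness concerns all absolutely continuous measures `ξ` in the ball, not only Gaussian ones. If
`ξ` is a fixed point, then `T = ∑ w_j T_j` preserves `ξ`. As an average of optimal maps it is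
cyclically monotone, and a measure preserving cyclically monotone map is the identity almost
everywhere (`CyclicallyMonotoneOn.ae_eq_self`): along an orbit the sum of `‖T^(k+1) x - T^k x‖²` is
bounded by boundary terms. So `ξ` is a Karcher mean of the `X_j` with fixed weights, and it remains
to show that it is the Gaussian one (`eq_affineGaussian_of_barycenter`). This compares two bounds
for its variance, with `B = ∑ w_j σ_j` and `σ_j²` the covariance of `X_j`.

* Writing `x = ∑ w_j T_j x` and using that a coupling of `X_j` and `X_k` has covariance at most
  `⟨σ_j, σ_k⟩`, with an explicit defect, the variance is at most `‖B‖²`, with equality only if all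
  `σ_j⁻¹ (T_j - μ_j)` coincide.
* The variance is at least `‖B‖²` (`hsInner_le_integral_norm_sub_sq`). Let `φ_j`, `ψ_j` be
  Rockafellar potentials of `T_j` and their conjugates. An Ornstein–Uhlenbeck step of size `s`,
  applied to all targets `T_j x` with the same noise, preserves the laws `X_j`, so it leaves the
  mean of `∑ w_j ψ_j` unchanged. It moves the barycentre by `δ ≈ -(s²/2) (x - m) + s B g`, and it
  raises `∑ w_j ψ_j` by at least `⟪x, δ⟫ + ‖δ‖² / 2` up to a small error, wherever the segment from `x` to
  `x + δ` meets the set on which `∑ w_j T_j = id` often enough. By the Lebesgue density theorem this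
  happens with probability tending to one as `s → 0`, since `ξ` is absolutely continuous. Taking
  expectations, dividing by `s²` and letting `s → 0` gives the bound.

The common value of the maps `σ_j⁻¹ (T_j - μ_j)` then has a standard Gaussian law, so `ξ` is
Gaussian, its point is a fixed point of the softmax map, and the contraction applies.
-/

namespace WassersteinRetrieval

open Filter Topology Finset
open scoped RealInnerProductSpace

/-! ### The Wasserstein distance and couplings -/

section Wasserstein

variable {d : ℕ} {μ ν : Measure (RSpace d)}

lemma W2_sq (μ ν : Measure (RSpace d)) :
    W2 μ ν ^ 2 = ⨅ γ ∈ couplings μ ν, ∫⁻ p, edist p.1 p.2 ^ 2 ∂γ := by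
  rw [W2, ← ENNReal.rpow_natCast, ← ENNReal.rpow_mul]
  norm_num

lemma W2_sq_le_of_coupling {γ : Measure (RSpace d × RSpace d)} (hγ : γ ∈ couplings μ ν) :
    W2 μ ν ^ 2 ≤ ∫⁻ p, edist p.1 p.2 ^ 2 ∂γ := by
  rw [W2_sq]; exact iInf₂_le _ hγ

lemma W2_sq_le_of_map {Ω : Type*} [MeasurableSpace Ω] {P : Measure Ω} {f g : Ω → RSpace d}
    (hf : Measurable f) (hg : Measurable g) (hμ : P.map f = μ) (hν : P.map g = ν) :
    W2 μ ν ^ 2 ≤ ∫⁻ ω, edist (f ω) (g ω) ^ 2 ∂P := by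
  have hm : Measurable (fun ω => (f ω, g ω)) := hf.prodMk hg
  have h : P.map (fun ω => (f ω, g ω)) ∈ couplings μ ν := by
    refine ⟨?_, ?_⟩
    · rw [Measure.map_map measurable_fst hm, ← hμ]; rfl
    · rw [Measure.map_map measurable_snd hm, ← hν]; rfl
  refine (W2_sq_le_of_coupling h).trans (le_of_eq ?_)
  rw [lintegral_map (by fun_prop) hm]

end Wasserstein

/-! ### Cyclical monotonicity -/

section Cyclic

variable {E : Type*} [NormedAddCommGroup E] [InnerProductSpace ℝ E]

/-- The graph of `T` over `s` is cyclically monotone: `∑ ⟪T x_k, x_{k+1} - x_k⟫ ≤ 0` along every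
closed chain `x_0, …, x_n, x_{n+1} = x_0` of points of `s`. -/
def CyclicallyMonotoneOn (T : E → E) (s : Set E) : Prop :=
  ∀ (n : ℕ) (x : ℕ → E), (∀ k ≤ n, x k ∈ s) →
    ∑ k ∈ range n, ⟪T (x k), x (k + 1) - x k⟫ + ⟪T (x n), x 0 - x n⟫ ≤ 0

lemma CyclicallyMonotoneOn.mono {T : E → E} {s t : Set E} (h : CyclicallyMonotoneOn T t)
    (hst : s ⊆ t) : CyclicallyMonotoneOn T s :=
  fun n x hx => h n x fun k hk => hst (hx k hk)

lemma CyclicallyMonotoneOn.weightedSum {ι : Type*} [Fintype ι] {T : ι → E → E} {s : Set E}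
    {w : ι → ℝ} (hw : ∀ j, 0 ≤ w j) (h : ∀ j, CyclicallyMonotoneOn (T j) s) :
    CyclicallyMonotoneOn (fun x => ∑ j, w j • T j x) s := by
  intro n x hx
  have := Finset.sum_nonpos (s := univ)
    fun j _ => mul_nonpos_of_nonneg_of_nonpos (hw j) (h j n x hx)
  refine le_trans (le_of_eq ?_) this
  simp only [sum_inner, real_inner_smul_left, mul_add, Finset.sum_add_distrib, Finset.mul_sum]
  rw [Finset.sum_comm]

/-- Rockafellar's theorem: a cyclically monotone map is a selection of subgradients. -/
theorem CyclicallyMonotoneOn.exists_potential {T : E → E} {s : Set E}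
    (h : CyclicallyMonotoneOn T s) :
    ∃ φ : E → ℝ, ∀ a ∈ s, ∀ b ∈ s, φ a + ⟪T a, b - a⟫ ≤ φ b := by
  rcases s.eq_empty_or_nonempty with rfl | ⟨x₀, hx₀⟩
  · exact ⟨0, by simp⟩
  -- the potential at `b` is the supremum over the chains in `s` from `x₀` to `b`
  let C : E → Set ℝ := fun b => {r | ∃ (n : ℕ) (x : ℕ → E), x 0 = x₀ ∧ x n = b ∧
    (∀ k ≤ n, x k ∈ s) ∧ r = ∑ k ∈ range n, ⟪T (x k), x (k + 1) - x k⟫}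
  have hbdd : ∀ b, BddAbove (C b) := by
    intro b
    refine ⟨-⟪T b, x₀ - b⟫, ?_⟩
    rintro r ⟨n, x, h0, hn, hx, rfl⟩
    have := h n x hx
    rw [h0, hn] at this
    linarith
  refine ⟨fun b => sSup (C b), fun a ha b hb => ?_⟩
  have hne : (C a).Nonempty := by
    refine ⟨_, 1, fun k => if k = 0 then x₀ else a, by simp, by simp, ?_, rfl⟩
    intro k _
    dsimp only
    split_ifs <;> assumption
  rw [← le_sub_iff_add_le]
  refine csSup_le hne ?_
  rintro r ⟨n, x, h0, hn, hx, rfl⟩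
  rw [le_sub_iff_add_le]
  refine le_csSup (hbdd b)
    ⟨n + 1, fun k => if k ≤ n then x k else b, by simp [h0], by simp, ?_, ?_⟩
  · intro k _
    dsimp only
    split_ifs with hk
    · exact hx k hk
    · exact hb
  · rw [Finset.sum_range_succ]
    congr 1
    · refine Finset.sum_congr rfl fun k hk => ?_
      have hk' := Finset.mem_range.1 hk
      simp [hk'.le, Nat.succ_le_of_lt hk']
    · simp [hn]

variable [MeasurableSpace E] [BorelSpace E]

/-- The Legendre transform of the potential of a cyclically monotone map. It is real-valued on a
measurable set `Y` that contains the range of the map, and may be infinite elsewhere. -/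
theorem CyclicallyMonotoneOn.exists_conjugate {T : E → E} {s : Set E}
    (h : CyclicallyMonotoneOn T s) :
    ∃ (φ ψ : E → ℝ) (Y : Set E), Measurable ψ ∧ MeasurableSet Y ∧ (∀ a ∈ s, T a ∈ Y) ∧
      (∀ a ∈ s, ∀ b ∈ s, φ a + ⟪T a, b - a⟫ ≤ φ b) ∧
      (∀ y ∈ Y, ∀ a ∈ s, ⟪a, y⟫ - φ a ≤ ψ y) ∧ ∀ a ∈ s, ψ (T a) = ⟪a, T a⟫ - φ a := by
  obtain ⟨φ, hφ⟩ := h.exists_potential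
  -- as a supremum of continuous functions the transform is lower semicontinuous, hence measurable
  let Ψ : E → EReal := fun y => ⨆ a ∈ s, ((⟪a, y⟫ - φ a : ℝ) : EReal)
  have hΨ : Measurable Ψ := by
    refine LowerSemicontinuous.measurable ?_
    refine lowerSemicontinuous_biSup fun a _ => Continuous.lowerSemicontinuous ?_
    exact continuous_coe_real_ereal.comp (by fun_prop)
  have hle : ∀ y, ∀ a ∈ s, ((⟪a, y⟫ - φ a : ℝ) : EReal) ≤ Ψ y := fun y a ha =>
    le_iSup₂ (f := fun a (_ : a ∈ s) => ((⟪a, y⟫ - φ a : ℝ) : EReal)) a ha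
  have hΨT : ∀ a ∈ s, Ψ (T a) = ((⟪a, T a⟫ - φ a : ℝ) : EReal) := by
    intro a ha
    refine le_antisymm (iSup₂_le fun b hb => ?_) (hle _ a ha)
    have := hφ a ha b hb
    rw [inner_sub_right, real_inner_comm b, real_inner_comm a] at this
    exact_mod_cast (by linarith)
  refine ⟨φ, fun y => (Ψ y).toReal, {y | Ψ y ≠ ⊤}, hΨ.ereal_toReal,
    hΨ (measurableSet_singleton ⊤).compl, fun a ha => ?_, hφ, fun y hy a ha => ?_, fun a ha => ?_⟩
  · simp only [Set.mem_ofPred_eq, hΨT a ha]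
    exact EReal.coe_ne_top _
  · have := EReal.toReal_le_toReal (hle y a ha) (EReal.coe_ne_bot _) hy
    rwa [EReal.toReal_coe] at this
  · simp only [hΨT a ha, EReal.toReal_coe]

end Cyclic

/-! ### Optimal transport maps are cyclically monotone -/

section Optimal

variable {d : ℕ} {ξ X : Measure (RSpace d)} {T : RSpace d → RSpace d}

/-- A fixed positive fraction of each normalized restriction of `ξ` can be split off from `ξ`. -/
lemma exists_add_smul_sum_cond_eq (ξ : Measure (RSpace d)) [IsProbabilityMeasure ξ]
    {ι : Type*} [Fintype ι] [Nonempty ι] (W : ι → Set (RSpace d))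
    (hWm : ∀ i, MeasurableSet (W i)) (hW : ∀ i, ξ (W i) ≠ 0) :
    ∃ (η : ℝ≥0∞) (ρ : Measure (RSpace d)), η ≠ 0 ∧ η ≠ ∞ ∧ ρ + η • ∑ i, cond ξ (W i) = ξ := by
  have hSfin : ∑ i, (ξ (W i))⁻¹ ≠ ∞ := by
    simp [ENNReal.sum_eq_top, hW]
  have hSpos : ∑ i, (ξ (W i))⁻¹ ≠ 0 := by
    simp [Finset.sum_eq_zero_iff, measure_ne_top]
  obtain ⟨η, hη⟩ : ∃ η : ℝ≥0∞, η = (∑ i, (ξ (W i))⁻¹)⁻¹ := ⟨_, rfl⟩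
  have hη0 : η ≠ 0 := hη ▸ ENNReal.inv_ne_zero.2 hSfin
  have hηtop : η ≠ ∞ := hη ▸ ENNReal.inv_ne_top.2 hSpos
  let h : RSpace d → ℝ≥0∞ := fun x => ∑ i, (W i).indicator (fun _ => η * (ξ (W i))⁻¹) x
  have hhm : Measurable h :=
    Finset.measurable_fun_sum _ fun i _ => measurable_const.indicator (hWm i)
  have hh1 : ∀ x, h x ≤ 1 := by
    intro x
    calc h x ≤ ∑ i, η * (ξ (W i))⁻¹ :=
          Finset.sum_le_sum fun i _ => Set.indicator_le_self' (by simp) x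
      _ = 1 := by rw [← Finset.mul_sum, hη, ENNReal.inv_mul_cancel hSpos hSfin]
  have hdens : ξ.withDensity h = η • ∑ i, cond ξ (W i) := by
    have : h = ∑ i, (W i).indicator (fun _ => η * (ξ (W i))⁻¹) := by
      ext x; simp [h, Finset.sum_apply]
    rw [this, Finset.smul_sum]
    have key : ∀ t : Finset ι, ξ.withDensity (∑ i ∈ t, (W i).indicator (fun _ => η * (ξ (W i))⁻¹))
        = ∑ i ∈ t, η • cond ξ (W i) := by
      classical
      intro t
      induction t using Finset.induction_on with
      | empty => simp
      | insert a t ha ih =>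
        rw [Finset.sum_insert ha, Finset.sum_insert ha, withDensity_add_left
          (measurable_const.indicator (hWm a)), ih, withDensity_indicator (hWm a),
          withDensity_const, mul_smul]
        rfl
    exact key univ
  refine ⟨η, ξ.withDensity (1 - h), hη0, hηtop, ?_⟩
  rw [← hdens, ← withDensity_add_right _ hhm]
  have : (1 - h + h) = 1 := by
    ext x; simp [tsub_add_cancel_of_le (hh1 x)]
  rw [this, withDensity_one]

/-- The transport plan of `T` competes with the plan that permutes the targets of the pieces
`κ i`. -/
lemma W2_sq_le_permuted_cost {ρ : Measure (RSpace d)} {η : ℝ≥0∞}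
    {ι : Type*} [Fintype ι] (σ : Equiv.Perm ι) (κ : ι → Measure (RSpace d))
    [∀ i, IsProbabilityMeasure (κ i)] (hρ : ρ + η • ∑ i, κ i = ξ)
    (hTm : Measurable T) (hTX : ξ.map T = X) :
    W2 ξ X ^ 2 ≤ ∫⁻ x, edist x (T x) ^ 2 ∂ρ +
      η * ∫⁻ z, ∑ i, edist (z (σ i)) (T (z i)) ^ 2 ∂(Measure.pi κ) := by
  have hQ : ∀ i, (Measure.pi κ).map (fun z => z i) = κ i :=
    fun i => (measurePreserving_eval κ i).map_eq
  have hm : ∀ i, Measurable (fun z : ι → RSpace d => (z (σ i), T (z i))) := fun i =>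
    (measurable_pi_apply _).prodMk (hTm.comp (measurable_pi_apply _))
  have hm2 : Measurable (fun x => (x, T x)) := measurable_id.prodMk hTm
  have hcm : Measurable (fun p : RSpace d × RSpace d => edist p.1 p.2 ^ 2) := by fun_prop
  have hc : ∀ i, Measurable (fun z : ι → RSpace d => edist (z (σ i)) (T (z i)) ^ 2) := fun i =>
    ((measurable_pi_apply (σ i)).edist (hTm.comp (measurable_pi_apply i))).pow_const 2
  generalize Measure.pi κ = Q at hQ ⊢
  have hsum : ∀ f : RSpace d × RSpace d → RSpace d, Measurable f →
      (ρ.map (fun x => (x, T x)) + η • ∑ i, Q.map (fun z => (z (σ i), T (z i)))).map f =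
        ρ.map (fun x => f (x, T x)) + η • ∑ i, Q.map (fun z => f (z (σ i), T (z i))) := by
    intro f hf
    rw [Measure.map_add _ _ hf, Measure.map_smul, Measure.map_map hf hm2,
      Measure.map_finset_sum hf.aemeasurable]
    congr 2
    exact Finset.sum_congr rfl fun i _ => Measure.map_map hf (hm i)
  have hγ : ρ.map (fun x => (x, T x)) + η • ∑ i, Q.map (fun z => (z (σ i), T (z i)))
      ∈ couplings ξ X := by
    refine ⟨?_, ?_⟩
    · rw [hsum _ measurable_fst]
      simp only [Measure.map_id', hQ]
      rw [Equiv.sum_comp σ κ, hρ]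
    · rw [hsum _ measurable_snd, ← hTX, ← hρ, Measure.map_add _ _ hTm, Measure.map_smul,
        Measure.map_finset_sum hTm.aemeasurable]
      congr 2
      refine Finset.sum_congr rfl fun i _ => ?_
      conv_rhs => rw [← hQ i]
      exact (Measure.map_map hTm (measurable_pi_apply i)).symm
  refine (W2_sq_le_of_coupling hγ).trans (le_of_eq ?_)
  rw [lintegral_add_measure, lintegral_map hcm hm2, lintegral_smul_measure,
    lintegral_finsetSum_measure, smul_eq_mul,
    lintegral_finsetSum (f := fun i (z : ι → RSpace d) => edist (z (σ i)) (T (z i)) ^ 2) univ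
      (fun i _ => hc i)]
  congr 2
  exact Finset.sum_congr rfl fun i _ => lintegral_map hcm (hm i)

lemma lintegral_cost_eq_add {ρ : Measure (RSpace d)} {η : ℝ≥0∞}
    {ι : Type*} [Fintype ι] (κ : ι → Measure (RSpace d))
    [∀ i, IsProbabilityMeasure (κ i)] (hρ : ρ + η • ∑ i, κ i = ξ) (hTm : Measurable T) :
    ∫⁻ x, edist x (T x) ^ 2 ∂ξ = ∫⁻ x, edist x (T x) ^ 2 ∂ρ +
      η * ∫⁻ z, ∑ i, edist (z i) (T (z i)) ^ 2 ∂(Measure.pi κ) := by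
  have hcT : Measurable (fun x => edist x (T x) ^ 2) := (measurable_id.edist hTm).pow_const 2
  rw [← hρ, lintegral_add_measure, lintegral_smul_measure, lintegral_finsetSum_measure, smul_eq_mul,
    lintegral_finsetSum (f := fun i (z : ι → RSpace d) => edist (z i) (T (z i)) ^ 2) univ
      (fun i _ => hcT.comp (measurable_pi_apply i))]
  congr 2
  refine Finset.sum_congr rfl fun i _ => ?_
  exact ((measurePreserving_eval κ i).lintegral_comp hcT).symm

/-- Mass cannot be rearranged cyclically at a profit: if the sets `W i` have positive mass, then
exchanging the targets `T (z i)` of the points `z i ∈ W i` along a permutation cannot always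
decrease the total cost. -/
lemma not_forall_sum_edist_lt_of_optimal [IsProbabilityMeasure ξ]
    (hT : IsOptimalTransportMap T ξ X) (hfin : ∫⁻ x, edist x (T x) ^ 2 ∂ξ ≠ ∞)
    {ι : Type*} [Fintype ι] [Nonempty ι] (σ : Equiv.Perm ι) (W : ι → Set (RSpace d))
    (hWm : ∀ i, MeasurableSet (W i)) (hW : ∀ i, ξ (W i) ≠ 0) :
    ¬ ∀ z : ι → RSpace d, (∀ i, z i ∈ W i) →
      ∑ i, edist (z (σ i)) (T (z i)) ^ 2 < ∑ i, edist (z i) (T (z i)) ^ 2 := by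
  intro hlt
  obtain ⟨hTm, hTX, hTopt⟩ := hT
  obtain ⟨η, ρ, hη0, hηtop, hρ⟩ := exists_add_smul_sum_cond_eq ξ W hWm hW
  have hκ : ∀ i, IsProbabilityMeasure (cond ξ (W i)) := fun i => cond_isProbabilityMeasure (hW i)
  have hcost := W2_sq_le_permuted_cost σ (fun i => cond ξ (W i)) hρ hTm hTX
  have hξc := lintegral_cost_eq_add (fun i => cond ξ (W i)) hρ hTm
  have hmem : ∀ᵐ z ∂(Measure.pi fun i => cond ξ (W i)), ∀ i, z i ∈ W i := by
    refine (ae_all_iff.2 fun i => ?_)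
    exact (measurePreserving_eval (fun i => cond ξ (W i)) i).quasiMeasurePreserving.ae
      (p := fun x => x ∈ W i) (ae_cond_mem (hWm i))
  have hQ0 : Measure.pi (fun i => cond ξ (W i)) ≠ 0 := IsProbabilityMeasure.ne_zero _
  have hmeas : Measurable fun z : ι → RSpace d => ∑ i, edist (z i) (T (z i)) ^ 2 :=
    Finset.measurable_fun_sum _ fun i _ =>
      ((measurable_pi_apply i).edist (hTm.comp (measurable_pi_apply i))).pow_const 2
  generalize Measure.pi (fun i => cond ξ (W i)) = Q at *
  have hfin3 : ∫⁻ z, ∑ i, edist (z i) (T (z i)) ^ 2 ∂Q ≠ ∞ := by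
    intro hc
    rw [hξc, hc, ENNReal.mul_top hη0] at hfin
    simp at hfin
  have hstrict : ∫⁻ z, ∑ i, edist (z (σ i)) (T (z i)) ^ 2 ∂Q <
      ∫⁻ z, ∑ i, edist (z i) (T (z i)) ^ 2 ∂Q := by
    refine lintegral_strict_mono hQ0 hmeas.aemeasurable ?_ ?_
    · refine ne_top_of_le_ne_top hfin3 (lintegral_mono_ae ?_)
      filter_upwards [hmem] with z hz using (hlt z hz).le
    · filter_upwards [hmem] with z hz using hlt z hz
  have hρfin : ∫⁻ x, edist x (T x) ^ 2 ∂ρ ≠ ∞ := by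
    intro hc; rw [hξc, hc] at hfin; simp at hfin
  refine absurd hcost (not_le.2 ?_)
  rw [← hTopt, hξc]
  exact ENNReal.add_lt_add_left hρfin (ENNReal.mul_lt_mul_right hη0 hηtop hstrict)

/-- The plan `(id, T)_# ξ` of an optimal map is concentrated on its support, on which any
violation of cyclical monotonicity would persist in a neighbourhood of positive mass. -/
theorem exists_cyclicallyMonotoneOn_of_optimal [IsProbabilityMeasure ξ]
    (hT : IsOptimalTransportMap T ξ X) (hfin : ∫⁻ x, edist x (T x) ^ 2 ∂ξ ≠ ∞) :
    ∃ s, MeasurableSet s ∧ ξ sᶜ = 0 ∧ CyclicallyMonotoneOn T s := by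
  have hTm := hT.1
  have hm2 : Measurable (fun x => (x, T x)) := measurable_id.prodMk hTm
  let γ := ξ.map (fun x => (x, T x))
  refine ⟨(fun x => (x, T x)) ⁻¹' γ.support, hm2 Measure.isClosed_support.measurableSet, ?_, ?_⟩
  · rw [← Set.preimage_compl, ← Measure.map_apply hm2
      Measure.isClosed_support.measurableSet.compl]
    exact Measure.measure_compl_support
  intro n x hx
  by_contra! hpos
  -- `H p` is what is gained by sending the target of `p i` to the point of `p (i + 1)`
  let σ : Equiv.Perm (Fin (n + 1)) := finRotate (n + 1)
  let H : (Fin (n + 1) → RSpace d × RSpace d) → ℝ := fun p =>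
    ∑ i, (dist (p i).1 (p i).2 ^ 2 - dist (p (σ i)).1 (p i).2 ^ 2)
  have hH : Continuous H := by fun_prop
  let p₀ : Fin (n + 1) → RSpace d × RSpace d := fun i => (x i, T (x i))
  have hsq : ∀ a b c : RSpace d, dist a c ^ 2 - dist b c ^ 2 =
      ‖a‖ ^ 2 - ‖b‖ ^ 2 + 2 * ⟪c, b - a⟫ := by
    intro a b c
    rw [dist_eq_norm, dist_eq_norm, norm_sub_sq_real, norm_sub_sq_real, inner_sub_right,
      real_inner_comm c a, real_inner_comm c b]
    ring
  have hH0 : 0 < H p₀ := by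
    simp only [H, p₀, hsq, Finset.sum_add_distrib, Finset.sum_sub_distrib]
    rw [Equiv.sum_comp σ (fun i => ‖x i‖ ^ 2), sub_self, zero_add, ← Finset.mul_sum,
      Fin.sum_univ_castSucc]
    have h1 : ∀ i : Fin n, ((σ i.castSucc : Fin (n + 1)) : ℕ) = i + 1 := by
      intro i
      simp [σ]
    have h2 : σ (Fin.last n) = 0 := finRotate_last
    simp only [h1, h2, Fin.val_castSucc, Fin.val_last, Fin.val_zero]
    rw [Fin.sum_univ_eq_sum_range (fun k => ⟪T (x k), x (k + 1) - x k⟫)]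
    linarith
  have hnhds : {p | 0 < H p} ∈ 𝓝 p₀ := (isOpen_lt continuous_const hH).mem_nhds hH0
  rw [nhds_pi, Filter.mem_pi'] at hnhds
  obtain ⟨I, U, hU, hUsub⟩ := hnhds
  have hex : ∀ i, ∃ V ⊆ U i, IsOpen V ∧ p₀ i ∈ V := fun i => mem_nhds_iff.1 (hU i)
  choose V hVU hVo hV using hex
  refine not_forall_sum_edist_lt_of_optimal hT hfin σ (fun i => (fun x => (x, T x)) ⁻¹' V i)
    (fun i => hm2 (hVo i).measurableSet) (fun i => ?_) (fun z hz => ?_)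
  · have h1 : p₀ i ∈ γ.support := hx i (Nat.lt_succ_iff.1 i.2)
    rw [Measure.mem_support_iff_forall] at h1
    have := h1 (V i) ((hVo i).mem_nhds (hV i))
    rw [Measure.map_apply hm2 (hVo i).measurableSet] at this
    exact this.ne'
  · have h1 : 0 < H (fun i => (z i, T (z i))) := hUsub fun i _ => hVU i (hz i)
    simp only [H, Finset.sum_sub_distrib, sub_pos] at h1
    have e : ∀ f : Fin (n + 1) → RSpace d, ∑ i, edist (f i) (T (z i)) ^ 2 =
        ENNReal.ofReal (∑ i, dist (f i) (T (z i)) ^ 2) := by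
      intro f
      rw [ENNReal.ofReal_sum_of_nonneg (fun _ _ => by positivity)]
      refine Finset.sum_congr rfl fun i _ => ?_
      rw [edist_dist, ENNReal.ofReal_pow dist_nonneg]
    rw [e (fun i => z (σ i)), e z]
    exact (ENNReal.ofReal_lt_ofReal_iff_of_nonneg (by positivity)).2 h1

end Optimal

/-! ### Measure preserving cyclically monotone maps -/

section SquareIntegrable

variable {Ω E : Type*} [MeasurableSpace Ω] {P : Measure Ω} [NormedAddCommGroup E]
  [InnerProductSpace ℝ E]

lemma integrable_inner_of_memLp {f g : Ω → E} (hf : MemLp f 2 P) (hg : MemLp g 2 P) :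
    Integrable (fun ω => ⟪f ω, g ω⟫) P := by
  refine Integrable.mono' (hf.norm.integrable_mul hg.norm)
    (hf.aestronglyMeasurable.inner hg.aestronglyMeasurable) ?_
  exact Eventually.of_forall fun ω => norm_inner_le_norm _ _

lemma integrable_norm_sq_of_memLp {f : Ω → E} (hf : MemLp f 2 P) :
    Integrable (fun ω => ‖f ω‖ ^ 2) P := by
  simpa using integrable_inner_of_memLp hf hf

end SquareIntegrable

/-- A cyclically monotone map that preserves a measure with finite second moment is the identity:
along an orbit `x, T x, …, T^n x` cyclical monotonicity bounds `∑ ‖T^(k+1) x - T^k x‖²` by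
boundary terms, whose expectation does not depend on `n`. -/
theorem CyclicallyMonotoneOn.ae_eq_self {E : Type*} [NormedAddCommGroup E] [InnerProductSpace ℝ E]
    [MeasurableSpace E] [BorelSpace E] [SecondCountableTopology E] {T : E → E} {s : Set E}
    {ξ : Measure E} (h : CyclicallyMonotoneOn T s) (hs : ξ sᶜ = 0) (hT : MeasurePreserving T ξ ξ)
    (hL : MemLp id 2 ξ) : ∀ᵐ x ∂ξ, T x = x := by
  have hit : ∀ k, MeasurePreserving (T^[k]) ξ ξ := fun k => hT.iterate k
  have hLk : ∀ k, MemLp (T^[k]) 2 ξ := fun k => by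
    simpa using hL.comp_measurePreserving (hit k)
  have hsq : ∀ k, ∫ x, ‖T^[k] x‖ ^ 2 ∂ξ = ∫ x, ‖x‖ ^ 2 ∂ξ := fun k => by
    conv_rhs => rw [← (hit k).map_eq]
    rw [integral_map (hit k).measurable.aemeasurable (by fun_prop)]
  have hdiff : ∀ k, ∫ x, ‖T^[k + 1] x - T^[k] x‖ ^ 2 ∂ξ = ∫ x, ‖T x - x‖ ^ 2 ∂ξ := fun k => by
    have hTm := hT.measurable
    conv_rhs => rw [← (hit k).map_eq]
    rw [integral_map (f := fun x => ‖T x - x‖ ^ 2) (hit k).measurable.aemeasurable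
      (((hTm.sub measurable_id).norm.pow_const 2).aestronglyMeasurable)]
    simp only [Function.iterate_succ_apply']
  have hmem : ∀ᵐ x ∂ξ, ∀ k, T^[k] x ∈ s := by
    refine ae_all_iff.2 fun k => ?_
    exact (hit k).quasiMeasurePreserving.ae (p := fun x => x ∈ s) (by rwa [ae_iff])
  have hpt : ∀ᵐ x ∂ξ, ∀ n : ℕ, ∑ k ∈ range n, ‖T^[k + 1] x - T^[k] x‖ ^ 2 ≤
      2 * (‖T^[0] x‖ ^ 2 + ‖T^[n + 1] x‖ ^ 2) := by
    filter_upwards [hmem] with x hx n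
    have h1 := h n (fun k => T^[k] x) fun k _ => hx k
    simp only [← Function.iterate_succ_apply' T] at h1
    have h2 : ∀ a b : E, ⟪a, a - b⟫ = (‖a - b‖ ^ 2 + (‖a‖ ^ 2 - ‖b‖ ^ 2)) / 2 := by
      intro a b
      rw [norm_sub_sq_real, inner_sub_right, real_inner_self_eq_norm_sq]; ring
    simp only [h2] at h1
    rw [← Finset.sum_div, Finset.sum_add_distrib,
      Finset.sum_range_sub (fun k => ‖T^[k] x‖ ^ 2)] at h1
    have h3 : ∀ a b : E, -(‖a‖ ^ 2 + ‖b‖ ^ 2) / 2 ≤ ⟪a, b⟫ := by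
      intro a b
      have := norm_add_sq_real a b
      nlinarith [sq_nonneg ‖a + b‖]
    have h4 := h3 (T^[n + 1] x) (T^[0] x)
    have h5 := h3 (T^[n + 1] x) (-T^[n] x)
    rw [norm_neg] at h5
    rw [sub_eq_add_neg (T^[0] x), inner_add_right] at h1
    linarith
  have hu : ∀ n : ℕ, n * ∫ x, ‖T x - x‖ ^ 2 ∂ξ ≤ 4 * ∫ x, ‖x‖ ^ 2 ∂ξ := by
    intro n
    have hi1 : ∀ k, Integrable (fun x => ‖T^[k + 1] x - T^[k] x‖ ^ 2) ξ := fun k =>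
      integrable_norm_sq_of_memLp ((hLk (k + 1)).sub (hLk k))
    have hi2 : ∀ k, Integrable (fun x => ‖T^[k] x‖ ^ 2) ξ := fun k =>
      integrable_norm_sq_of_memLp (hLk k)
    have := integral_mono_ae (integrable_finsetSum (range n) fun k _ => hi1 k)
      (((hi2 0).add (hi2 (n + 1))).const_mul 2) (hpt.mono fun x hx => hx n)
    rw [integral_finsetSum _ fun k _ => hi1 k, integral_const_mul] at this
    simp only [Pi.add_apply] at this
    rw [integral_add (hi2 0) (hi2 (n + 1)), hsq, hsq] at this
    simp only [hdiff, sum_const, card_range, nsmul_eq_mul] at this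
    linarith
  have hu0 : ∫ x, ‖T x - x‖ ^ 2 ∂ξ = 0 := by
    refine le_antisymm ?_ (integral_nonneg fun x => by positivity)
    by_contra! hpos
    obtain ⟨n, hn⟩ := exists_nat_gt ((4 * ∫ x, ‖x‖ ^ 2 ∂ξ) / ∫ x, ‖T x - x‖ ^ 2 ∂ξ)
    rw [div_lt_iff₀ hpos] at hn
    linarith [hu n]
  have hi : Integrable (fun x => ‖T x - x‖ ^ 2) ξ :=
    integrable_norm_sq_of_memLp ((hLk 1).sub hL)
  rw [integral_eq_zero_iff_of_nonneg (fun x => by positivity) hi] at hu0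
  filter_upwards [hu0] with x hx
  simpa [sub_eq_zero] using hx

/-! ### Gaussian measures as affine images of the standard Gaussian -/

section Gaussian

variable {d : ℕ}

/-- The law of `m + P g`, where `g` is a standard Gaussian vector. For positive semidefinite `P`
it is the Gaussian measure with mean `m` and covariance `P²`. -/
noncomputable def affineGaussian (m : RSpace d) (P : RSpace d →L[ℝ] RSpace d) :
    Measure (RSpace d) :=
  (stdGaussian (RSpace d)).map (fun g => m + P g)

instance (m : RSpace d) (P : RSpace d →L[ℝ] RSpace d) :
    IsProbabilityMeasure (affineGaussian m P) :=
  Measure.isProbabilityMeasure_map (by fun_prop)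

/-- The Hilbert–Schmidt inner product of two operators. -/
noncomputable def hsInner (A B : RSpace d →L[ℝ] RSpace d) : ℝ :=
  ∑ i, ⟪A (EuclideanSpace.basisFun (Fin d) ℝ i), B (EuclideanSpace.basisFun (Fin d) ℝ i)⟫

lemma memLp_clm_stdGaussian (A : RSpace d →L[ℝ] RSpace d) :
    MemLp (fun g => A g) 2 (stdGaussian (RSpace d)) :=
  A.comp_memLp' (IsGaussian.memLp_two_id (μ := stdGaussian (RSpace d)))

lemma integral_inner_mul_inner_stdGaussian (x y : RSpace d) :
    ∫ g, ⟪x, g⟫ * ⟪y, g⟫ ∂(stdGaussian (RSpace d)) = ⟪x, y⟫ := by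
  have h := covarianceBilin_apply (μ := stdGaussian (RSpace d)) IsGaussian.memLp_two_id x y
  rw [covarianceBilin_stdGaussian, innerSL_apply_apply] at h
  simpa using h.symm

lemma integral_inner_clm_stdGaussian (A B : RSpace d →L[ℝ] RSpace d) :
    ∫ g, ⟪A g, B g⟫ ∂(stdGaussian (RSpace d)) = hsInner A B := by
  let e := EuclideanSpace.basisFun (Fin d) ℝ
  have hexp : ∀ g, ⟪A g, B g⟫ = ∑ i, ∑ j, ⟪e i, g⟫ * ⟪e j, g⟫ * ⟪A (e i), B (e j)⟫ := by
    intro g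
    conv_lhs => rw [← e.sum_repr' g]
    simp only [map_sum, map_smul, sum_inner, inner_sum, real_inner_smul_left,
      real_inner_smul_right]
    rw [Finset.sum_comm]
    refine Finset.sum_congr rfl fun i _ => Finset.sum_congr rfl fun j _ => ?_
    ring
  have hL : ∀ x : RSpace d, MemLp (fun g : RSpace d => ⟪x, g⟫) 2 (stdGaussian (RSpace d)) :=
    fun x => IsGaussian.memLp_two_id.const_inner x
  have hint : ∀ i j, Integrable (fun g => ⟪e i, g⟫ * ⟪e j, g⟫ * ⟪A (e i), B (e j)⟫)
      (stdGaussian (RSpace d)) := fun i j => ((hL _).integrable_mul (hL _)).mul_const _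
  simp only [hexp]
  rw [integral_finsetSum _ fun i _ => integrable_finsetSum _ fun j _ => hint i j]
  refine Finset.sum_congr rfl fun i _ => ?_
  rw [integral_finsetSum _ fun j _ => hint i j]
  simp only [integral_mul_const, integral_inner_mul_inner_stdGaussian]
  rw [Finset.sum_eq_single i]
  · simp [e]
  · intro j _ hj
    rw [e.inner_eq_zero hj.symm, zero_mul]
  · simp

lemma hsInner_comm (A B : RSpace d →L[ℝ] RSpace d) : hsInner A B = hsInner B A := by
  simp only [hsInner, real_inner_comm]

lemma hsInner_sub_self (A B : RSpace d →L[ℝ] RSpace d) :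
    hsInner (A - B) (A - B) = hsInner A A - 2 * hsInner A B + hsInner B B := by
  simp only [hsInner, Finset.mul_sum, ← Finset.sum_sub_distrib, ← Finset.sum_add_distrib]
  refine Finset.sum_congr rfl fun i _ => ?_
  simp only [sub_apply, inner_sub_left, inner_sub_right]
  rw [real_inner_comm (A _) (B _)]
  ring

lemma hsInner_self_nonneg (A : RSpace d →L[ℝ] RSpace d) : 0 ≤ hsInner A A :=
  Finset.sum_nonneg fun _ _ => real_inner_self_nonneg

/-- The quadratic form `⟪A x, B x⟫` of a centred random vector with law `P_# γ`. -/
lemma integral_inner_affineGaussian {Ω : Type*} [MeasurableSpace Ω] {Q : Measure Ω}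
    {X : Ω → RSpace d} (hX : Measurable X) {m : RSpace d} {P : RSpace d →L[ℝ] RSpace d}
    (hlaw : Q.map X = affineGaussian m P) (A B : RSpace d →L[ℝ] RSpace d) :
    ∫ ω, ⟪A (X ω - m), B (X ω - m)⟫ ∂Q = hsInner (A ∘L P) (B ∘L P) := by
  have h1 : ∫ ω, ⟪A (X ω - m), B (X ω - m)⟫ ∂Q = ∫ x, ⟪A (x - m), B (x - m)⟫ ∂(Q.map X) := by
    rw [integral_map hX.aemeasurable]
    exact Continuous.aestronglyMeasurable (by fun_prop)
  rw [h1, hlaw, affineGaussian, integral_map (by fun_prop)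
    (Continuous.aestronglyMeasurable (by fun_prop))]
  simp only [add_sub_cancel_left]
  exact integral_inner_clm_stdGaussian (A ∘L P) (B ∘L P)

lemma memLp_of_map_eq_affineGaussian {Ω : Type*} [MeasurableSpace Ω] {Q : Measure Ω}
    {X : Ω → RSpace d} (hX : Measurable X) {m : RSpace d} {P : RSpace d →L[ℝ] RSpace d}
    (hlaw : Q.map X = affineGaussian m P) : MemLp X 2 Q := by
  have h : MemLp id 2 (Q.map X) := by
    rw [hlaw, affineGaussian, memLp_map_measure_iff (by fun_prop) (by fun_prop)]
    exact (memLp_const m).add (memLp_clm_stdGaussian P)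
  exact (memLp_map_measure_iff (by fun_prop) hX.aemeasurable).1 h

lemma integral_affineGaussian {Ω : Type*} [MeasurableSpace Ω] {Q : Measure Ω}
    {X : Ω → RSpace d} (hX : Measurable X) {m : RSpace d} {P : RSpace d →L[ℝ] RSpace d}
    (hlaw : Q.map X = affineGaussian m P) : ∫ ω, X ω ∂Q = m := by
  have h1 : ∫ ω, X ω ∂Q = ∫ x, x ∂(Q.map X) := (integral_map (f := fun x : RSpace d => x)
    hX.aemeasurable (by fun_prop)).symm
  rw [h1, hlaw, affineGaussian, integral_map (by fun_prop) (by fun_prop)]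
  have hi : Integrable (fun g => P g) (stdGaussian (RSpace d)) :=
    (memLp_clm_stdGaussian P).integrable (by norm_num)
  rw [integral_add (integrable_const _) hi, P.integral_comp_comm IsGaussian.integrable_fun_id]
  simp

/-- For independent standard Gaussians `v`, `g` and `c² + s² = 1`, the vector `c v + s g` is
standard Gaussian. This is the invariance of `affineGaussian` under the Ornstein–Uhlenbeck
step `y ↦ m + c (y - m) + s P g`. -/
lemma map_ornsteinUhlenbeck_affineGaussian (m : RSpace d) (P : RSpace d →L[ℝ] RSpace d)
    {c s : ℝ} (hcs : c ^ 2 + s ^ 2 = 1) :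
    ((affineGaussian m P).prod (stdGaussian (RSpace d))).map
      (fun p => m + c • (p.1 - m) + s • P p.2) = affineGaussian m P := by
  have hstd : ((stdGaussian (RSpace d)).prod (stdGaussian (RSpace d))).map
      (fun p => c • p.1 + s • p.2) = stdGaussian (RSpace d) := by
    have hm : Measurable (fun p : RSpace d × RSpace d => c • p.1 + s • p.2) := by fun_prop
    have := Measure.isProbabilityMeasure_map
      (μ := (stdGaussian (RSpace d)).prod (stdGaussian (RSpace d))) hm.aemeasurable
    refine Measure.ext_of_charFun ?_
    ext t
    rw [charFun_apply, integral_map hm.aemeasurable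
      (Continuous.aestronglyMeasurable (by fun_prop)), charFun_stdGaussian]
    have : ∀ p : RSpace d × RSpace d, Complex.exp (⟪c • p.1 + s • p.2, t⟫ * Complex.I) =
        Complex.exp (⟪p.1, c • t⟫ * Complex.I) * Complex.exp (⟪p.2, s • t⟫ * Complex.I) := by
      intro p
      rw [← Complex.exp_add, inner_add_left, real_inner_smul_left, real_inner_smul_left,
        real_inner_smul_right, real_inner_smul_right]
      push_cast
      ring_nf
    simp only [this]
    rw [integral_prod_mul (fun x : RSpace d => Complex.exp (⟪x, c • t⟫ * Complex.I))
      (fun x : RSpace d => Complex.exp (⟪x, s • t⟫ * Complex.I)), ← charFun_apply, ← charFun_apply,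
      charFun_stdGaussian, charFun_stdGaussian, ← Complex.exp_add, norm_smul, norm_smul]
    congr 1
    have : (c : ℂ) ^ 2 + (s : ℂ) ^ 2 = 1 := by exact_mod_cast hcs
    have h2 : (|c| : ℝ) ^ 2 = c ^ 2 := sq_abs c
    have h3 : (|s| : ℝ) ^ 2 = s ^ 2 := sq_abs s
    rw [← Complex.ofReal_pow, ← Complex.ofReal_pow, mul_pow, mul_pow, Real.norm_eq_abs,
      Real.norm_eq_abs, h2, h3]
    push_cast
    linear_combination (-(‖t‖ : ℂ) ^ 2 / 2) * this
  have hprod : (affineGaussian m P).prod (stdGaussian (RSpace d)) =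
      ((stdGaussian (RSpace d)).prod (stdGaussian (RSpace d))).map
        (Prod.map (fun g => m + P g) id) := by
    rw [← Measure.map_prod_map _ _ (by fun_prop) (by fun_prop), Measure.map_id]
    rfl
  rw [hprod, Measure.map_map (by fun_prop) (by fun_prop)]
  conv_rhs => rw [affineGaussian, ← hstd, Measure.map_map (by fun_prop) (by fun_prop)]
  congr 1
  ext1 p
  simp [add_assoc]

end Gaussian

/-! ### The Wasserstein distance between commuting Gaussian measures -/

section Operators

variable {d : ℕ}

/-- The operator on Euclidean space given by a matrix. -/
noncomputable abbrev op (A : Matrix (Fin d) (Fin d) ℝ) : RSpace d →L[ℝ] RSpace d :=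
  Matrix.toEuclideanCLM (𝕜 := ℝ) A

lemma op_mul_apply (A B : Matrix (Fin d) (Fin d) ℝ) (x : RSpace d) :
    op (A * B) x = op A (op B x) := by
  simp [op, map_mul]

lemma op_inv_apply_op {A : Matrix (Fin d) (Fin d) ℝ} (hA : A.PosDef) (x : RSpace d) :
    op A⁻¹ (op A x) = x := by
  rw [← op_mul_apply, Matrix.nonsing_inv_mul _ ((Matrix.isUnit_iff_isUnit_det A).1 hA.isUnit)]
  simp [op]

lemma op_apply_op_inv {A : Matrix (Fin d) (Fin d) ℝ} (hA : A.PosDef) (x : RSpace d) :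
    op A (op A⁻¹ x) = x := by
  rw [← op_mul_apply, Matrix.mul_nonsing_inv _ ((Matrix.isUnit_iff_isUnit_det A).1 hA.isUnit)]
  simp [op]

lemma inner_op_left {A : Matrix (Fin d) (Fin d) ℝ} (hA : A.IsHermitian) (x y : RSpace d) :
    ⟪op A x, y⟫ = ⟪x, op A y⟫ := by
  have h : star (op A) = op A := by
    rw [op, ← map_star]
    congr 1
  conv_lhs => rw [← h, ContinuousLinearMap.star_eq_adjoint,
    ContinuousLinearMap.adjoint_inner_left]

lemma inner_op_self_pos {A : Matrix (Fin d) (Fin d) ℝ} (hA : A.PosDef) {x : RSpace d}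
    (hx : x ≠ 0) : 0 < ⟪x, op A x⟫ := by
  rw [Matrix.inner_toEuclideanCLM]
  have hx' : WithLp.ofLp x ≠ 0 := fun h => hx (by ext i; simpa using congrFun h i)
  simpa using hA.dotProduct_mulVec_pos hx'

lemma inner_op_self_nonneg {A : Matrix (Fin d) (Fin d) ℝ} (hA : A.PosSemidef) (x : RSpace d) :
    0 ≤ ⟪x, op A x⟫ := by
  rw [Matrix.inner_toEuclideanCLM]
  simpa using hA.dotProduct_mulVec_nonneg (WithLp.ofLp x)

open scoped MatrixOrder in
lemma posDef_mul_of_commute {A B : Matrix (Fin d) (Fin d) ℝ} (hA : A.PosDef) (hB : B.PosDef)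
    (h : Commute A B) : (A * B).PosDef := by
  rw [← Matrix.isStrictlyPositive_iff_posDef] at hA hB ⊢
  exact (hA.commute_iff hB).1 h

lemma hsInner_op_mul_one {A B : Matrix (Fin d) (Fin d) ℝ} (hA : A.IsHermitian) :
    hsInner (op A ∘L op B) (ContinuousLinearMap.id ℝ _) = hsInner (op A) (op B) := by
  refine Finset.sum_congr rfl fun i _ => ?_
  simp only [ContinuousLinearMap.comp_apply, ContinuousLinearMap.id_apply]
  rw [inner_op_left hA, real_inner_comm]

end Operators

section GaussianW2

variable {d : ℕ}

lemma lintegral_edist_sq {Ω : Type*} [MeasurableSpace Ω] {Q : Measure Ω} {X Y : Ω → RSpace d}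
    (hX : MemLp X 2 Q) (hY : MemLp Y 2 Q) :
    ∫⁻ ω, edist (X ω) (Y ω) ^ 2 ∂Q = ENNReal.ofReal (∫ ω, ‖X ω - Y ω‖ ^ 2 ∂Q) := by
  rw [ofReal_integral_eq_lintegral_ofReal
    (integrable_norm_sq_of_memLp (f := fun ω => X ω - Y ω) (hX.sub hY))
    (Eventually.of_forall fun ω => by positivity)]
  refine lintegral_congr fun ω => ?_
  rw [edist_dist, dist_eq_norm, ENNReal.ofReal_pow (norm_nonneg _)]

/-- The covariance of a coupling of two Gaussian measures with commuting covariances is at most the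
Hilbert–Schmidt product of their parameters. The defect vanishes only if both random vectors are
images of the same standard Gaussian vector. -/
theorem integral_inner_coupling_affineGaussian {Ω : Type*} [MeasurableSpace Ω] {Q : Measure Ω}
    [IsProbabilityMeasure Q] {X Y : Ω → RSpace d} (hX : Measurable X) (hY : Measurable Y)
    {m m' : RSpace d} {P R : Matrix (Fin d) (Fin d) ℝ} (hP : P.PosDef) (hR : R.PosDef)
    (hPR : Commute P R) (hlX : Q.map X = affineGaussian m (op P))
    (hlY : Q.map Y = affineGaussian m' (op R)) :
    ∫ ω, ⟪X ω - m, Y ω - m'⟫ ∂Q = hsInner (op P) (op R) -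
      (∫ ω, ⟪op P⁻¹ (X ω - m) - op R⁻¹ (Y ω - m'),
        op (P * R) (op P⁻¹ (X ω - m) - op R⁻¹ (Y ω - m'))⟫ ∂Q) / 2 := by
  have hX0 : MemLp (fun ω => X ω - m) 2 Q :=
    (memLp_of_map_eq_affineGaussian hX hlX).sub (memLp_const m)
  have hY0 : MemLp (fun ω => Y ω - m') 2 Q :=
    (memLp_of_map_eq_affineGaussian hY hlY).sub (memLp_const m')
  have hXYi : Integrable (fun ω => ⟪X ω - m, Y ω - m'⟫) Q := integrable_inner_of_memLp hX0 hY0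
  have hX1 : Integrable (fun ω => ⟪op R (X ω - m), op P⁻¹ (X ω - m)⟫) Q :=
    integrable_inner_of_memLp ((op R).comp_memLp' hX0) ((op P⁻¹).comp_memLp' hX0)
  have hY1 : Integrable (fun ω => ⟪op P (Y ω - m'), op R⁻¹ (Y ω - m')⟫) Q :=
    integrable_inner_of_memLp ((op P).comp_memLp' hY0) ((op R⁻¹).comp_memLp' hY0)
  have hdef : ∀ ω, ⟪op P⁻¹ (X ω - m) - op R⁻¹ (Y ω - m'),
        op (P * R) (op P⁻¹ (X ω - m) - op R⁻¹ (Y ω - m'))⟫ =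
      ⟪op R (X ω - m), op P⁻¹ (X ω - m)⟫ - 2 * ⟪X ω - m, Y ω - m'⟫ +
        ⟪op P (Y ω - m'), op R⁻¹ (Y ω - m')⟫ := by
    intro ω
    generalize hx : X ω - m = x
    generalize hy : Y ω - m' = y
    have e1 : op (P * R) (op P⁻¹ x) = op R x := by
      rw [hPR.eq, op_mul_apply, op_apply_op_inv hP]
    have e2 : op (P * R) (op R⁻¹ y) = op P y := by
      rw [op_mul_apply, op_apply_op_inv hR]
    rw [map_sub, e1, e2, inner_sub_left, inner_sub_right, inner_sub_right,
      ← inner_op_left hP.isHermitian, op_apply_op_inv hP, ← inner_op_left hR.isHermitian (op R⁻¹ y),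
      op_apply_op_inv hR, real_inner_comm x y, real_inner_comm (op R x),
      real_inner_comm (op P y)]
    ring
  have c1 : op P⁻¹ ∘L op P = ContinuousLinearMap.id ℝ (RSpace d) := by
    ext1 x; exact op_inv_apply_op hP x
  have c2 : op R⁻¹ ∘L op R = ContinuousLinearMap.id ℝ (RSpace d) := by
    ext1 x; exact op_inv_apply_op hR x
  simp only [hdef]
  rw [integral_add (hX1.sub' (hXYi.const_mul 2)) hY1, integral_sub hX1 (hXYi.const_mul 2),
    integral_const_mul, integral_inner_affineGaussian hX hlX, integral_inner_affineGaussian hY hlY,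
    c1, c2, hsInner_op_mul_one hR.isHermitian, hsInner_op_mul_one hP.isHermitian,
    hsInner_comm (op R) (op P)]
  ring

/-- The cost of a coupling of two Gaussian measures with commuting covariances is the squared
distance of their parameters plus a nonnegative defect. -/
theorem integral_norm_sub_sq_affineGaussian {Ω : Type*} [MeasurableSpace Ω] {Q : Measure Ω}
    [IsProbabilityMeasure Q] {X Y : Ω → RSpace d} (hX : Measurable X) (hY : Measurable Y)
    {m m' : RSpace d} {P R : Matrix (Fin d) (Fin d) ℝ} (hP : P.PosDef) (hR : R.PosDef)
    (hPR : Commute P R) (hlX : Q.map X = affineGaussian m (op P))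
    (hlY : Q.map Y = affineGaussian m' (op R)) :
    ∫ ω, ‖X ω - Y ω‖ ^ 2 ∂Q = ‖m - m'‖ ^ 2 + hsInner (op P - op R) (op P - op R) +
      ∫ ω, ⟪op P⁻¹ (X ω - m) - op R⁻¹ (Y ω - m'),
        op (P * R) (op P⁻¹ (X ω - m) - op R⁻¹ (Y ω - m'))⟫ ∂Q := by
  have hX2 := memLp_of_map_eq_affineGaussian hX hlX
  have hY2 := memLp_of_map_eq_affineGaussian hY hlY
  have hX0 : MemLp (fun ω => X ω - m) 2 Q := hX2.sub (memLp_const m)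
  have hY0 : MemLp (fun ω => Y ω - m') 2 Q := hY2.sub (memLp_const m')
  let I := ContinuousLinearMap.id ℝ (RSpace d)
  have hXi : Integrable (fun ω => ⟪I (X ω - m), I (X ω - m)⟫) Q :=
    integrable_inner_of_memLp hX0 hX0
  have hYi : Integrable (fun ω => ⟪I (Y ω - m'), I (Y ω - m')⟫) Q :=
    integrable_inner_of_memLp hY0 hY0
  have hXYi : Integrable (fun ω => ⟪X ω - m, Y ω - m'⟫) Q := integrable_inner_of_memLp hX0 hY0
  have hX00 : ∫ ω, (X ω - m) ∂Q = 0 := by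
    rw [integral_sub (hX2.integrable (by norm_num)) (integrable_const _),
      integral_affineGaussian hX hlX]
    simp
  have hY00 : ∫ ω, (Y ω - m') ∂Q = 0 := by
    rw [integral_sub (hY2.integrable (by norm_num)) (integrable_const _),
      integral_affineGaussian hY hlY]
    simp
  have hmean : ∫ ω, ⟪m - m', (X ω - m) - (Y ω - m')⟫ ∂Q = 0 := by
    have hi : Integrable (fun ω => (X ω - m) - (Y ω - m')) Q :=
      (hX0.sub hY0).integrable (by norm_num)
    have h1 := integral_inner (𝕜 := ℝ) hi (m - m')
    rw [h1, integral_sub (hX0.integrable (by norm_num)) (hY0.integrable (by norm_num)), hX00, hY00]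
    simp
  have hmi : Integrable (fun ω => ⟪m - m', (X ω - m) - (Y ω - m')⟫) Q :=
    integrable_inner_of_memLp (memLp_const _) (hX0.sub hY0)
  have hpt : ∀ ω, ‖X ω - Y ω‖ ^ 2 = ‖m - m'‖ ^ 2 + 2 * ⟪m - m', (X ω - m) - (Y ω - m')⟫ +
      ⟪I (X ω - m), I (X ω - m)⟫ - 2 * ⟪X ω - m, Y ω - m'⟫ +
      ⟪I (Y ω - m'), I (Y ω - m')⟫ := by
    intro ω
    have : X ω - Y ω = (m - m') + ((X ω - m) - (Y ω - m')) := by abel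
    rw [this, norm_add_sq_real, norm_sub_sq_real (X ω - m)]
    simp only [I, ContinuousLinearMap.id_apply, real_inner_self_eq_norm_sq]
    ring
  simp only [hpt]
  rw [integral_add ((((integrable_const _).fun_add (hmi.const_mul 2)).fun_add hXi).sub'
      (hXYi.const_mul 2)) hYi,
    integral_sub (((integrable_const _).fun_add (hmi.const_mul 2)).fun_add hXi)
      (hXYi.const_mul 2),
    integral_add ((integrable_const _).fun_add (hmi.const_mul 2)) hXi,
    integral_add (integrable_const _) (hmi.const_mul 2), integral_const_mul, integral_const_mul,
    hmean, integral_inner_coupling_affineGaussian hX hY hP hR hPR hlX hlY,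
    integral_inner_affineGaussian hX hlX, integral_inner_affineGaussian hY hlY, hsInner_sub_self]
  simp only [I, ContinuousLinearMap.id_comp, integral_const, probReal_univ, one_smul]
  ring

variable {m m' : RSpace d} {P R : Matrix (Fin d) (Fin d) ℝ}

lemma measurable_affine (m : RSpace d) (P : RSpace d →L[ℝ] RSpace d) :
    Measurable (fun g : RSpace d => m + P g) := by fun_prop

lemma lintegral_edist_affine_sq (m m' : RSpace d) (P R : RSpace d →L[ℝ] RSpace d) :
    ∫⁻ g, edist (m + P g) (m' + R g) ^ 2 ∂(stdGaussian (RSpace d)) =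
      ENNReal.ofReal (‖m - m'‖ ^ 2 + hsInner (P - R) (P - R)) := by
  rw [lintegral_edist_sq (X := fun g => m + P g) (Y := fun g => m' + R g)
    ((memLp_const m).add (memLp_clm_stdGaussian P))
    ((memLp_const m').add (memLp_clm_stdGaussian R))]
  congr 1
  have h1 : ∀ g : RSpace d, ‖m + P g - (m' + R g)‖ ^ 2 =
      ‖m - m'‖ ^ 2 + 2 * ⟪m - m', (P - R) g⟫ + ⟪(P - R) g, (P - R) g⟫ := by
    intro g
    have : m + P g - (m' + R g) = (m - m') + (P - R) g := by
      simp only [sub_apply]; abel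
    rw [this, norm_add_sq_real, real_inner_self_eq_norm_sq]
  have hL := memLp_clm_stdGaussian (P - R)
  have hi : Integrable (fun g => (P - R) g) (stdGaussian (RSpace d)) :=
    hL.integrable (by norm_num)
  have hi2 : Integrable (fun g => ⟪m - m', (P - R) g⟫) (stdGaussian (RSpace d)) :=
    integrable_inner_of_memLp (memLp_const _) hL
  simp only [h1]
  rw [integral_add ((integrable_const _).fun_add (hi2.const_mul 2))
      (integrable_inner_of_memLp hL hL),
    integral_add (integrable_const _) (hi2.const_mul 2), integral_const_mul,
    integral_inner_clm_stdGaussian, integral_inner (𝕜 := ℝ) hi,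
    (P - R).integral_comp_comm IsGaussian.integrable_fun_id]
  simp

lemma W2_sq_affineGaussian_le (m m' : RSpace d) (P R : RSpace d →L[ℝ] RSpace d) :
    W2 (affineGaussian m P) (affineGaussian m' R) ^ 2 ≤
      ENNReal.ofReal (‖m - m'‖ ^ 2 + hsInner (P - R) (P - R)) :=
  (W2_sq_le_of_map (P := stdGaussian (RSpace d)) (measurable_affine m P)
    (measurable_affine m' R) rfl rfl).trans_eq (lintegral_edist_affine_sq m m' P R)

lemma isProbabilityMeasure_of_mem_couplings {μ ν : Measure (RSpace d)} [IsProbabilityMeasure μ]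
    {γ : Measure (RSpace d × RSpace d)} (hγ : γ ∈ couplings μ ν) : IsProbabilityMeasure γ := by
  constructor
  have h : γ.map Prod.fst Set.univ = 1 := by rw [hγ.1]; exact measure_univ
  rwa [Measure.map_apply measurable_fst MeasurableSet.univ, Set.preimage_univ] at h

/-- The coupling through a common standard Gaussian vector is optimal. -/
theorem W2_sq_affineGaussian (hP : P.PosDef) (hR : R.PosDef) (hPR : Commute P R) :
    W2 (affineGaussian m (op P)) (affineGaussian m' (op R)) ^ 2 =
      ENNReal.ofReal (‖m - m'‖ ^ 2 + hsInner (op P - op R) (op P - op R)) := by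
  refine le_antisymm (W2_sq_affineGaussian_le _ _ _ _) ?_
  rw [W2_sq]
  refine le_iInf₂ fun γ hγ => ?_
  have := isProbabilityMeasure_of_mem_couplings hγ
  rw [lintegral_edist_sq (memLp_of_map_eq_affineGaussian measurable_fst hγ.1)
    (memLp_of_map_eq_affineGaussian measurable_snd hγ.2),
    integral_norm_sub_sq_affineGaussian measurable_fst measurable_snd hP hR hPR hγ.1 hγ.2]
  refine ENNReal.ofReal_le_ofReal (le_add_of_nonneg_right (integral_nonneg fun p => ?_))
  exact inner_op_self_nonneg (posDef_mul_of_commute hP hR hPR).posSemidef _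

lemma toReal_W2_affineGaussian_sq (hP : P.PosDef) (hR : R.PosDef) (hPR : Commute P R) :
    (W2 (affineGaussian m (op P)) (affineGaussian m' (op R))).toReal ^ 2 =
      ‖m - m'‖ ^ 2 + hsInner (op P - op R) (op P - op R) := by
  rw [← ENNReal.toReal_pow, W2_sq_affineGaussian hP hR hPR, ENNReal.toReal_ofReal]
  exact add_nonneg (by positivity) (hsInner_self_nonneg _)

lemma map_affineGaussian (hP : P.PosDef) :
    (affineGaussian m (op P)).map (fun x => m' + op R (op P⁻¹ (x - m))) =
      affineGaussian m' (op R) := by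
  rw [affineGaussian, Measure.map_map (by fun_prop) (by fun_prop)]
  congr 1
  ext1 g
  simp [op_inv_apply_op hP]

/-- The affine map between commuting Gaussian measures is an optimal transport map. -/
theorem isOptimalTransportMap_affineGaussian (hP : P.PosDef) (hR : R.PosDef)
    (hPR : Commute P R) :
    IsOptimalTransportMap (fun x => m' + op R (op P⁻¹ (x - m))) (affineGaussian m (op P))
      (affineGaussian m' (op R)) := by
  have hmeas : Measurable (fun x => m' + op R (op P⁻¹ (x - m))) := by fun_prop
  refine ⟨hmeas, map_affineGaussian hP, ?_⟩
  have hl1 : (affineGaussian m (op P)).map (fun x => x) = affineGaussian m (op P) :=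
    Measure.map_id
  rw [W2_sq_affineGaussian hP hR hPR,
    lintegral_edist_sq (memLp_of_map_eq_affineGaussian measurable_id' hl1)
      (memLp_of_map_eq_affineGaussian hmeas (map_affineGaussian hP)),
    integral_norm_sub_sq_affineGaussian measurable_id' hmeas hP hR hPR hl1 (map_affineGaussian hP)]
  simp [op_inv_apply_op hR]

/-- The optimal transport map between commuting Gaussian measures is unique up to null sets. -/
theorem ae_eq_affine_of_optimal {T : RSpace d → RSpace d} (hP : P.PosDef) (hR : R.PosDef)
    (hPR : Commute P R)
    (hT : IsOptimalTransportMap T (affineGaussian m (op P)) (affineGaussian m' (op R))) :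
    ∀ᵐ x ∂(affineGaussian m (op P)), T x = m' + op R (op P⁻¹ (x - m)) := by
  obtain ⟨hTm, hTl, hTc⟩ := hT
  have hl1 : (affineGaussian m (op P)).map (fun x => x) = affineGaussian m (op P) :=
    Measure.map_id
  have hid := memLp_of_map_eq_affineGaussian measurable_id' hl1
  have hT2 := memLp_of_map_eq_affineGaussian hTm hTl
  have hpd := posDef_mul_of_commute hP hR hPR
  let U : RSpace d → RSpace d := fun x => op P⁻¹ (x - m) - op R⁻¹ (T x - m')
  have hnn : ∀ x, 0 ≤ ⟪U x, op (P * R) (U x)⟫ := fun x => inner_op_self_nonneg hpd.posSemidef _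
  have hUL : MemLp U 2 (affineGaussian m (op P)) :=
    ((op P⁻¹).comp_memLp' (hid.sub (memLp_const m))).sub
      ((op R⁻¹).comp_memLp' (hT2.sub (memLp_const m')))
  rw [W2_sq_affineGaussian hP hR hPR, lintegral_edist_sq hid hT2,
    integral_norm_sub_sq_affineGaussian measurable_id' hTm hP hR hPR hl1 hTl,
    ENNReal.ofReal_eq_ofReal_iff
      (add_nonneg (add_nonneg (by positivity) (hsInner_self_nonneg _))
        (integral_nonneg hnn)) (add_nonneg (by positivity) (hsInner_self_nonneg _)),
    add_eq_left, integral_eq_zero_iff_of_nonneg hnn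
      (integrable_inner_of_memLp hUL ((op (P * R)).comp_memLp' hUL))] at hTc
  filter_upwards [hTc] with x hx
  have hU0 : U x = 0 := by
    by_contra h
    exact (inner_op_self_pos hpd h).ne' hx
  have : op P⁻¹ (x - m) = op R⁻¹ (T x - m') := sub_eq_zero.1 hU0
  rw [this, op_apply_op_inv hR]
  abel

end GaussianW2

/-! ### Small random displacements from density points -/

section Density

lemma tendsto_measure_zero_of_absolutelyContinuous {α ι : Type*} [MeasurableSpace α]
    {ξ μ : Measure α} [IsFiniteMeasure ξ] [SigmaFinite μ] (h : ξ ≪ μ) {l : Filter ι}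
    {A : ι → Set α} (hA : Tendsto (fun k => μ (A k)) l (𝓝 0)) :
    Tendsto (fun k => ξ (A k)) l (𝓝 0) := by
  have hfin : ∫⁻ x, ξ.rnDeriv μ x ∂μ ≠ ∞ := (Measure.lintegral_rnDeriv_lt_top ξ μ).ne
  have := tendsto_setLIntegral_zero hfin hA
  refine this.congr fun k => ?_
  conv_rhs => rw [← Measure.withDensity_rnDeriv_eq ξ μ h]
  rw [withDensity_apply' _ (A k)]

variable {d : ℕ}

/-- At a Lebesgue density point `x` of `s`, a Gaussian displacement of size `ε k → 0` leaves `s`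
with vanishing probability. -/
lemma tendsto_measure_displacement_notMem {γ : Measure (RSpace d)} [IsProbabilityMeasure γ]
    (hγ : γ ≪ volume) {s : Set (RSpace d)} (hs : MeasurableSet s) {x : RSpace d}
    (hx : Tendsto (fun r => volume (s ∩ Metric.closedBall x r) / volume (Metric.closedBall x r))
      (𝓝[>] 0) (𝓝 1))
    {B : RSpace d →L[ℝ] RSpace d} (hB : LinearMap.det (B : RSpace d →ₗ[ℝ] RSpace d) ≠ 0)
    {t : ℝ} (ht : 0 < t) {ε : ℕ → ℝ} (hε : ∀ k, 0 < ε k) (hε0 : Tendsto ε atTop (𝓝 0))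
    {z : ℕ → RSpace d} {C : ℝ} (hz : ∀ k, ‖z k‖ ≤ C * ε k) :
    Tendsto (fun k => γ {g | x + z k + (t * ε k) • B g ∉ s}) atTop (𝓝 0) := by
  rw [ENNReal.tendsto_nhds_zero]
  intro η hη
  obtain ⟨K, hK, hKη⟩ : ∃ K : Set (RSpace d), IsCompact K ∧ γ Kᶜ ≤ η / 2 := by
    have := isTightMeasureSet_iff_exists_isCompact_measure_compl_le.1
      (isTightMeasureSet_singleton (μ := γ)) (η / 2) (ENNReal.half_pos hη.ne')
    obtain ⟨K, hK, h⟩ := this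
    exact ⟨K, hK, h γ rfl⟩
  obtain ⟨R, hR⟩ := hK.isBounded.exists_norm_le
  -- for `g ∈ K` the displaced point lies in the ball of radius `C' * ε k` around `x`
  have hC0 : 0 ≤ C := by
    have := (norm_nonneg _).trans (hz 0)
    exact nonneg_of_mul_nonneg_left this (hε 0)
  have hR0 : 0 ≤ |R| := abs_nonneg R
  let C' := C + t * ‖B‖ * |R| + 1
  have hC' : 0 < C' := by positivity
  have hvol : Tendsto (fun k => volume (K ∩ {g | x + z k + (t * ε k) • B g ∉ s})) atTop (𝓝 0) := by
    let ρ : ℕ → ℝ≥0∞ := fun k => volume (s ∩ Metric.closedBall x (C' * ε k)) /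
      volume (Metric.closedBall x (C' * ε k))
    have hρ : Tendsto ρ atTop (𝓝 1) := by
      refine hx.comp (tendsto_nhdsWithin_iff.2 ⟨?_, Eventually.of_forall fun k => ?_⟩)
      · simpa using hε0.const_mul C'
      · exact mul_pos hC' (hε k)
    let D : ℝ≥0∞ := ENNReal.ofReal (|(LinearMap.det (B : RSpace d →ₗ[ℝ] RSpace d))⁻¹| *
      (C' / t) ^ d) * volume (Metric.ball (0 : RSpace d) 1)
    have hD : D ≠ ∞ := ENNReal.mul_ne_top ENNReal.ofReal_ne_top measure_ball_lt_top.ne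
    have hlim : Tendsto (fun k => D * (1 - ρ k)) atTop (𝓝 0) := by
      have h1 : Tendsto (fun k => 1 - ρ k) atTop (𝓝 (1 - 1)) :=
        ENNReal.Tendsto.sub tendsto_const_nhds hρ (Or.inl ENNReal.one_ne_top)
      rw [tsub_self] at h1
      simpa using ENNReal.Tendsto.const_mul h1 (Or.inr hD)
    refine tendsto_of_tendsto_of_tendsto_of_le_of_le tendsto_const_nhds hlim
      (fun _ => zero_le) fun k => ?_
    have hb : 0 < C' * ε k := mul_pos hC' (hε k)
    have htε : 0 < t * ε k := mul_pos ht (hε k)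
    have hsub : K ∩ {g | x + z k + (t * ε k) • B g ∉ s} ⊆
        ((t * ε k) • B) ⁻¹'
          ((fun y => (x + z k) + y) ⁻¹' (Metric.closedBall x (C' * ε k) \ s)) := by
      rintro g ⟨hgK, hgs⟩
      refine ⟨?_, hgs⟩
      rw [mem_closedBall_iff_norm]
      have e : (x + z k) + ((t * ε k) • B) g - x = z k + (t * ε k) • B g := by
        simp only [smul_apply]; abel
      rw [e]
      have h1 : ‖B g‖ ≤ ‖B‖ * |R| :=
        (B.le_opNorm g).trans (by gcongr; exact (hR g hgK).trans (le_abs_self R))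
      calc ‖z k + (t * ε k) • B g‖ ≤ C * ε k + (t * ε k) * (‖B‖ * |R|) := by
            refine (norm_add_le _ _).trans (add_le_add (hz k) ?_)
            rw [norm_smul, Real.norm_of_nonneg htε.le]
            gcongr
        _ ≤ C' * ε k := by simp only [C']; nlinarith [hε k]
    refine (measure_mono hsub).trans ?_
    have hdet : LinearMap.det (((t * ε k) • B : RSpace d →L[ℝ] RSpace d) :
        RSpace d →ₗ[ℝ] RSpace d) = (t * ε k) ^ d * LinearMap.det (B : RSpace d →ₗ[ℝ] RSpace d) := by
      have : (((t * ε k) • B : RSpace d →L[ℝ] RSpace d) : RSpace d →ₗ[ℝ] RSpace d) =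
        (t * ε k) • (B : RSpace d →ₗ[ℝ] RSpace d) := rfl
      rw [this, LinearMap.det_smul]
      simp
    rw [Measure.addHaar_preimage_continuousLinearMap _
      (by rw [hdet]; exact mul_ne_zero (pow_ne_zero _ htε.ne') hB), measure_preimage_add, hdet]
    have hfin : volume (Metric.closedBall x (C' * ε k)) ≠ ∞ := measure_closedBall_lt_top.ne
    have hpos : volume (Metric.closedBall x (C' * ε k)) ≠ 0 :=
      (Metric.measure_closedBall_pos _ _ hb).ne'
    have hdiff : volume (Metric.closedBall x (C' * ε k) \ s) =
        volume (Metric.closedBall x (C' * ε k)) * (1 - ρ k) := by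
      rw [← measure_inter_add_sdiff (Metric.closedBall x (C' * ε k)) hs] at hfin
      have h2 := measure_inter_add_sdiff (μ := volume) (Metric.closedBall x (C' * ε k)) hs
      have hf1 : volume (Metric.closedBall x (C' * ε k) ∩ s) ≠ ∞ :=
        ne_top_of_le_ne_top hfin le_self_add
      rw [ENNReal.mul_sub (fun _ _ => measure_closedBall_lt_top.ne), mul_one,
        ENNReal.mul_div_cancel hpos measure_closedBall_lt_top.ne, Set.inter_comm s]
      exact ENNReal.eq_sub_of_add_eq hf1 (by rw [add_comm]; exact h2)
    rw [hdiff, Measure.addHaar_closedBall _ _ hb.le, ← mul_assoc, ← mul_assoc]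
    refine le_of_eq ?_
    congr 1
    rw [← ENNReal.ofReal_mul (abs_nonneg _)]
    congr 2
    rw [finrank_euclideanSpace_fin, mul_inv, abs_mul, abs_of_pos (inv_pos.2 (pow_pos htε d)),
      div_pow, mul_pow, mul_pow]
    have h1 := (hε k).ne'
    have h2 := ht.ne'
    field_simp
  have hγK := tendsto_measure_zero_of_absolutelyContinuous hγ hvol
  rw [ENNReal.tendsto_nhds_zero] at hγK
  filter_upwards [hγK (η / 2) (ENNReal.half_pos hη.ne')] with k hk
  calc γ {g | x + z k + (t * ε k) • B g ∉ s}
      ≤ γ (K ∩ {g | x + z k + (t * ε k) • B g ∉ s}) + γ Kᶜ := by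
        refine (measure_mono fun g hg => ?_).trans (measure_union_le _ _)
        by_cases h : g ∈ K
        · exact Or.inl ⟨h, hg⟩
        · exact Or.inr h
    _ ≤ η / 2 + η / 2 := add_le_add hk hKη
    _ = η := ENNReal.add_halves η

/-- The displacement `(c - 1) (x - m) + s B g` with `c = √(1 - s²)` of an Ornstein–Uhlenbeck step
around `m`. -/
noncomputable def ouStep (m : RSpace d) (B : RSpace d →L[ℝ] RSpace d) (s : ℝ)
    (p : RSpace d × RSpace d) : RSpace d :=
  (√(1 - s ^ 2) - 1) • (p.1 - m) + s • B p.2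

lemma continuous_ouStep (m : RSpace d) (B : RSpace d →L[ℝ] RSpace d) (s : ℝ) :
    Continuous (ouStep m B s) := by
  unfold ouStep; fun_prop

/-- For a point `x` with law `ξ ≪ volume` and an independent Gaussian vector, the first `n` equally
spaced points of the segment from `x` along the displacement stay in any set of full
`ξ`-measure, with a probability that tends to one with the size of the displacement. -/
lemma tendsto_measure_ouStep_segment_notMem {γ ξ : Measure (RSpace d)} [IsProbabilityMeasure γ]
    [IsProbabilityMeasure ξ] (hγ : γ ≪ volume) (hξ : ξ ≪ volume) {S : Set (RSpace d)}
    (hS : MeasurableSet S) (hS0 : ξ Sᶜ = 0) (m : RSpace d)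
    {B : RSpace d →L[ℝ] RSpace d} (hB : LinearMap.det (B : RSpace d →ₗ[ℝ] RSpace d) ≠ 0)
    (n : ℕ) {ε : ℕ → ℝ} (hε : ∀ k, 0 < ε k) (hε1 : ∀ k, ε k ≤ 1) (hε0 : Tendsto ε atTop (𝓝 0)) :
    Tendsto (fun k => (ξ.prod γ) {p | ∃ j ≤ n, p.1 + ((j : ℝ) / n) • ouStep m B (ε k) p ∉ S})
      atTop (𝓝 0) := by
  have hdens : ∀ᵐ x ∂ξ, Tendsto (fun r => volume (S ∩ Metric.closedBall x r) /
      volume (Metric.closedBall x r)) (𝓝[>] 0) (𝓝 1) := by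
    have h1 := Besicovitch.ae_tendsto_measure_inter_div (volume : Measure (RSpace d)) S
    have hac : ξ ≪ volume.restrict S := by
      refine Measure.AbsolutelyContinuous.mk fun N hN h0 => ?_
      rw [Measure.restrict_apply hN] at h0
      refine le_antisymm ?_ zero_le
      calc ξ N ≤ ξ (N ∩ S) + ξ Sᶜ := (measure_mono fun y hy => by
            by_cases h : y ∈ S
            · exact Or.inl ⟨hy, h⟩
            · exact Or.inr h).trans (measure_union_le _ _)
        _ = 0 := by rw [hξ h0, hS0, add_zero]
    exact hac.ae_le h1
  have hmeas : ∀ (t s : ℝ),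
      MeasurableSet {p : RSpace d × RSpace d | p.1 + t • ouStep m B s p ∉ S} :=
    fun t s => (show Continuous fun p : RSpace d × RSpace d => p.1 + t • ouStep m B s p from
      continuous_fst.add ((continuous_ouStep m B s).const_smul t)).measurable hS.compl
  have hone : ∀ t : ℝ, 0 ≤ t → Tendsto (fun k => (ξ.prod γ)
      {p | p.1 + t • ouStep m B (ε k) p ∉ S}) atTop (𝓝 0) := by
    intro t ht
    rcases ht.eq_or_lt with rfl | ht
    · refine tendsto_const_nhds.congr fun k => ?_
      have : {p : RSpace d × RSpace d | p.1 + (0 : ℝ) • ouStep m B (ε k) p ∉ S} =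
        Sᶜ ×ˢ Set.univ := by ext p; simp
      rw [this, Measure.prod_prod, hS0, zero_mul]
    · have h1 : ∀ k, (ξ.prod γ) {p | p.1 + t • ouStep m B (ε k) p ∉ S} =
          ∫⁻ x, γ {g | x + t • ouStep m B (ε k) (x, g) ∉ S} ∂ξ := fun k => by
        rw [Measure.prod_apply (hmeas _ _)]; rfl
      simp only [h1]
      rw [← lintegral_zero (μ := ξ)]
      refine tendsto_lintegral_of_dominated_convergence (fun _ => 1)
        (fun k => measurable_measure_prodMk_left (hmeas t (ε k)))
        (fun k => Eventually.of_forall fun x => prob_le_one) (by simp) ?_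
      filter_upwards [hdens] with x hx
      have := tendsto_measure_displacement_notMem hγ hS hx hB ht hε hε0
        (z := fun k => (t * (√(1 - ε k ^ 2) - 1)) • (x - m)) (C := t * ‖x - m‖) (fun k => ?_)
      · refine this.congr fun k => ?_
        congr 1
        ext g
        simp only [ouStep, smul_add, smul_smul, add_assoc]
      · have he := hε k
        have he1 := hε1 k
        have hs1 : 1 - ε k ≤ √(1 - ε k ^ 2) := by
          refine Real.le_sqrt_of_sq_le ?_
          nlinarith
        have hs2 : √(1 - ε k ^ 2) ≤ 1 := Real.sqrt_le_one.2 (by nlinarith)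
        rw [norm_smul, norm_mul, Real.norm_of_nonneg ht.le, Real.norm_eq_abs, abs_sub_comm,
          abs_of_nonneg (by linarith)]
        have : t * (1 - √(1 - ε k ^ 2)) * ‖x - m‖ = t * ‖x - m‖ * (1 - √(1 - ε k ^ 2)) := by ring
        rw [this]
        gcongr
        linarith
  have hsum : Tendsto (fun k => ∑ j ∈ range (n + 1), (ξ.prod γ)
      {p | p.1 + ((j : ℝ) / n) • ouStep m B (ε k) p ∉ S}) atTop (𝓝 0) := by
    rw [← Finset.sum_const_zero (s := range (n + 1))]
    exact tendsto_finsetSum _ fun j _ => hone _ (by positivity)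
  refine tendsto_of_tendsto_of_tendsto_of_le_of_le tendsto_const_nhds hsum
    (fun _ => zero_le) fun k => ?_
  refine (measure_mono ?_).trans (measure_biUnion_finset_le (range (n + 1)) _)
  rintro p ⟨j, hj, hp⟩
  exact Set.mem_biUnion (Finset.mem_coe.2 (Finset.mem_range.2 (Nat.lt_succ_of_le hj))) hp

end Density

/-! ### Karcher means of Gaussian measures -/

section Gain

variable {E ι : Type*} [NormedAddCommGroup E] [InnerProductSpace ℝ E] [Fintype ι]
  {w : ι → ℝ} {T : ι → E → E} {φ ψ : ι → E → ℝ} {S : Set E}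

/-- Moving the targets `T j x` to points `y j` with barycentre `x + δ` increases the weighted sum of
the conjugate potentials to first order by at least `⟪x, δ⟫`. -/
lemma inner_le_sum_conjugate_sub (hw : ∀ j, 0 ≤ w j) (hT : ∀ x ∈ S, ∑ j, w j • T j x = x)
    (hψT : ∀ j, ∀ a ∈ S, ψ j (T j a) = ⟪a, T j a⟫ - φ j a)
    {y : ι → E} (hψ : ∀ j, ∀ a ∈ S, ⟪a, y j⟫ - φ j a ≤ ψ j (y j))
    {x δ : E} (hx : x ∈ S) (hy : ∑ j, w j • y j = x + δ) {a : E} (ha : a ∈ S) :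
    ⟪a, x + δ⟫ - ∑ j, w j * φ j a - (⟪x, x⟫ - ∑ j, w j * φ j x) ≤
      ∑ j, w j * (ψ j (y j) - ψ j (T j x)) := by
  have h1 : ⟪a, x + δ⟫ = ∑ j, w j * ⟪a, y j⟫ := by
    rw [← hy, inner_sum]; simp only [real_inner_smul_right]
  have h2 : ⟪x, x⟫ = ∑ j, w j * ⟪x, T j x⟫ := by
    conv_lhs => rw [← hT x hx]
    rw [sum_inner]
    refine Finset.sum_congr rfl fun j _ => ?_
    rw [real_inner_smul_left, hT x hx, real_inner_comm]
  rw [h1, h2, ← Finset.sum_sub_distrib, ← Finset.sum_sub_distrib, ← Finset.sum_sub_distrib]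
  refine Finset.sum_le_sum fun j _ => ?_
  rw [hψT j x hx, ← mul_sub, ← mul_sub, ← mul_sub]
  exact mul_le_mul_of_nonneg_left (by linarith [hψ j a ha]) (hw j)

/-- If the segment from `x` to `x + δ` visits `S` at `n + 1` equally spaced points, then there is
also a second-order gain. On `S` the convex function `∑ j, w j * φ j` has the subgradient `x` at
`x`, so along the segment it grows at most as fast as a Riemann sum for `‖x‖² / 2`. -/
lemma inner_add_le_sum_conjugate_sub (hw : ∀ j, 0 ≤ w j) (hT : ∀ x ∈ S, ∑ j, w j • T j x = x)
    (hφ : ∀ j, ∀ a ∈ S, ∀ b ∈ S, φ j a + ⟪T j a, b - a⟫ ≤ φ j b)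
    (hψT : ∀ j, ∀ a ∈ S, ψ j (T j a) = ⟪a, T j a⟫ - φ j a)
    {y : ι → E} (hψ : ∀ j, ∀ a ∈ S, ⟪a, y j⟫ - φ j a ≤ ψ j (y j))
    {x δ : E} (hy : ∑ j, w j • y j = x + δ) {n : ℕ} (hn : n ≠ 0)
    (hS : ∀ k ≤ n, x + ((k : ℝ) / n) • δ ∈ S) :
    ⟪x, δ⟫ + (1 - 1 / n) / 2 * ‖δ‖ ^ 2 ≤ ∑ j, w j * (ψ j (y j) - ψ j (T j x)) := by
  have hn' : (n : ℝ) ≠ 0 := Nat.cast_ne_zero.2 hn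
  have hx : x ∈ S := by simpa using hS 0 (Nat.zero_le _)
  have hxδ : x + δ ∈ S := by simpa [hn'] using hS n le_rfl
  let F : E → ℝ := fun a => ∑ j, w j * φ j a
  have hF : ∀ a ∈ S, ∀ b ∈ S, F a + ⟪a, b - a⟫ ≤ F b := by
    intro a ha b hb
    have h1 : ⟪a, b - a⟫ = ∑ j, w j * ⟪T j a, b - a⟫ := by
      conv_lhs => rw [← hT a ha]
      rw [sum_inner]
      refine Finset.sum_congr rfl fun j _ => ?_
      rw [real_inner_smul_left, hT a ha]
    simp only [F]
    rw [h1, ← Finset.sum_add_distrib]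
    refine Finset.sum_le_sum fun j _ => ?_
    rw [← mul_add]
    exact mul_le_mul_of_nonneg_left (hφ j a ha b hb) (hw j)
  have hstep : ∀ k < n, F (x + (((k + 1 : ℕ) : ℝ) / n) • δ) - F (x + ((k : ℝ) / n) • δ) ≤
      ⟪x, δ⟫ / n + ((k : ℝ) + 1) * (‖δ‖ ^ 2 / n ^ 2) := by
    intro k hk
    have h1 := hF _ (hS (k + 1) hk) _ (hS k hk.le)
    have h2 : x + ((k : ℝ) / n) • δ - (x + (((k + 1 : ℕ) : ℝ) / n) • δ) = (-(1 / n : ℝ)) • δ := by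
      rw [add_sub_add_left_eq_sub, ← sub_smul]
      congr 1
      push_cast
      ring
    rw [h2, real_inner_smul_right, inner_add_left, real_inner_smul_left,
      real_inner_self_eq_norm_sq] at h1
    push_cast at h1 ⊢
    have h3 : ⟪x, δ⟫ / n + ((k : ℝ) + 1) * (‖δ‖ ^ 2 / n ^ 2) =
      1 / n * (⟪x, δ⟫ + (k + 1) / n * ‖δ‖ ^ 2) := by field_simp
    rw [h3]
    linarith
  have hsum := Finset.sum_le_sum fun k hk => hstep k (Finset.mem_range.1 hk)
  rw [Finset.sum_range_sub (fun k : ℕ => F (x + ((k : ℝ) / n) • δ)), Finset.sum_add_distrib,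
    ← Finset.sum_mul] at hsum
  have hgauss : ∑ k ∈ range n, ((k : ℝ) + 1) = n * (n + 1) / 2 := by
    clear hsum hstep hS hn hn'
    induction n with
    | zero => simp
    | succ n ih => rw [Finset.sum_range_succ, ih]; push_cast; ring
  rw [hgauss] at hsum
  simp only [div_self hn', one_smul, Nat.cast_zero, zero_div, zero_smul, add_zero, sum_const,
    card_range, nsmul_eq_mul] at hsum
  have h4 := inner_le_sum_conjugate_sub hw hT hψT hψ hx hy hxδ
  rw [real_inner_self_eq_norm_sq, norm_add_sq_real, real_inner_self_eq_norm_sq] at h4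
  have h5 : (n : ℝ) * (⟪x, δ⟫ / n) + n * (n + 1) / 2 * (‖δ‖ ^ 2 / n ^ 2) =
      ⟪x, δ⟫ + (1 + 1 / n) / 2 * ‖δ‖ ^ 2 := by field_simp
  rw [h5] at hsum
  simp only [F] at hsum
  linarith

end Gain

section Karcher

variable {d : ℕ} {ξ : Measure (RSpace d)}

lemma map_ornsteinUhlenbeck_prod [IsProbabilityMeasure ξ] {T : RSpace d → RSpace d} {μ : RSpace d}
    {P : RSpace d →L[ℝ] RSpace d} (hTm : Measurable T)
    (hTl : ξ.map T = affineGaussian μ P) {c s : ℝ} (hcs : c ^ 2 + s ^ 2 = 1) :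
    (ξ.prod (stdGaussian (RSpace d))).map (fun p => μ + c • (T p.1 - μ) + s • P p.2) =
      affineGaussian μ P := by
  rw [← map_ornsteinUhlenbeck_affineGaussian μ P hcs, ← hTl]
  have : (ξ.map T).prod (stdGaussian (RSpace d)) =
      (ξ.prod (stdGaussian (RSpace d))).map (Prod.map T id) := by
    rw [← Measure.map_prod_map _ _ hTm measurable_id, Measure.map_id]
  rw [this, Measure.map_map (by fun_prop) (hTm.prodMap measurable_id)]
  rfl

lemma integrable_conjugate_comp [IsProbabilityMeasure ξ] {T : RSpace d → RSpace d} {μ : RSpace d}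
    {P : RSpace d →L[ℝ] RSpace d} {φ ψ : RSpace d → ℝ} {S : Set (RSpace d)} (hTm : Measurable T)
    (hTl : ξ.map T = affineGaussian μ P) (hL : MemLp (fun x => x) 2 ξ) (hψm : Measurable ψ)
    (hS0 : ξ Sᶜ = 0)
    (hφ : ∀ a ∈ S, ∀ b ∈ S, φ a + ⟪T a, b - a⟫ ≤ φ b)
    (hψT : ∀ a ∈ S, ψ (T a) = ⟪a, T a⟫ - φ a) : Integrable (fun x => ψ (T x)) ξ := by
  have hae : ∀ᵐ x ∂ξ, x ∈ S := by rwa [ae_iff]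
  obtain ⟨x₀, hx₀⟩ := hae.exists
  have hTL := memLp_of_map_eq_affineGaussian hTm hTl
  -- `ψ ∘ T` lies between the bounds that come from the subgradients at `x` and at `x₀`
  refine integrable_of_le_of_le (hψm.comp hTm).aestronglyMeasurable
    (g₁ := fun x => ⟪x₀, T x⟫ - φ x₀) (g₂ := fun x => ⟪x, T x⟫ - φ x₀ - ⟪T x₀, x - x₀⟫) ?_ ?_ ?_ ?_
  · filter_upwards [hae] with x hx
    have h1 := hφ x hx x₀ hx₀
    rw [hψT x hx]
    rw [inner_sub_right, real_inner_comm x₀, real_inner_comm x] at h1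
    linarith
  · filter_upwards [hae] with x hx
    have h1 := hφ x₀ hx₀ x hx
    rw [hψT x hx]
    linarith
  · exact (integrable_inner_of_memLp (memLp_const _) hTL).sub' (integrable_const _)
  · exact ((integrable_inner_of_memLp hL hTL).sub' (integrable_const _)).sub'
      (integrable_inner_of_memLp (memLp_const _) (hL.sub (memLp_const _)))

variable {ι : Type*} [Fintype ι] {w : ι → ℝ} {T : ι → RSpace d → RSpace d} {μ : ι → RSpace d}
  {P : ι → RSpace d →L[ℝ] RSpace d}

lemma integral_eq_sum_of_ae_eq [IsProbabilityMeasure ξ] (hTm : ∀ j, Measurable (T j))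
    (hTl : ∀ j, ξ.map (T j) = affineGaussian (μ j) (P j))
    (hT : ∀ᵐ x ∂ξ, ∑ j, w j • T j x = x) : ∫ x, x ∂ξ = ∑ j, w j • μ j := by
  rw [← integral_congr_ae hT, integral_finsetSum]
  · refine Finset.sum_congr rfl fun j _ => ?_
    rw [integral_smul, integral_affineGaussian (hTm j) (hTl j)]
  · intro j _
    have hi : Integrable (T j) ξ :=
      (memLp_of_map_eq_affineGaussian (hTm j) (hTl j)).integrable (by norm_num)
    exact hi.smul (w j)

lemma memLp_id_of_ae_eq (hTm : ∀ j, Measurable (T j))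
    (hTl : ∀ j, ξ.map (T j) = affineGaussian (μ j) (P j))
    (hT : ∀ᵐ x ∂ξ, ∑ j, w j • T j x = x) : MemLp (fun x => x) 2 ξ := by
  refine MemLp.ae_eq hT (memLp_finsetSum _ fun j _ => ?_)
  exact (memLp_of_map_eq_affineGaussian (hTm j) (hTl j)).const_smul (w j)

end Karcher

/-! ### The density of the standard Gaussian measure -/

section StdDensity

/-- The density of the standard Gaussian measure. -/
noncomputable def stdGaussianDensity (d : ℕ) (x : RSpace d) : ℝ :=
  (2 * Real.pi) ^ (-(d : ℝ) / 2) * Real.exp (-(1 / 2) * ‖x‖ ^ 2)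

variable {d : ℕ}

lemma stdGaussianDensity_pos (x : RSpace d) : 0 < stdGaussianDensity d x := by
  unfold stdGaussianDensity; positivity

lemma continuous_stdGaussianDensity : Continuous (stdGaussianDensity d) := by
  unfold stdGaussianDensity; fun_prop

lemma integrable_stdGaussianDensity : Integrable (stdGaussianDensity d) := by
  refine Integrable.const_mul ?_ _
  have h := (GaussianFourier.integrable_cexp_neg_mul_sq_norm_add (V := RSpace d) (b := 1 / 2)
    (by norm_num) 0 0).norm
  refine h.congr (Eventually.of_forall fun x => ?_)
  simp only [Complex.norm_exp]
  congr 1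
  have : (-(1 / 2 : ℂ) * (‖x‖ : ℂ) ^ 2 + 0 * ((⟪(0 : RSpace d), x⟫ : ℝ) : ℂ)) =
    ((-(1 / 2) * ‖x‖ ^ 2 : ℝ) : ℂ) := by push_cast; ring
  rw [this, Complex.ofReal_re]

theorem stdGaussian_eq_withDensity : stdGaussian (RSpace d) =
    volume.withDensity fun x => ENNReal.ofReal (stdGaussianDensity d x) := by
  have hfin : IsFiniteMeasure ((volume : Measure (RSpace d)).withDensity
      fun x => ENNReal.ofReal (stdGaussianDensity d x)) :=
    isFiniteMeasure_withDensity_ofReal integrable_stdGaussianDensity.2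
  refine Measure.ext_of_charFun ?_
  ext t
  rw [charFun_stdGaussian, charFun_apply, integral_withDensity_eq_integral_toReal_smul
    continuous_stdGaussianDensity.measurable.ennreal_ofReal
    (Eventually.of_forall fun _ => ENNReal.ofReal_lt_top)]
  have h1 : ∀ x : RSpace d, (ENNReal.ofReal (stdGaussianDensity d x)).toReal •
      Complex.exp (⟪x, t⟫ * Complex.I) = (((2 * Real.pi) ^ (-(d : ℝ) / 2) : ℝ) : ℂ) *
      Complex.exp (-(1 / 2 : ℂ) * (‖x‖ : ℂ) ^ 2 + Complex.I * ((⟪t, x⟫ : ℝ) : ℂ)) := by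
    intro x
    rw [ENNReal.toReal_ofReal (stdGaussianDensity_pos x).le, stdGaussianDensity, Complex.exp_add,
      real_inner_comm]
    simp only [Complex.real_smul]
    push_cast
    ring_nf
  simp only [h1]
  rw [integral_const_mul, GaussianFourier.integral_cexp_neg_mul_sq_norm_add (by norm_num)]
  have h2 : ((Real.pi : ℂ) / (1 / 2)) ^ ((Module.finrank ℝ (RSpace d) : ℂ) / 2) =
      (((2 * Real.pi) ^ ((d : ℝ) / 2) : ℝ) : ℂ) := by
    rw [finrank_euclideanSpace_fin, Complex.ofReal_cpow (by positivity)]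
    congr 1
    · push_cast; ring
    · push_cast; ring
  rw [h2, ← mul_assoc, ← Complex.ofReal_mul, ← Real.rpow_add (by positivity)]
  simp only [Complex.I_sq]
  rw [show -(d : ℝ) / 2 + d / 2 = 0 by ring, Real.rpow_zero]
  push_cast
  rw [one_mul]
  congr 1
  ring

lemma stdGaussian_absolutelyContinuous : stdGaussian (RSpace d) ≪ volume := by
  rw [stdGaussian_eq_withDensity]
  exact withDensity_absolutelyContinuous _ _

end StdDensity

/-! ### The variance of a Karcher mean -/

section KarcherLower

variable {d : ℕ} {ι : Type*} [Fintype ι] {ξ : Measure (RSpace d)} [IsProbabilityMeasure ξ]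
  {w : ι → ℝ} {T : ι → RSpace d → RSpace d} {μ : ι → RSpace d}
  {P : ι → RSpace d →L[ℝ] RSpace d} {S : Set (RSpace d)}

/-- One Ornstein–Uhlenbeck step, simultaneously for all targets and with the same noise: on average
it does not change the conjugate potentials, so the second-order gain is bounded by the first-order
loss `(1 - c) ∫ ‖x - m‖²`. -/
lemma integral_indicator_ouStep_le (hw : ∀ j, 0 ≤ w j)
    (hTm : ∀ j, Measurable (T j)) (hTl : ∀ j, ξ.map (T j) = affineGaussian (μ j) (P j))
    (hSm : MeasurableSet S) (hS0 : ξ Sᶜ = 0) (hcm : ∀ j, CyclicallyMonotoneOn (T j) S)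
    (hT : ∀ x ∈ S, ∑ j, w j • T j x = x) {n : ℕ} (hn : n ≠ 0) {s : ℝ} (hs0 : 0 ≤ s) (hs1 : s ≤ 1) :
    (1 - 1 / n) / 2 * ∫ p, {p | ∀ j ≤ n, p.1 + ((j : ℝ) / n) •
        ouStep (∑ j, w j • μ j) (∑ j, w j • P j) s p ∈ S}.indicator
        (fun p => ‖ouStep (∑ j, w j • μ j) (∑ j, w j • P j) s p‖ ^ 2) p
        ∂(ξ.prod (stdGaussian (RSpace d))) ≤
      (1 - √(1 - s ^ 2)) * ∫ x, ‖x - ∑ j, w j • μ j‖ ^ 2 ∂ξ := by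
  have hSae : ∀ᵐ x ∂ξ, x ∈ S := by rwa [ae_iff]
  have hTae : ∀ᵐ x ∂ξ, ∑ j, w j • T j x = x := hSae.mono hT
  have hL := memLp_id_of_ae_eq hTm hTl hTae
  have hmean := integral_eq_sum_of_ae_eq hTm hTl hTae
  choose φ ψ Y hψm hYm hTY hφ hψ hψT using fun j => (hcm j).exists_conjugate
  set m := ∑ j, w j • μ j with hm
  set B := ∑ j, w j • P j with hB
  set c := √(1 - s ^ 2) with hc
  have hcs : c ^ 2 + s ^ 2 = 1 := by
    rw [hc, Real.sq_sqrt (by nlinarith)]; ring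
  set Q := ξ.prod (stdGaussian (RSpace d)) with hQ
  set G := {p : RSpace d × RSpace d | ∀ j ≤ n, p.1 + ((j : ℝ) / n) • ouStep m B s p ∈ S} with hG
  have hGm : MeasurableSet G := by
    have : G = ⋂ j ∈ Set.Iic n, {p | p.1 + ((j : ℝ) / n) • ouStep m B s p ∈ S} := by
      ext p; simp [G]
    rw [this]
    refine MeasurableSet.biInter (Set.to_countable _) fun j _ => ?_
    exact (continuous_fst.add ((continuous_ouStep m B s).const_smul ((j : ℝ) / n))).measurable hSm
  let y : ι → RSpace d × RSpace d → RSpace d := fun j p => μ j + c • (T j p.1 - μ j) + s • P j p.2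
  have hym : ∀ j, Measurable (y j) := fun j => by
    have : Measurable fun p : RSpace d × RSpace d => T j p.1 := (hTm j).comp measurable_fst
    fun_prop
  have hyl : ∀ j, Q.map (y j) = affineGaussian (μ j) (P j) := fun j =>
    map_ornsteinUhlenbeck_prod (hTm j) (hTl j) hcs
  have hfst : MeasurePreserving Prod.fst Q ξ := measurePreserving_fst
  -- the conjugate potentials have the same integral before and after the step
  have hψi : ∀ j, Integrable (fun x => ψ j (T j x)) ξ := fun j =>
    integrable_conjugate_comp (hTm j) (hTl j) hL (hψm j) hS0 (hφ j) (hψT j)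
  have hψi' : ∀ j, Integrable (ψ j) (affineGaussian (μ j) (P j)) := fun j => by
    rw [← hTl j]
    exact (integrable_map_measure (hψm j).aestronglyMeasurable (hTm j).aemeasurable).2 (hψi j)
  have hψy : ∀ j, Integrable (fun p => ψ j (y j p)) Q := fun j =>
    (integrable_map_measure (hψm j).aestronglyMeasurable (hym j).aemeasurable).1
      (by rw [hyl j]; exact hψi' j)
  have hψx : ∀ j, Integrable (fun p : RSpace d × RSpace d => ψ j (T j p.1)) Q := fun j =>
    hfst.integrable_comp_of_integrable (hψi j)
  have hψeq : ∀ j, ∫ p, ψ j (y j p) ∂Q = ∫ p, ψ j (T j p.1) ∂Q := by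
    intro j
    have h1 : ∫ p, ψ j (y j p) ∂Q = ∫ z, ψ j z ∂(affineGaussian (μ j) (P j)) := by
      rw [← hyl j, integral_map (hym j).aemeasurable (hψm j).aestronglyMeasurable]
    have h2 : ∫ p, ψ j (T j p.1) ∂Q = ∫ z, ψ j z ∂(affineGaussian (μ j) (P j)) := by
      rw [← hTl j, integral_map (hTm j).aemeasurable (hψm j).aestronglyMeasurable,
        ← hfst.map_eq, integral_map (f := fun x => ψ j (T j x)) measurable_fst.aemeasurable
        ((hψm j).comp (hTm j)).aestronglyMeasurable]
    rw [h1, h2]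
  -- the gain is of second order where the segment visits `S`, and of first order elsewhere
  have hYae : ∀ᵐ p ∂Q, ∀ j, y j p ∈ Y j := by
    refine ae_all_iff.2 fun j => ?_
    have h1 : ∀ᵐ z ∂(affineGaussian (μ j) (P j)), z ∈ Y j := by
      rw [← hTl j, ae_map_iff (p := fun z => z ∈ Y j) (hTm j).aemeasurable (hYm j)]
      exact hSae.mono fun x hx => hTY j x hx
    rw [← hyl j] at h1
    exact ae_of_ae_map (hym j).aemeasurable h1
  have hSQ : ∀ᵐ p ∂Q, p.1 ∈ S := hfst.quasiMeasurePreserving.ae hSae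
  have hsumy : ∀ p : RSpace d × RSpace d, p.1 ∈ S → ∑ j, w j • y j p = p.1 + ouStep m B s p := by
    intro p hp
    have h1 : ∑ j, w j • y j p = m + c • (∑ j, w j • T j p.1 - m) + s • B p.2 := by
      simp only [y, hm, hB, smul_add, smul_sub, Finset.sum_add_distrib, Finset.sum_sub_distrib,
        Finset.smul_sum, _root_.sum_apply, smul_apply, smul_comm (w _)]
    rw [h1, hT p.1 hp, ouStep, ← hc]
    module
  have hpt : ∀ᵐ p ∂Q, ⟪p.1, ouStep m B s p⟫ + (1 - 1 / n) / 2 *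
      G.indicator (fun p => ‖ouStep m B s p‖ ^ 2) p ≤
      ∑ j, w j * (ψ j (y j p) - ψ j (T j p.1)) := by
    filter_upwards [hYae, hSQ] with p hpY hpS
    by_cases hpG : p ∈ G
    · rw [Set.indicator_of_mem hpG]
      exact inner_add_le_sum_conjugate_sub hw hT hφ hψT (y := fun j => y j p)
        (fun j => hψ j _ (hpY j)) (hsumy p hpS) hn hpG
    · rw [Set.indicator_of_notMem hpG, mul_zero, add_zero]
      have := inner_le_sum_conjugate_sub hw hT hψT (y := fun j => y j p)
        (fun j => hψ j _ (hpY j)) hpS (hsumy p hpS) hpS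
      rw [inner_add_right] at this
      linarith
  have hL1 : MemLp (fun p : RSpace d × RSpace d => p.1) 2 Q := hL.comp_measurePreserving hfst
  have hL1m : MemLp (fun p : RSpace d × RSpace d => p.1 - m) 2 Q := hL1.sub (memLp_const m)
  have hsnd : MeasurePreserving Prod.snd Q (stdGaussian (RSpace d)) := measurePreserving_snd
  have hL2 : MemLp (fun p : RSpace d × RSpace d => B p.2) 2 Q :=
    (memLp_clm_stdGaussian B).comp_measurePreserving hsnd
  have hLo : MemLp (ouStep m B s) 2 Q :=
    (hL1m.const_smul (c - 1)).add (hL2.const_smul s)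
  have hinner : ∫ p, ⟪p.1, ouStep m B s p⟫ ∂Q = (c - 1) * ∫ x, ‖x - m‖ ^ 2 ∂ξ := by
    have h1 : ∀ p : RSpace d × RSpace d, ⟪p.1, ouStep m B s p⟫ =
        (c - 1) * ⟪p.1, p.1 - m⟫ + s * ⟪p.1, B p.2⟫ := fun p => by
      rw [ouStep, inner_add_right, real_inner_smul_right, real_inner_smul_right]
    have h2 : ∫ p, ⟪p.1, B p.2⟫ ∂Q = 0 := by
      rw [integral_prod _ (integrable_inner_of_memLp hL1 hL2)]
      have hi : Integrable (fun g => B g) (stdGaussian (RSpace d)) :=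
        (memLp_clm_stdGaussian B).integrable (by norm_num)
      simp only [integral_inner (𝕜 := ℝ) hi, B.integral_comp_comm IsGaussian.integrable_fun_id]
      simp
    have h3 : ∫ p, ⟪p.1, p.1 - m⟫ ∂Q = ∫ x, ‖x - m‖ ^ 2 ∂ξ := by
      have e1 : ∫ p, ⟪p.1, p.1 - m⟫ ∂Q = ∫ x, ⟪x, x - m⟫ ∂ξ := by
        rw [← hfst.map_eq, integral_map measurable_fst.aemeasurable
          (Continuous.aestronglyMeasurable (by fun_prop))]
      have hLm : MemLp (fun x : RSpace d => x - m) 2 ξ := hL.sub (memLp_const m)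
      have e2 : ∀ x : RSpace d, ⟪x, x - m⟫ = ‖x - m‖ ^ 2 + ⟪m, x - m⟫ := fun x => by
        rw [← real_inner_self_eq_norm_sq, ← inner_add_left, sub_add_cancel]
      have e3 : ∫ x, ⟪m, x - m⟫ ∂ξ = 0 := by
        rw [integral_inner (𝕜 := ℝ) (hLm.integrable (by norm_num)),
          integral_sub (hL.integrable (by norm_num)) (integrable_const _), hmean]
        simp
      rw [e1]
      simp only [e2]
      rw [integral_add (integrable_norm_sq_of_memLp hLm)
        (integrable_inner_of_memLp (memLp_const _) hLm), e3, add_zero]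
    simp only [h1]
    rw [integral_add ((integrable_inner_of_memLp hL1 hL1m).const_mul _)
      ((integrable_inner_of_memLp hL1 hL2).const_mul _), integral_const_mul, integral_const_mul,
      h2, h3, mul_zero, add_zero]
  have hindi : Integrable (fun p => G.indicator (fun p => ‖ouStep m B s p‖ ^ 2) p) Q :=
    (integrable_norm_sq_of_memLp hLo).indicator hGm
  have hsumi : ∀ j, Integrable (fun p => w j * (ψ j (y j p) - ψ j (T j p.1))) Q := fun j =>
    ((hψy j).sub (hψx j)).const_mul (w j)
  have hint := integral_mono_ae ((integrable_inner_of_memLp hL1 hLo).fun_add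
    (hindi.const_mul ((1 - 1 / n) / 2))) (integrable_finsetSum _ fun j _ => hsumi j) hpt
  rw [integral_add (integrable_inner_of_memLp hL1 hLo) (hindi.const_mul _), hinner,
    integral_const_mul, integral_finsetSum _ fun j _ => hsumi j] at hint
  have hzero : ∑ j, ∫ p, w j * (ψ j (y j p) - ψ j (T j p.1)) ∂Q = 0 := by
    refine Finset.sum_eq_zero fun j _ => ?_
    rw [integral_const_mul, integral_sub (hψy j) (hψx j), hψeq, sub_self, mul_zero]
  rw [hzero] at hint
  linarith

end KarcherLower

section KarcherLimit

variable {d : ℕ} {ι : Type*} [Fintype ι] {ξ : Measure (RSpace d)} [IsProbabilityMeasure ξ]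
  {w : ι → ℝ} {T : ι → RSpace d → RSpace d} {μ : ι → RSpace d}
  {P : ι → RSpace d →L[ℝ] RSpace d} {S : Set (RSpace d)}

lemma one_sub_sqrt_one_sub_sq {s : ℝ} (hs0 : 0 ≤ s) (hs1 : s ≤ 1) :
    1 - √(1 - s ^ 2) = s ^ 2 * (1 / (1 + √(1 - s ^ 2))) := by
  have h1 : √(1 - s ^ 2) ^ 2 = 1 - s ^ 2 := Real.sq_sqrt (by nlinarith)
  have h2 : 0 < 1 + √(1 - s ^ 2) := by positivity
  field_simp
  linear_combination -h1

lemma tendsto_ouStep_div (m : RSpace d) (B : RSpace d →L[ℝ] RSpace d) {ε : ℕ → ℝ}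
    (hε : ∀ k, 0 < ε k) (hε1 : ∀ k, ε k ≤ 1) (hε0 : Tendsto ε atTop (𝓝 0))
    (p : RSpace d × RSpace d) :
    Tendsto (fun k => ‖ouStep m B (ε k) p‖ ^ 2 / ε k ^ 2) atTop (𝓝 (‖B p.2‖ ^ 2)) := by
  have h1 : ∀ k, ‖ouStep m B (ε k) p‖ ^ 2 / ε k ^ 2 =
      ‖(-(ε k * (1 / (1 + √(1 - ε k ^ 2))))) • (p.1 - m) + B p.2‖ ^ 2 := by
    intro k
    have h2 : ouStep m B (ε k) p =
        ε k • ((-(ε k * (1 / (1 + √(1 - ε k ^ 2))))) • (p.1 - m) + B p.2) := by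
      rw [ouStep, smul_add, smul_smul]
      congr 2
      linear_combination -one_sub_sqrt_one_sub_sq (hε k).le (hε1 k)
    rw [h2, norm_smul, mul_pow, Real.norm_of_nonneg (hε k).le]
    have := (hε k).ne'
    field_simp
  simp only [h1]
  have hsq : Tendsto (fun k => 1 / (1 + √(1 - ε k ^ 2))) atTop (𝓝 (1 / (1 + √(1 - 0 ^ 2)))) := by
    refine tendsto_const_nhds.div (tendsto_const_nhds.add ?_) (by positivity)
    exact (Real.continuous_sqrt.tendsto _).comp (tendsto_const_nhds.sub (hε0.pow 2))
  have h3 : Tendsto (fun k => -(ε k * (1 / (1 + √(1 - ε k ^ 2))))) atTop (𝓝 0) := by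
    have := (hε0.mul hsq).neg
    simpa using this
  have h4 := ((h3.smul_const (p.1 - m)).add_const (B p.2)).norm.pow 2
  simpa using h4

/-- The variance of a Karcher mean `ξ ≪ volume` of Gaussian measures is at least that of the
Gaussian candidate. -/
theorem hsInner_le_integral_norm_sub_sq (hw : ∀ j, 0 ≤ w j)
    (hTm : ∀ j, Measurable (T j)) (hTl : ∀ j, ξ.map (T j) = affineGaussian (μ j) (P j))
    (hξ : ξ ≪ volume) (hSm : MeasurableSet S) (hS0 : ξ Sᶜ = 0)
    (hcm : ∀ j, CyclicallyMonotoneOn (T j) S) (hT : ∀ x ∈ S, ∑ j, w j • T j x = x)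
    (hdet : LinearMap.det ((∑ j, w j • P j : RSpace d →L[ℝ] RSpace d) :
      RSpace d →ₗ[ℝ] RSpace d) ≠ 0) :
    hsInner (∑ j, w j • P j) (∑ j, w j • P j) ≤ ∫ x, ‖x - ∑ j, w j • μ j‖ ^ 2 ∂ξ := by
  have hSae : ∀ᵐ x ∂ξ, x ∈ S := by rwa [ae_iff]
  have hL := memLp_id_of_ae_eq hTm hTl (hSae.mono hT)
  have hkey := fun {n : ℕ} (hn : n ≠ 0) {s : ℝ} (h0 : 0 ≤ s) (h1 : s ≤ 1) =>
    integral_indicator_ouStep_le hw hTm hTl hSm hS0 hcm hT hn h0 h1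
  set m := ∑ j, w j • μ j with hm
  set B := ∑ j, w j • P j with hB
  set V := ∫ x, ‖x - m‖ ^ 2 ∂ξ with hV
  set Q := ξ.prod (stdGaussian (RSpace d)) with hQ
  -- divide the bound for the step size `ε k` by `(ε k)²` and let `k → ∞`, then `n → ∞`
  let ε : ℕ → ℝ := fun k => 1 / ((k : ℝ) + 1)
  have hε : ∀ k, 0 < ε k := fun k => by positivity
  have hε1 : ∀ k, ε k ≤ 1 := fun k => by
    simp only [ε]
    rw [div_le_one (by positivity)]
    linarith [(Nat.cast_nonneg k : (0 : ℝ) ≤ k)]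
  have hε0 : Tendsto ε atTop (𝓝 0) := tendsto_one_div_add_atTop_nhds_zero_nat
  have hclaim : ∀ n : ℕ, 2 ≤ n → (1 - 1 / (n : ℝ)) * hsInner B B ≤ V := by
    intro n hn
    have hn0 : n ≠ 0 := by omega
    have hn2 : (2 : ℝ) ≤ n := by exact_mod_cast hn
    have ha : 0 < 1 - 1 / (n : ℝ) := by
      rw [sub_pos, div_lt_one (by linarith)]; linarith
    let G : ℕ → Set (RSpace d × RSpace d) := fun k =>
      {p | ∀ j ≤ n, p.1 + ((j : ℝ) / n) • ouStep m B (ε k) p ∈ S}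
    have hG : Tendsto (fun k => Q (G k)ᶜ) atTop (𝓝 0) := by
      have h1 := tendsto_measure_ouStep_segment_notMem stdGaussian_absolutelyContinuous hξ hSm hS0
        m hdet n hε hε1 hε0
      refine h1.congr fun k => ?_
      congr 1
      ext p
      simp [G]
    -- by the Borel–Cantelli lemma, along a subsequence almost every point is eventually good
    obtain ⟨σ, hσ, hσG⟩ := extraction_forall_of_eventually
      (P := fun i k => Q (G k)ᶜ ≤ (2⁻¹ : ℝ≥0∞) ^ i) fun i => by
        rw [ENNReal.tendsto_nhds_zero] at hG
        exact hG _ (ENNReal.pow_pos (by norm_num) _)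
    have hBC : ∀ᵐ p ∂Q, ∀ᶠ i in atTop, p ∈ G (σ i) := by
      have h1 : ∑' i, Q (G (σ i))ᶜ ≠ ∞ := by
        refine ne_top_of_le_ne_top ?_ (ENNReal.tsum_le_tsum hσG)
        rw [ENNReal.tsum_geometric]
        simp
      filter_upwards [ae_eventually_notMem h1] with p hp
      filter_upwards [hp] with i hi
      simpa using hi
    let f : ℕ → RSpace d × RSpace d → ℝ≥0∞ := fun i p =>
      ENNReal.ofReal ((G (σ i)).indicator (fun p => ‖ouStep m B (ε (σ i)) p‖ ^ 2) p / ε (σ i) ^ 2)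
    have hGm : ∀ k, MeasurableSet (G k) := by
      intro k
      have : G k = ⋂ j ∈ Set.Iic n, {p | p.1 + ((j : ℝ) / n) • ouStep m B (ε k) p ∈ S} := by
        ext p; simp [G]
      rw [this]
      refine MeasurableSet.biInter (Set.to_countable _) fun j _ => ?_
      exact (continuous_fst.add
        ((continuous_ouStep m B (ε k)).const_smul ((j : ℝ) / n))).measurable hSm
    have hfm : ∀ i, Measurable (f i) := fun i => by
      refine ENNReal.measurable_ofReal.comp (Measurable.div_const ?_ _)
      exact ((continuous_ouStep m B _).norm.pow 2).measurable.indicator (hGm _)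
    have hflim : ∀ᵐ p ∂Q, Tendsto (fun i => f i p) atTop (𝓝 (ENNReal.ofReal (‖B p.2‖ ^ 2))) := by
      filter_upwards [hBC] with p hp
      refine (ENNReal.continuous_ofReal.tendsto _).comp ?_
      refine ((tendsto_ouStep_div m B hε hε1 hε0 p).comp hσ.tendsto_atTop).congr' ?_
      filter_upwards [hp] with i hi
      simp [Set.indicator_of_mem hi]
    have hL1m : MemLp (fun p : RSpace d × RSpace d => p.1 - m) 2 Q :=
      (hL.sub (memLp_const m)).comp_measurePreserving
        (measurePreserving_fst (μ := ξ) (ν := stdGaussian (RSpace d)))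
    have hL2 : MemLp (fun p : RSpace d × RSpace d => B p.2) 2 Q :=
      (memLp_clm_stdGaussian B).comp_measurePreserving
        (measurePreserving_snd (μ := ξ) (ν := stdGaussian (RSpace d)))
    have hLo : ∀ s, MemLp (ouStep m B s) 2 Q := fun s =>
      (hL1m.const_smul (√(1 - s ^ 2) - 1)).add (hL2.const_smul s)
    have hfint : ∀ i, ∫⁻ p, f i p ∂Q ≤
        ENNReal.ofReal (2 / (1 - 1 / n) * (1 / (1 + √(1 - ε (σ i) ^ 2)) * V)) := by
      intro i
      have hi : Integrable (fun p => (G (σ i)).indicator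
          (fun p => ‖ouStep m B (ε (σ i)) p‖ ^ 2) p / ε (σ i) ^ 2) Q :=
        ((integrable_norm_sq_of_memLp (hLo _)).indicator (hGm _)).div_const _
      rw [← ofReal_integral_eq_lintegral_ofReal hi (Eventually.of_forall fun p =>
        div_nonneg (Set.indicator_nonneg (fun _ _ => by positivity) _) (by positivity)),
        integral_div]
      refine ENNReal.ofReal_le_ofReal ?_
      have h1 := hkey hn0 (hε (σ i)).le (hε1 (σ i))
      rw [one_sub_sqrt_one_sub_sq (hε (σ i)).le (hε1 (σ i)), mul_assoc] at h1
      have h2 : 0 < ε (σ i) ^ 2 := pow_pos (hε _) 2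
      rw [div_le_iff₀ h2]
      have h3 : 2 / (1 - 1 / (n : ℝ)) * (1 / (1 + √(1 - ε (σ i) ^ 2)) * V) * ε (σ i) ^ 2 =
          2 / (1 - 1 / (n : ℝ)) * (ε (σ i) ^ 2 * (1 / (1 + √(1 - ε (σ i) ^ 2)) * V)) := by ring
      rw [h3]
      calc ∫ p, (G (σ i)).indicator (fun p => ‖ouStep m B (ε (σ i)) p‖ ^ 2) p ∂Q
          = 2 / (1 - 1 / (n : ℝ)) * ((1 - 1 / (n : ℝ)) / 2 *
            ∫ p, (G (σ i)).indicator (fun p => ‖ouStep m B (ε (σ i)) p‖ ^ 2) p ∂Q) := by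
              have := ha.ne'
              generalize 1 - 1 / (n : ℝ) = a at *
              field_simp
        _ ≤ _ := mul_le_mul_of_nonneg_left h1 (by positivity)
    have hrhs : Tendsto (fun i => ENNReal.ofReal
        (2 / (1 - 1 / (n : ℝ)) * (1 / (1 + √(1 - ε (σ i) ^ 2)) * V))) atTop
        (𝓝 (ENNReal.ofReal (2 / (1 - 1 / (n : ℝ)) * (1 / (1 + √(1 - 0 ^ 2)) * V)))) := by
      refine (ENNReal.continuous_ofReal.tendsto _).comp
        (Tendsto.const_mul _ (Tendsto.mul_const _ ?_))
      refine tendsto_const_nhds.div (tendsto_const_nhds.add ?_) (by positivity)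
      exact (Real.continuous_sqrt.tendsto _).comp
        (tendsto_const_nhds.sub ((hε0.comp hσ.tendsto_atTop).pow 2))
    have hfatou : ∫⁻ p, ENNReal.ofReal (‖B p.2‖ ^ 2) ∂Q ≤
        ENNReal.ofReal (2 / (1 - 1 / (n : ℝ)) * (1 / (1 + √(1 - 0 ^ 2)) * V)) := by
      calc ∫⁻ p, ENNReal.ofReal (‖B p.2‖ ^ 2) ∂Q = ∫⁻ p, liminf (fun i => f i p) atTop ∂Q :=
            lintegral_congr_ae (hflim.mono fun p hp => hp.liminf_eq.symm)
        _ ≤ liminf (fun i => ∫⁻ p, f i p ∂Q) atTop := lintegral_liminf_le hfm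
        _ ≤ liminf (fun i => ENNReal.ofReal
            (2 / (1 - 1 / (n : ℝ)) * (1 / (1 + √(1 - ε (σ i) ^ 2)) * V))) atTop :=
            liminf_le_liminf (Eventually.of_forall hfint)
        _ = _ := hrhs.liminf_eq
    have hV0 : 0 ≤ V := integral_nonneg fun x => by positivity
    have hleft : ∫⁻ p, ENNReal.ofReal (‖B p.2‖ ^ 2) ∂Q = ENNReal.ofReal (hsInner B B) := by
      rw [← ofReal_integral_eq_lintegral_ofReal (integrable_norm_sq_of_memLp hL2)
        (Eventually.of_forall fun p => by positivity), ← integral_inner_clm_stdGaussian]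
      congr 1
      have hsnd := measurePreserving_snd (μ := ξ) (ν := stdGaussian (RSpace d))
      simp only [real_inner_self_eq_norm_sq]
      conv_rhs => rw [← hsnd.map_eq]
      rw [integral_map measurable_snd.aemeasurable
        (Continuous.aestronglyMeasurable (by fun_prop))]
    rw [hleft, ENNReal.ofReal_le_ofReal_iff (mul_nonneg (by positivity)
      (mul_nonneg (by positivity) hV0))] at hfatou
    have h5 : 2 / (1 - 1 / (n : ℝ)) * (1 / (1 + √(1 - 0 ^ 2)) * V) = V / (1 - 1 / (n : ℝ)) := by
      norm_num
      ring
    rw [h5, le_div_iff₀ ha] at hfatou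
    linarith
  have hlim : Tendsto (fun n : ℕ => (1 - 1 / (n : ℝ)) * hsInner B B) atTop
      (𝓝 ((1 - 0) * hsInner B B)) :=
    (tendsto_const_nhds.sub tendsto_one_div_atTop_nhds_zero_nat).mul_const _
  rw [sub_zero, one_mul] at hlim
  exact le_of_tendsto hlim (eventually_atTop.2 ⟨2, hclaim⟩)

end KarcherLimit

/-! ### Uniqueness of the Karcher mean -/

section KarcherUnique

variable {d : ℕ}

lemma det_op_ne_zero {A : Matrix (Fin d) (Fin d) ℝ} (hA : A.PosDef) :
    LinearMap.det ((op A : RSpace d →L[ℝ] RSpace d) : RSpace d →ₗ[ℝ] RSpace d) ≠ 0 := by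
  intro h
  have h1 : ((op A⁻¹ : RSpace d →L[ℝ] RSpace d) : RSpace d →ₗ[ℝ] RSpace d) ∘ₗ
      ((op A : RSpace d →L[ℝ] RSpace d) : RSpace d →ₗ[ℝ] RSpace d) = LinearMap.id := by
    ext1 x; exact op_inv_apply_op hA x
  have h2 := congrArg LinearMap.det h1
  rw [LinearMap.det_comp, h, mul_zero, LinearMap.det_id] at h2
  exact zero_ne_one h2

lemma op_sum_smul {ι : Type*} [Fintype ι] (w : ι → ℝ) (σ : ι → Matrix (Fin d) (Fin d) ℝ) :
    op (∑ j, w j • σ j) = ∑ j, w j • op (σ j) := by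
  simp only [op, map_sum, map_smul]

lemma posDef_sum_smul {ι : Type*} [Fintype ι] (i : ι) {σ : ι → Matrix (Fin d) (Fin d) ℝ}
    (hσ : ∀ j, (σ j).PosDef) {w : ι → ℝ} (hw : ∀ j, 0 < w j) : (∑ j, w j • σ j).PosDef :=
  Matrix.posDef_sum ⟨i, mem_univ i⟩ fun j _ => (hσ j).smul (hw j)

lemma hsInner_sum_smul_self {ι : Type*} [Fintype ι] (w : ι → ℝ)
    (P : ι → RSpace d →L[ℝ] RSpace d) : hsInner (∑ j, w j • P j) (∑ j, w j • P j) =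
      ∑ j, ∑ k, w j * w k * hsInner (P j) (P k) := by
  have h : ∀ e : RSpace d, ⟪(∑ j, w j • P j) e, (∑ j, w j • P j) e⟫ =
      ∑ j, ∑ k, w j * w k * ⟪P j e, P k e⟫ := by
    intro e
    simp only [_root_.sum_apply, smul_apply, sum_inner, inner_sum, real_inner_smul_left,
      real_inner_smul_right]
    refine Finset.sum_congr rfl fun j _ => Finset.sum_congr rfl fun k _ => ?_
    rw [real_inner_comm]
    ring
  simp only [hsInner, h, Finset.mul_sum]
  rw [Finset.sum_comm]
  exact Finset.sum_congr rfl fun j _ => Finset.sum_comm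

/-- An absolutely continuous Karcher mean of commuting Gaussian measures is the Gaussian one: the
two bounds on its variance force the normalized transport maps `σ_j⁻¹ (T_j - μ_j)` to coincide. -/
theorem eq_affineGaussian_of_barycenter {ι : Type*} [Fintype ι] (i : ι) {ξ : Measure (RSpace d)}
    [IsProbabilityMeasure ξ] {w : ι → ℝ} {T : ι → RSpace d → RSpace d} {μ : ι → RSpace d}
    {σ : ι → Matrix (Fin d) (Fin d) ℝ} {S : Set (RSpace d)}
    (hσ : ∀ j, (σ j).PosDef) (hcomm : ∀ j k, Commute (σ j) (σ k)) (hw : ∀ j, 0 < w j)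
    (hTm : ∀ j, Measurable (T j)) (hTl : ∀ j, ξ.map (T j) = affineGaussian (μ j) (op (σ j)))
    (hξ : ξ ≪ volume) (hSm : MeasurableSet S) (hS0 : ξ Sᶜ = 0)
    (hcm : ∀ j, CyclicallyMonotoneOn (T j) S) (hT : ∀ x ∈ S, ∑ j, w j • T j x = x) :
    ξ = affineGaussian (∑ j, w j • μ j) (op (∑ j, w j • σ j)) := by
  have hSae : ∀ᵐ x ∂ξ, x ∈ S := by rwa [ae_iff]
  have hB := posDef_sum_smul i hσ hw
  have hlow := hsInner_le_integral_norm_sub_sq (fun j => (hw j).le) hTm hTl hξ hSm hS0 hcm hT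
    (by rw [← op_sum_smul]; exact det_op_ne_zero hB)
  set m := ∑ j, w j • μ j with hm
  -- the variance of `ξ` falls short of that of the Gaussian candidate by a sum of the nonnegative
  -- defects `D j k`, which have to vanish
  let U : ι → ι → RSpace d → RSpace d := fun j k x =>
    op (σ j)⁻¹ (T j x - μ j) - op (σ k)⁻¹ (T k x - μ k)
  let D : ι → ι → ℝ := fun j k => ∫ x, ⟪U j k x, op (σ j * σ k) (U j k x)⟫ ∂ξ
  have hpd : ∀ j k, (σ j * σ k).PosDef := fun j k =>
    posDef_mul_of_commute (hσ j) (hσ k) (hcomm j k)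
  have hnn : ∀ j k x, 0 ≤ ⟪U j k x, op (σ j * σ k) (U j k x)⟫ := fun j k x =>
    inner_op_self_nonneg (hpd j k).posSemidef _
  have hL : ∀ j, MemLp (fun x => T j x - μ j) 2 ξ := fun j =>
    (memLp_of_map_eq_affineGaussian (hTm j) (hTl j)).sub (memLp_const _)
  have hvar : ∫ x, ‖x - m‖ ^ 2 ∂ξ =
      ∑ j, ∑ k, w j * w k * (hsInner (op (σ j)) (op (σ k)) - D j k / 2) := by
    have h1 : ∀ᵐ x ∂ξ, ‖x - m‖ ^ 2 = ∑ j, ∑ k, w j * w k * ⟪T j x - μ j, T k x - μ k⟫ := by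
      filter_upwards [hSae] with x hx
      have h2 : x - m = ∑ j, w j • (T j x - μ j) := by
        simp only [smul_sub, Finset.sum_sub_distrib, hT x hx, hm]
      rw [h2, ← real_inner_self_eq_norm_sq]
      simp only [sum_inner, inner_sum, real_inner_smul_left, real_inner_smul_right]
      refine Finset.sum_congr rfl fun j _ => Finset.sum_congr rfl fun k _ => ?_
      rw [real_inner_comm]
      ring
    have hi : ∀ j k, Integrable (fun x => w j * w k * ⟪T j x - μ j, T k x - μ k⟫) ξ := fun j k =>
      (integrable_inner_of_memLp (hL j) (hL k)).const_mul _
    rw [integral_congr_ae h1,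
      integral_finsetSum _ fun j _ => integrable_finsetSum _ fun k _ => hi j k]
    refine Finset.sum_congr rfl fun j _ => ?_
    rw [integral_finsetSum _ fun k _ => hi j k]
    refine Finset.sum_congr rfl fun k _ => ?_
    rw [integral_const_mul, integral_inner_coupling_affineGaussian (hTm j) (hTm k) (hσ j) (hσ k)
      (hcomm j k) (hTl j) (hTl k)]
  rw [hsInner_sum_smul_self, hvar] at hlow
  have hD0 : ∀ j k, 0 ≤ D j k := fun j k => integral_nonneg (hnn j k)
  have hsum : ∑ j, ∑ k, w j * w k * D j k ≤ 0 := by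
    have h3 : ∑ j, ∑ k, w j * w k * (hsInner (op (σ j)) (op (σ k)) - D j k / 2) =
        ∑ j, ∑ k, w j * w k * hsInner (op (σ j)) (op (σ k)) -
          (∑ j, ∑ k, w j * w k * D j k) / 2 := by
      simp only [mul_sub, Finset.sum_sub_distrib, Finset.sum_div]
      congr 1
      exact Finset.sum_congr rfl fun j _ => Finset.sum_congr rfl fun k _ => by ring
    linarith
  have hterm : ∀ j k, 0 ≤ w j * w k * D j k := fun j k =>
    mul_nonneg (mul_nonneg (hw j).le (hw k).le) (hD0 j k)
  have hDzero : ∀ k, D i k = 0 := by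
    intro k
    have h4 : w i * w k * D i k ≤ ∑ j, ∑ k, w j * w k * D j k :=
      (Finset.single_le_sum (f := fun k => w i * w k * D i k) (fun k _ => hterm i k)
        (mem_univ k)).trans (Finset.single_le_sum (f := fun j => ∑ k, w j * w k * D j k)
        (fun j _ => Finset.sum_nonneg fun k _ => hterm j k) (mem_univ i))
    have h5 : w i * w k * D i k = 0 := le_antisymm (h4.trans hsum) (hterm i k)
    rcases mul_eq_zero.1 h5 with h6 | h6
    · exact absurd h6 (mul_pos (hw i) (hw k)).ne'
    · exact h6
  have hUae : ∀ᵐ x ∂ξ, ∀ k, U i k x = 0 := by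
    refine ae_all_iff.2 fun k => ?_
    have hUL : MemLp (U i k) 2 ξ :=
      ((op (σ i)⁻¹).comp_memLp' (hL i)).sub ((op (σ k)⁻¹).comp_memLp' (hL k))
    have h7 := hDzero k
    rw [integral_eq_zero_iff_of_nonneg (hnn i k)
      (integrable_inner_of_memLp hUL ((op (σ i * σ k)).comp_memLp' hUL))] at h7
    filter_upwards [h7] with x hx
    by_contra h
    exact (inner_op_self_pos (hpd i k) h).ne' hx
  have hx : ∀ᵐ x ∂ξ, m + op (∑ j, w j • σ j) (op (σ i)⁻¹ (T i x - μ i)) = x := by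
    filter_upwards [hUae, hSae] with x hU hxS
    rw [op_sum_smul]
    simp only [_root_.sum_apply, smul_apply]
    have h8 : ∀ k, op (σ k) (op (σ i)⁻¹ (T i x - μ i)) = T k x - μ k := fun k => by
      rw [sub_eq_zero.1 (hU k), op_apply_op_inv (hσ k)]
    simp only [h8, smul_sub, Finset.sum_sub_distrib, hT x hxS, hm]
    abel
  calc ξ = ξ.map (fun x => x) := Measure.map_id.symm
    _ = ξ.map (fun x => m + op (∑ j, w j • σ j) (op (σ i)⁻¹ (T i x - μ i))) :=
        (Measure.map_congr hx).symm
    _ = (ξ.map (T i)).map (fun y => m + op (∑ j, w j • σ j) (op (σ i)⁻¹ (y - μ i))) := by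
        rw [Measure.map_map (by fun_prop) (hTm i)]; rfl
    _ = affineGaussian m (op (∑ j, w j • σ j)) := by
        rw [hTl i, map_affineGaussian (hσ i)]

end KarcherUnique

/-! ### Gaussian measures given by covariance matrices -/

section Covariance

open scoped MatrixOrder

variable {d : ℕ}

/-- The positive semidefinite square root of a covariance matrix. -/
noncomputable abbrev covSqrt (S : Matrix (Fin d) (Fin d) ℝ) : Matrix (Fin d) (Fin d) ℝ :=
  CFC.sqrt S

lemma multivariateGaussian_eq_affineGaussian (m : RSpace d) (S : Matrix (Fin d) (Fin d) ℝ) :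
    multivariateGaussian m S = affineGaussian m (op (covSqrt S)) := rfl

lemma posDef_covSqrt {S : Matrix (Fin d) (Fin d) ℝ} (hS : S.PosDef) : (covSqrt S).PosDef := by
  rw [← Matrix.isStrictlyPositive_iff_posDef] at hS ⊢
  exact hS.sqrt

lemma covSqrt_mul_self {S : Matrix (Fin d) (Fin d) ℝ} (hS : S.PosSemidef) :
    covSqrt S * covSqrt S = S :=
  CFC.sqrt_mul_sqrt_self S hS.nonneg

lemma commute_covSqrt {A B : Matrix (Fin d) (Fin d) ℝ} (h : Commute A B) :
    Commute (covSqrt A) (covSqrt B) :=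
  ((h.cfcₙ_nnreal NNReal.sqrt).symm.cfcₙ_nnreal NNReal.sqrt).symm

lemma norm_op_covSqrt_sq {S : Matrix (Fin d) (Fin d) ℝ} (hS : S.PosSemidef) (x : RSpace d) :
    ‖op (covSqrt S) x‖ ^ 2 = ⟪x, op S x⟫ := by
  have h : (covSqrt S).IsHermitian :=
    (Matrix.nonneg_iff_posSemidef.1 (CFC.sqrt_nonneg S)).isHermitian
  rw [← real_inner_self_eq_norm_sq, inner_op_left h, ← op_mul_apply,
    covSqrt_mul_self hS]

lemma inner_op_le_of_spectrum_le {S : Matrix (Fin d) (Fin d) ℝ} (hS : S.PosSemidef) {c : ℝ}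
    (h : ∀ t ∈ spectrum ℝ S, t ≤ c) (x : RSpace d) : ⟪x, op S x⟫ ≤ c * ‖x‖ ^ 2 := by
  have h1 : S ≤ algebraMap ℝ _ c := le_algebraMap_of_spectrum_le h hS.isHermitian
  have h2 := inner_op_self_nonneg (Matrix.le_iff.1 h1) x
  have h3 : op (algebraMap ℝ (Matrix (Fin d) (Fin d) ℝ) c - S) x = c • x - op S x := by
    simp [op, map_sub, Algebra.algebraMap_eq_smul_one]
  rw [h3, inner_sub_right, real_inner_smul_right, real_inner_self_eq_norm_sq] at h2
  linarith

lemma le_inner_op_of_le_spectrum {S : Matrix (Fin d) (Fin d) ℝ} (hS : S.PosSemidef) {c : ℝ}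
    (h : ∀ t ∈ spectrum ℝ S, c ≤ t) (x : RSpace d) : c * ‖x‖ ^ 2 ≤ ⟪x, op S x⟫ := by
  have h1 : algebraMap ℝ _ c ≤ S := algebraMap_le_of_le_spectrum h hS.isHermitian
  have h2 := inner_op_self_nonneg (Matrix.le_iff.1 h1) x
  have h3 : op (S - algebraMap ℝ (Matrix (Fin d) (Fin d) ℝ) c) x = op S x - c • x := by
    simp [op, map_sub, Algebra.algebraMap_eq_smul_one]
  rw [h3, inner_sub_right, real_inner_smul_right, real_inner_self_eq_norm_sq] at h2
  linarith

lemma posDef_of_spectrum_pos {S : Matrix (Fin d) (Fin d) ℝ} (hS : S.PosSemidef)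
    (h : ∀ t ∈ spectrum ℝ S, 0 < t) : S.PosDef := by
  rw [← Matrix.isStrictlyPositive_iff_posDef]
  refine ⟨hS.nonneg, ?_⟩
  by_contra h0
  exact lt_irrefl _ (h 0 ((spectrum.zero_mem_iff ℝ).2 h0))

lemma inP2_affineGaussian (m : RSpace d) (P : RSpace d →L[ℝ] RSpace d) :
    InP2 (affineGaussian m P) := by
  refine ⟨inferInstance, ?_⟩
  have hl : (affineGaussian m P).map (fun x => x) = affineGaussian m P := Measure.map_id
  have h := lintegral_edist_sq (memLp_of_map_eq_affineGaussian measurable_id' hl)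
    (memLp_const (0 : RSpace d))
  simp only [edist_zero_right] at h
  rw [h]
  exact ENNReal.ofReal_lt_top

lemma memLp_id_of_inP2 {ν : Measure (RSpace d)} (h : InP2 ν) : MemLp id 2 ν := by
  refine ⟨measurable_id.aestronglyMeasurable, ?_⟩
  rw [eLpNorm_lt_top_iff_lintegral_rpow_enorm_lt_top two_ne_zero ENNReal.ofNat_ne_top]
  simpa using h.2


/-- The only coupling with a Dirac measure is the product. -/
lemma W2_dirac_affineGaussian_sq (m : RSpace d) (P : RSpace d →L[ℝ] RSpace d) :
    W2 (Measure.dirac 0) (affineGaussian m P) ^ 2 = ENNReal.ofReal (‖m‖ ^ 2 + hsInner P P) := by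
  have h0 : (Measure.dirac 0 : Measure (RSpace d)) = affineGaussian 0 0 := by
    simp [affineGaussian, Measure.map_const]
  refine le_antisymm ?_ ?_
  · rw [h0]
    refine (W2_sq_affineGaussian_le _ _ _ _).trans (le_of_eq ?_)
    simp [hsInner]
  · rw [W2_sq]
    refine le_iInf₂ fun γ hγ => ?_
    have := isProbabilityMeasure_of_mem_couplings hγ
    have hX : ∀ᵐ p ∂γ, p.1 = 0 := by
      have : ∀ᵐ x ∂(γ.map Prod.fst), x = 0 := by
        rw [hγ.1, ae_dirac_eq]; rfl
      exact ae_of_ae_map measurable_fst.aemeasurable this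
    have h1 : ∫⁻ p, edist p.1 p.2 ^ 2 ∂γ = ∫⁻ x, edist 0 x ^ 2 ∂(affineGaussian m P) := by
      rw [← hγ.2, lintegral_map (by fun_prop) measurable_snd]
      refine lintegral_congr_ae ?_
      filter_upwards [hX] with p hp
      rw [hp]
    rw [h1, affineGaussian, lintegral_map (by fun_prop) (by fun_prop)]
    have h2 := lintegral_edist_affine_sq 0 m 0 P
    simp only [zero_apply, add_zero, zero_sub, norm_neg] at h2
    rw [h2]
    simp [hsInner]

end Covariance

/-! ### The overlap of two commuting Gaussian measures -/

section Overlap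

variable {d : ℕ}

/-- The affine bijection `y ↦ m + P y`. -/
noncomputable def affineEquiv (m : RSpace d) {P : Matrix (Fin d) (Fin d) ℝ} (hP : P.PosDef) :
    RSpace d ≃ᵐ RSpace d where
  toFun y := m + op P y
  invFun x := op P⁻¹ (x - m)
  left_inv y := by simp [op_inv_apply_op hP]
  right_inv x := by simp [op_apply_op_inv hP]
  measurable_toFun := measurable_affine m (op P)
  measurable_invFun := (op P⁻¹).measurable.comp (measurable_id.sub_const m)

lemma det_op_pos_abs {P : Matrix (Fin d) (Fin d) ℝ} (hP : P.PosDef) :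
    0 < |LinearMap.det ((op P : RSpace d →L[ℝ] RSpace d) : RSpace d →ₗ[ℝ] RSpace d)| :=
  abs_pos.2 (det_op_ne_zero hP)

lemma map_volume_affine (m : RSpace d) {P : Matrix (Fin d) (Fin d) ℝ} (hP : P.PosDef) :
    (volume : Measure (RSpace d)).map (fun y => m + op P y) = ENNReal.ofReal
      |LinearMap.det ((op P : RSpace d →L[ℝ] RSpace d) : RSpace d →ₗ[ℝ] RSpace d)|⁻¹ •
        volume := by
  have h2 : (volume : Measure (RSpace d)).map (fun g => m + op P g) =
      ((volume : Measure (RSpace d)).map (op P : RSpace d →ₗ[ℝ] RSpace d)).map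
        (fun g => m + g) :=
    (Measure.map_map (g := fun g => m + g) (by fun_prop) (op P).measurable).symm
  rw [h2, Measure.map_linearMap_addHaar_eq_smul_addHaar _ (det_op_ne_zero hP), Measure.map_smul,
    map_add_left_eq_self, abs_inv]

lemma affineGaussian_absolutelyContinuous (m : RSpace d) {P : Matrix (Fin d) (Fin d) ℝ}
    (hP : P.PosDef) : affineGaussian m (op P) ≪ volume := by
  have h1 : affineGaussian m (op P) ≪ volume.map (fun g => m + op P g) :=
    stdGaussian_absolutelyContinuous.map (measurable_affine m _)
  rw [map_volume_affine m hP] at h1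
  exact h1.trans Measure.smul_absolutelyContinuous

/-- The density of the Gaussian measure `affineGaussian m (op P)`. -/
noncomputable def affineGaussianDensity (m : RSpace d) (P : Matrix (Fin d) (Fin d) ℝ)
    (x : RSpace d) : ℝ :=
  |LinearMap.det ((op P : RSpace d →L[ℝ] RSpace d) : RSpace d →ₗ[ℝ] RSpace d)|⁻¹ *
    stdGaussianDensity d (op P⁻¹ (x - m))

lemma continuous_affineGaussianDensity (m : RSpace d) (P : Matrix (Fin d) (Fin d) ℝ) :
    Continuous (affineGaussianDensity m P) := by
  unfold affineGaussianDensity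
  have := continuous_stdGaussianDensity (d := d)
  fun_prop

lemma affineGaussianDensity_nonneg (m : RSpace d) (P : Matrix (Fin d) (Fin d) ℝ) (x : RSpace d) :
    0 ≤ affineGaussianDensity m P x := by
  unfold affineGaussianDensity
  have := stdGaussianDensity_pos (op P⁻¹ (x - m))
  positivity

lemma affineGaussian_eq_withDensity (m : RSpace d) {P : Matrix (Fin d) (Fin d) ℝ}
    (hP : P.PosDef) : affineGaussian m (op P) =
      volume.withDensity fun x => ENNReal.ofReal (affineGaussianDensity m P x) := by
  ext A hA
  have hcont := continuous_stdGaussianDensity (d := d)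
  rw [affineGaussian, Measure.map_apply (by fun_prop) hA, stdGaussian_eq_withDensity,
    withDensity_apply _ ((measurable_affine m (op P)) hA), withDensity_apply _ hA]
  have h1 : ∀ x, ENNReal.ofReal (affineGaussianDensity m P x) = ENNReal.ofReal
      |LinearMap.det ((op P : RSpace d →L[ℝ] RSpace d) : RSpace d →ₗ[ℝ] RSpace d)|⁻¹ *
        ENNReal.ofReal (stdGaussianDensity d (op P⁻¹ (x - m))) := fun x =>
    ENNReal.ofReal_mul (by positivity)
  simp only [h1]
  rw [lintegral_const_mul _ (by fun_prop), ← smul_eq_mul, ← lintegral_smul_measure,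
    ← Measure.restrict_smul, ← map_volume_affine m hP,
    setLIntegral_map hA (by fun_prop) (by fun_prop)]
  simp [op_inv_apply_op hP]

lemma integral_comp_affine (m : RSpace d) {P : Matrix (Fin d) (Fin d) ℝ} (hP : P.PosDef)
    (f : RSpace d → ℝ) : ∫ x, f x =
      |LinearMap.det ((op P : RSpace d →L[ℝ] RSpace d) : RSpace d →ₗ[ℝ] RSpace d)| *
        ∫ y, f (m + op P y) := by
  have h := (affineEquiv m hP).measurableEmbedding.integral_map (μ := volume) f
  change ∫ x, f x ∂((volume : Measure (RSpace d)).map (fun y => m + op P y)) =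
    ∫ y, f (m + op P y) at h
  rw [← h, map_volume_affine m hP, integral_smul_measure, ENNReal.toReal_ofReal (by positivity),
    smul_eq_mul, mul_inv_cancel_left₀ (det_op_pos_abs hP).ne']

lemma integrable_comp_affine (m : RSpace d) {P : Matrix (Fin d) (Fin d) ℝ} (hP : P.PosDef)
    {f : RSpace d → ℝ} (hf : Integrable f) : Integrable (fun y => f (m + op P y)) := by
  refine ((affineEquiv m hP).measurableEmbedding.integrable_map_iff (g := f)).1 ?_
  change Integrable f ((volume : Measure (RSpace d)).map (fun y => m + op P y))
  rw [map_volume_affine m hP]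
  exact hf.smul_measure ENNReal.ofReal_ne_top

lemma l2Inner_affineGaussian (m m' : RSpace d) {P R : Matrix (Fin d) (Fin d) ℝ}
    (hP : P.PosDef) (hR : R.PosDef) :
    l2Inner (affineGaussian m (op P)) (affineGaussian m' (op R)) =
      ∫ x, affineGaussianDensity m P x * affineGaussianDensity m' R x := by
  have key : ∀ (m : RSpace d) {P : Matrix (Fin d) (Fin d) ℝ}, P.PosDef →
      ∀ᵐ x, ((affineGaussian m (op P)).rnDeriv volume x).toReal = affineGaussianDensity m P x := by
    intro m P hP
    rw [affineGaussian_eq_withDensity m hP]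
    have hm := (continuous_affineGaussianDensity m P).measurable
    filter_upwards [Measure.rnDeriv_withDensity (volume : Measure (RSpace d))
      hm.ennreal_ofReal] with x hx
    rw [hx, ENNReal.toReal_ofReal (affineGaussianDensity_nonneg m P x)]
  refine integral_congr_ae ?_
  filter_upwards [key m hP, key m' hR] with x h1 h2
  rw [h1, h2]

/-- After centring at the midpoint of the means and rescaling by `P * R`, the product of the
densities becomes a Gaussian function with an explicit exponent. -/
lemma l2Inner_affineGaussian_eq (m m' : RSpace d) {P R : Matrix (Fin d) (Fin d) ℝ}
    (hP : P.PosDef) (hR : R.PosDef) (hPR : Commute P R) :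
    l2Inner (affineGaussian m (op P)) (affineGaussian m' (op R)) =
      ∫ y, stdGaussianDensity d (op P⁻¹ ((1 / 2 : ℝ) • (m' - m)) + op R y) *
        stdGaussianDensity d (-op R⁻¹ ((1 / 2 : ℝ) • (m' - m)) + op P y) := by
  rw [l2Inner_affineGaussian m m' hP hR,
    integral_comp_affine ((1 / 2 : ℝ) • (m + m')) (posDef_mul_of_commute hP hR hPR)]
  have hdet : |LinearMap.det ((op (P * R) : RSpace d →L[ℝ] RSpace d) : RSpace d →ₗ[ℝ] RSpace d)| =
      |LinearMap.det ((op P : RSpace d →L[ℝ] RSpace d) : RSpace d →ₗ[ℝ] RSpace d)| *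
      |LinearMap.det ((op R : RSpace d →L[ℝ] RSpace d) : RSpace d →ₗ[ℝ] RSpace d)| := by
    rw [← abs_mul, ← LinearMap.det_comp]
    congr 2
    ext1 x
    exact op_mul_apply P R x
  rw [hdet, ← integral_const_mul]
  refine integral_congr_ae (Eventually.of_forall fun y => ?_)
  have e1 : op P⁻¹ ((1 / 2 : ℝ) • (m + m') + op (P * R) y - m) =
      op P⁻¹ ((1 / 2 : ℝ) • (m' - m)) + op R y := by
    have : (1 / 2 : ℝ) • (m + m') + op (P * R) y - m =
        (1 / 2 : ℝ) • (m' - m) + op P (op R y) := by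
      rw [op_mul_apply]; module
    rw [this, map_add, op_inv_apply_op hP]
  have e2 : op R⁻¹ ((1 / 2 : ℝ) • (m + m') + op (P * R) y - m') =
      -op R⁻¹ ((1 / 2 : ℝ) • (m' - m)) + op P y := by
    have : (1 / 2 : ℝ) • (m + m') + op (P * R) y - m' =
        -((1 / 2 : ℝ) • (m' - m)) + op R (op P y) := by
      rw [hPR.eq, op_mul_apply]; module
    rw [this, map_add, map_neg, op_inv_apply_op hR]
  simp only [affineGaussianDensity, e1, e2]
  have h1 := (det_op_pos_abs hP).ne'
  have h2 := (det_op_pos_abs hR).ne'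
  field_simp

/-- Symmetrization: a linear term in the exponent can only increase a Gaussian integral. -/
lemma le_integral_exp_neg_mul_sq_add_inner {b : ℝ} (hb : 0 < b) (v : RSpace d) :
    (Real.pi / b) ^ ((d : ℝ) / 2) ≤ ∫ y : RSpace d, Real.exp (-b * ‖y‖ ^ 2 + ⟪v, y⟫) := by
  have hint : ∀ v : RSpace d, Integrable fun y : RSpace d =>
      Real.exp (-b * ‖y‖ ^ 2 + ⟪v, y⟫) := by
    intro v
    have h := (GaussianFourier.integrable_cexp_neg_mul_sq_norm_add (V := RSpace d) (b := (b : ℂ))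
      (by simpa using hb) 1 v).norm
    refine h.congr (Eventually.of_forall fun x => ?_)
    simp only [Complex.norm_exp]
    congr 1
    norm_cast
    simp
  have hneg : ∫ y : RSpace d, Real.exp (-b * ‖y‖ ^ 2 + ⟪-v, y⟫) =
      ∫ y : RSpace d, Real.exp (-b * ‖y‖ ^ 2 + ⟪v, y⟫) := by
    rw [← integral_neg_eq_self]
    simp
  have h0 := GaussianFourier.integral_rexp_neg_mul_sq_norm (V := RSpace d) hb
  rw [finrank_euclideanSpace_fin] at h0
  have h2 : 2 * ∫ y : RSpace d, Real.exp (-b * ‖y‖ ^ 2) ≤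
      2 * ∫ y : RSpace d, Real.exp (-b * ‖y‖ ^ 2 + ⟪v, y⟫) := by
    rw [two_mul (∫ y : RSpace d, Real.exp (-b * ‖y‖ ^ 2 + ⟪v, y⟫))]
    nth_rewrite 1 [← hneg]
    rw [← integral_add (hint (-v)) (hint v), ← integral_const_mul]
    refine integral_mono (by simpa using (hint 0).const_mul 2) ((hint (-v)).add (hint v)) ?_
    intro y
    simp only [inner_neg_left, Real.exp_add]
    have h3 : 2 ≤ Real.exp (-⟪v, y⟫) + Real.exp ⟪v, y⟫ := by
      linarith [Real.add_one_le_exp (-⟪v, y⟫), Real.add_one_le_exp ⟪v, y⟫]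
    rw [← mul_add, mul_comm 2]
    exact mul_le_mul_of_nonneg_left h3 (Real.exp_pos _).le
  rw [← h0]
  linarith

/-- Lower bound for the overlap of two Gaussian measures with commuting covariances whose
eigenvalues lie in `[a, b]`. -/
theorem le_l2Inner_affineGaussian (m m' : RSpace d) {P R : Matrix (Fin d) (Fin d) ℝ}
    (hP : P.PosDef) (hR : R.PosDef) (hPR : Commute P R) {a b : ℝ} (ha : 0 < a) (hb : 0 < b)
    (hPa : ∀ x, a * ‖x‖ ^ 2 ≤ ‖op P x‖ ^ 2) (hRa : ∀ x, a * ‖x‖ ^ 2 ≤ ‖op R x‖ ^ 2)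
    (hPb : ∀ x, ‖op P x‖ ^ 2 ≤ b * ‖x‖ ^ 2) (hRb : ∀ x, ‖op R x‖ ^ 2 ≤ b * ‖x‖ ^ 2) :
    (4 * Real.pi * b) ^ (-(d : ℝ) / 2) * Real.exp (-(‖m - m'‖ ^ 2 / (4 * a))) ≤
      l2Inner (affineGaussian m (op P)) (affineGaussian m' (op R)) := by
  rw [l2Inner_affineGaussian_eq m m' hP hR hPR]
  set u : RSpace d := (1 / 2 : ℝ) • (m' - m) with hu
  set p := op P⁻¹ u with hp
  set q := op R⁻¹ u with hq
  have hun : ‖u‖ ^ 2 = ‖m - m'‖ ^ 2 / 4 := by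
    rw [hu, norm_smul, norm_sub_rev m' m]; norm_num; ring
  have hpn : ‖p‖ ^ 2 ≤ ‖m - m'‖ ^ 2 / (4 * a) := by
    have := hPa p
    rw [hp, op_apply_op_inv hP, ← hp, hun] at this
    rw [le_div_iff₀ (by positivity)]; linarith
  have hqn : ‖q‖ ^ 2 ≤ ‖m - m'‖ ^ 2 / (4 * a) := by
    have := hRa q
    rw [hq, op_apply_op_inv hR, ← hq, hun] at this
    rw [le_div_iff₀ (by positivity)]; linarith
  set v : RSpace d := op P q - op R p with hv
  have hexp : ∀ y, -b * ‖y‖ ^ 2 + ⟪v, y⟫ - ‖m - m'‖ ^ 2 / (4 * a) ≤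
      -(1 / 2) * ‖p + op R y‖ ^ 2 + -(1 / 2) * ‖-q + op P y‖ ^ 2 := by
    intro y
    rw [norm_add_sq_real, norm_add_sq_real, norm_neg, inner_neg_left, hv, inner_sub_left,
      inner_op_left hP.isHermitian, inner_op_left hR.isHermitian]
    linarith [hPb y, hRb y]
  have hc : (4 * Real.pi * b) ^ (-(d : ℝ) / 2) =
      (2 * Real.pi) ^ (-(d : ℝ) / 2) * (2 * Real.pi) ^ (-(d : ℝ) / 2) *
        (Real.pi / b) ^ ((d : ℝ) / 2) := by
    have hpi := Real.pi_pos
    rw [← Real.mul_rpow (by positivity) (by positivity), neg_div, Real.rpow_neg (by positivity),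
      Real.rpow_neg (by positivity), ← Real.inv_rpow (by positivity),
      ← Real.inv_rpow (by positivity), ← Real.mul_rpow (by positivity) (by positivity)]
    congr 1
    field_simp
    ring
  set C : ℝ := (2 * Real.pi) ^ (-(d : ℝ) / 2) with hC
  have hC0 : 0 < C := by rw [hC]; positivity
  have hle : ∀ y, stdGaussianDensity d (p + op R y) ≤ C := fun y => by
    rw [stdGaussianDensity, ← hC]
    refine mul_le_of_le_one_right hC0.le (Real.exp_le_one_iff.2 ?_)
    nlinarith [sq_nonneg ‖p + op R y‖]
  have hcont : Continuous fun y => stdGaussianDensity d (p + op R y) :=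
    continuous_stdGaussianDensity.comp (by fun_prop)
  calc _ = C * C * Real.exp (-(‖m - m'‖ ^ 2 / (4 * a))) * (Real.pi / b) ^ ((d : ℝ) / 2) := by
        rw [hc]; ring
    _ ≤ C * C * Real.exp (-(‖m - m'‖ ^ 2 / (4 * a))) *
        ∫ y : RSpace d, Real.exp (-b * ‖y‖ ^ 2 + ⟪v, y⟫) :=
      mul_le_mul_of_nonneg_left (le_integral_exp_neg_mul_sq_add_inner hb v) (by positivity)
    _ = ∫ y : RSpace d, C * C * Real.exp (-(‖m - m'‖ ^ 2 / (4 * a))) *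
        Real.exp (-b * ‖y‖ ^ 2 + ⟪v, y⟫) := (integral_const_mul _ _).symm
    _ ≤ _ := by
      refine integral_mono_of_nonneg (Eventually.of_forall fun y => by positivity) ?_
        (Eventually.of_forall fun y => ?_)
      · refine (integrable_comp_affine (-q) hP integrable_stdGaussianDensity).bdd_mul
          hcont.aestronglyMeasurable (c := C) (Eventually.of_forall fun y => ?_)
        rw [Real.norm_of_nonneg (stdGaussianDensity_pos _).le]
        exact hle y
      · simp only [stdGaussianDensity, ← hC]
        rw [mul_mul_mul_comm C _ C, ← Real.exp_add, mul_assoc, ← Real.exp_add]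
        refine mul_le_mul_of_nonneg_left (Real.exp_le_exp.2 ?_) (by positivity)
        linarith [hexp y]

end Overlap

/-! ### The softmax retrieval map of a Hilbert space -/

section Softmax

variable {V : Type*} [NormedAddCommGroup V] {N : ℕ}

/-- The Gibbs weights of a point `x` with respect to finitely many patterns `p j`. -/
noncomputable def softmaxWeight (β : ℝ) (p : Fin N → V) (x : V) (j : Fin N) : ℝ :=
  Real.exp (-β * ‖p j - x‖ ^ 2) / ∑ k, Real.exp (-β * ‖p k - x‖ ^ 2)

lemma sum_exp_pos (i : Fin N) (β : ℝ) (p : Fin N → V) (x : V) :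
    0 < ∑ k, Real.exp (-β * ‖p k - x‖ ^ 2) :=
  Finset.sum_pos (fun _ _ => Real.exp_pos _) ⟨i, Finset.mem_univ i⟩

lemma softmaxWeight_pos (i : Fin N) (β : ℝ) (p : Fin N → V) (x : V) (j : Fin N) :
    0 < softmaxWeight β p x j :=
  div_pos (Real.exp_pos _) (sum_exp_pos i β p x)

lemma sum_softmaxWeight (i : Fin N) (β : ℝ) (p : Fin N → V) (x : V) :
    ∑ j, softmaxWeight β p x j = 1 := by
  simp only [softmaxWeight]
  rw [← Finset.sum_div, div_self (sum_exp_pos i β p x).ne']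

lemma one_sub_softmaxWeight (i : Fin N) (β : ℝ) (p : Fin N → V) (x : V) :
    1 - softmaxWeight β p x i = ∑ j ∈ univ.erase i, softmaxWeight β p x j := by
  rw [← sum_softmaxWeight i β p x, ← Finset.add_sum_erase _ _ (Finset.mem_univ i)]
  ring

variable [InnerProductSpace ℝ V] {β M : ℝ} {p : Fin N → V}

/-- The softmax retrieval map: the barycentre of the patterns with the Gibbs weights. -/
noncomputable def softmaxMap (β : ℝ) (p : Fin N → V) (x : V) : V :=
  ∑ j, softmaxWeight β p x j • p j

lemma norm_softmaxMap_sub_le (i : Fin N) (hM : ∀ j, ‖p j‖ ≤ M) (x : V) :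
    ‖softmaxMap β p x - p i‖ ≤ 2 * M * (1 - softmaxWeight β p x i) := by
  have h1 : softmaxMap β p x - p i = ∑ j ∈ univ.erase i, softmaxWeight β p x j • (p j - p i) := by
    have h0 : p i = ∑ j, softmaxWeight β p x j • p i := by
      rw [← Finset.sum_smul, sum_softmaxWeight i, one_smul]
    conv_lhs => rw [softmaxMap, h0, ← Finset.sum_sub_distrib]
    rw [← Finset.add_sum_erase _ _ (Finset.mem_univ i)]
    simp [smul_sub]
  rw [h1, one_sub_softmaxWeight, Finset.mul_sum]
  refine norm_sum_le_of_le _ fun j _ => ?_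
  rw [norm_smul, Real.norm_of_nonneg (softmaxWeight_pos i β p x j).le, mul_comm]
  refine mul_le_mul_of_nonneg_right ?_ (softmaxWeight_pos i β p x j).le
  linarith [norm_sub_le (p j) (p i), hM j, hM i]

/-- The derivative of the softmax map in direction `h` is `2β` times the covariance of `p j` and
`⟪p j, h⟫` under the weights, which is small where the weight of `p i` dominates. -/
lemma norm_softmaxMap_sub_softmaxMap_le (i : Fin N) (hβ : 0 ≤ β) (hM : ∀ j, ‖p j‖ ≤ M)
    {s : Set V} (hs : Convex ℝ s) {C : ℝ}
    (hC : ∀ x ∈ s, 8 * β * M ^ 2 * (1 - softmaxWeight β p x i) ≤ C) {x y : V} (hx : x ∈ s)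
    (hy : y ∈ s) : ‖softmaxMap β p x - softmaxMap β p y‖ ≤ C * ‖x - y‖ := by
  -- differentiate along the segment; `c t j` is the logarithmic derivative of the exponential `j`
  set h := x - y with hh
  let c : ℝ → Fin N → ℝ := fun t j => 2 * β * ⟪p j - (y + t • h), h⟫
  let W : ℝ → Fin N → ℝ := fun t j => softmaxWeight β p (y + t • h) j
  have hM0 : 0 ≤ M := (norm_nonneg _).trans (hM i)
  have hE : ∀ t j, HasDerivAt (fun t => Real.exp (-β * ‖p j - (y + t • h)‖ ^ 2))
      (c t j * Real.exp (-β * ‖p j - (y + t • h)‖ ^ 2)) t := by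
    intro t j
    have h1 : HasDerivAt (fun t : ℝ => p j - (y + t • h)) (-h) t := by
      simpa using (((hasDerivAt_id t).smul_const h).const_add y).const_sub (p j)
    have h2 := (h1.norm_sq.const_mul (-β)).exp
    refine h2.congr_deriv ?_
    simp only [c, inner_neg_right]
    ring
  have hZ : ∀ t, HasDerivAt (fun t => ∑ k, Real.exp (-β * ‖p k - (y + t • h)‖ ^ 2))
      (∑ k, c t k * Real.exp (-β * ‖p k - (y + t • h)‖ ^ 2)) t := fun t =>
    HasDerivAt.fun_sum fun k _ => hE t k
  have hW : ∀ t j, HasDerivAt (fun t => W t j) (W t j * (c t j - ∑ k, W t k * c t k)) t := by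
    intro t j
    have hZ0 := (sum_exp_pos i β p (y + t • h)).ne'
    refine ((hE t j).div (hZ t) hZ0).congr_deriv ?_
    have h1 : ∑ k, c t k * Real.exp (-β * ‖p k - (y + t • h)‖ ^ 2) =
        (∑ k, W t k * c t k) * ∑ k, Real.exp (-β * ‖p k - (y + t • h)‖ ^ 2) := by
      rw [Finset.sum_mul]
      refine Finset.sum_congr rfl fun k _ => ?_
      have h2 : W t k * ∑ k, Real.exp (-β * ‖p k - (y + t • h)‖ ^ 2) =
          Real.exp (-β * ‖p k - (y + t • h)‖ ^ 2) := div_mul_cancel₀ _ hZ0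
      rw [← h2]; ring
    rw [h1]
    generalize (∑ k, W t k * c t k) = A
    simp only [W, softmaxWeight]
    field_simp
  have hg : ∀ t, HasDerivAt (fun t => softmaxMap β p (y + t • h))
      (∑ j, (W t j * (c t j - ∑ k, W t k * c t k)) • p j) t := fun t =>
    HasDerivAt.fun_sum fun j _ => (hW t j).smul_const (p j)
  have hbound : ∀ t ∈ Set.Ico (0 : ℝ) 1,
      ‖∑ j, (W t j * (c t j - ∑ k, W t k * c t k)) • p j‖ ≤ C * ‖h‖ := by
    intro t ht
    have hmem : y + t • h ∈ s := hs.add_smul_sub_mem hy hx ⟨ht.1, ht.2.le⟩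
    have hW1 : ∑ k, W t k = 1 := sum_softmaxWeight i β p _
    have hWp : ∀ k, 0 ≤ W t k := fun k => (softmaxWeight_pos i β p _ k).le
    have hz : ∑ j, W t j * (c t j - ∑ k, W t k * c t k) = 0 := by
      simp only [mul_sub]
      rw [Finset.sum_sub_distrib, ← Finset.sum_mul, hW1, one_mul, sub_self]
    have hcj : ∀ j, |c t j - ∑ k, W t k * c t k| ≤ 4 * β * M * ‖h‖ := by
      intro j
      have h1 : c t j - ∑ k, W t k * c t k = ∑ k, W t k * (2 * β * ⟪p j - p k, h⟫) := by
        have : c t j = ∑ k, W t k * c t j := by rw [← Finset.sum_mul, hW1, one_mul]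
        rw [this, ← Finset.sum_sub_distrib]
        refine Finset.sum_congr rfl fun k _ => ?_
        simp only [c, inner_sub_left]
        ring
      rw [h1]
      refine (Finset.abs_sum_le_sum_abs _ _).trans ?_
      calc _ ≤ ∑ k, W t k * (4 * β * M * ‖h‖) := by
            refine Finset.sum_le_sum fun k _ => ?_
            rw [abs_mul, abs_of_nonneg (hWp k)]
            refine mul_le_mul_of_nonneg_left ?_ (hWp k)
            rw [abs_mul, abs_of_nonneg (by positivity)]
            have h2 : |⟪p j - p k, h⟫| ≤ 2 * M * ‖h‖ := by
              refine (abs_real_inner_le_norm _ _).trans ?_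
              refine mul_le_mul_of_nonneg_right ?_ (norm_nonneg _)
              linarith [norm_sub_le (p j) (p k), hM j, hM k]
            calc _ ≤ 2 * β * (2 * M * ‖h‖) := by gcongr
              _ = _ := by ring
        _ = _ := by rw [← Finset.sum_mul, hW1, one_mul]
    have h1 : ∑ j, (W t j * (c t j - ∑ k, W t k * c t k)) • p j =
        ∑ j ∈ univ.erase i, (W t j * (c t j - ∑ k, W t k * c t k)) • (p j - p i) := by
      have h0 : ∑ j, (W t j * (c t j - ∑ k, W t k * c t k)) • p i = 0 := by
        rw [← Finset.sum_smul, hz, zero_smul]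
      rw [← sub_zero (∑ j, (W t j * (c t j - ∑ k, W t k * c t k)) • p j), ← h0,
        ← Finset.sum_sub_distrib, ← Finset.add_sum_erase _ _ (Finset.mem_univ i)]
      simp [smul_sub]
    rw [h1]
    calc _ ≤ ∑ j ∈ univ.erase i, W t j * (8 * β * M ^ 2 * ‖h‖) := by
          refine norm_sum_le_of_le _ fun j _ => ?_
          rw [norm_smul, Real.norm_eq_abs, abs_mul, abs_of_nonneg (hWp j), mul_assoc]
          refine mul_le_mul_of_nonneg_left ?_ (hWp j)
          have h2 : ‖p j - p i‖ ≤ 2 * M := by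
            linarith [norm_sub_le (p j) (p i), hM j, hM i]
          calc _ ≤ (4 * β * M * ‖h‖) * (2 * M) := by
                have := hcj j
                gcongr
            _ = _ := by ring
      _ = 8 * β * M ^ 2 * (1 - softmaxWeight β p (y + t • h) i) * ‖h‖ := by
          rw [← Finset.sum_mul, one_sub_softmaxWeight]; ring
      _ ≤ C * ‖h‖ := mul_le_mul_of_nonneg_right (hC _ hmem) (norm_nonneg _)
  have := norm_image_sub_le_of_norm_deriv_le_segment_01'
    (fun t _ => (hg t).hasDerivWithinAt) hbound
  simpa [hh] using this

/-- If the patterns are well separated, then near the pattern `p i` all other weights are small. -/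
lemma softmaxWeight_le_inv {i j : Fin N} (hβ : 0 < β) {L r : ℝ} (hL : 1 ≤ L)
    (hsep : 4 * Real.log L ≤ β * ‖p i - p j‖ ^ 2) (hr : 4 * r ≤ ‖p i - p j‖) {x : V}
    (hx : ‖x - p i‖ ≤ r) : softmaxWeight β p x j ≤ L⁻¹ := by
  have h1 : softmaxWeight β p x j ≤
      Real.exp (-β * ‖p j - x‖ ^ 2) / Real.exp (-β * ‖p i - x‖ ^ 2) := by
    refine div_le_div_of_nonneg_left (Real.exp_pos _).le (Real.exp_pos _) ?_
    exact Finset.single_le_sum (f := fun k => Real.exp (-β * ‖p k - x‖ ^ 2))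
      (fun _ _ => (Real.exp_pos _).le) (Finset.mem_univ i)
  refine h1.trans ?_
  rw [← Real.exp_sub, ← Real.exp_log (inv_pos.2 (zero_lt_one.trans_le hL)), Real.log_inv]
  refine Real.exp_le_exp.2 ?_
  have h2 : ‖p j - x‖ ^ 2 = ‖p i - p j‖ ^ 2 + 2 * ⟪p i - p j, x - p i⟫ + ‖p i - x‖ ^ 2 := by
    have : p j - x = -((p i - p j) + (x - p i)) := by abel
    rw [this, norm_neg, norm_add_sq_real, norm_sub_rev x]
  have h3 : -(‖p i - p j‖ * r) ≤ ⟪p i - p j, x - p i⟫ := by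
    refine (neg_le_neg ?_).trans (neg_abs_le _)
    exact (abs_real_inner_le_norm _ _).trans (mul_le_mul_of_nonneg_left hx (norm_nonneg _))
  have h4 : ‖p i - p j‖ ^ 2 / 2 ≤ ‖p j - x‖ ^ 2 - ‖p i - x‖ ^ 2 := by
    nlinarith [norm_nonneg (p i - p j)]
  have h5 := mul_le_mul_of_nonneg_left h4 hβ.le
  linarith [Real.log_nonneg hL]

/-- Near a well separated pattern `p i` the softmax map is a contraction, and it moves the points
of a ball around `p i` to its interior. -/
theorem softmaxMap_contraction (i : Fin N) (hβ : 0 < β) (hM0 : 0 < M) (hM : ∀ j, ‖p j‖ ≤ M)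
    {K : ℝ} (hK : 4 * M ^ 2 ≤ K) (hL : 2 < Real.log (N ^ 3 * β * K))
    (hsep : ∀ j, j ≠ i → 4 * Real.log (N ^ 3 * β * K) ≤ β * ‖p i - p j‖ ^ 2)
    (hκ : 144 * β * M ^ 2 / N < 1) {r : ℝ} (hr : r = 1 / √(β * N)) {x : V}
    (hx : ‖x - p i‖ ≤ r) :
    2 * M * (1 - softmaxWeight β p x i) < r ∧
      8 * β * M ^ 2 * (1 - softmaxWeight β p x i) ≤ 144 * β * M ^ 2 / N := by
  have hN : 0 < N := i.pos
  have hN' : (1 : ℝ) ≤ N := by exact_mod_cast hN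
  have hβN : 0 < β * N := by positivity
  have hr0 : 0 < r := by rw [hr]; positivity
  have hr2 : r ^ 2 * (β * N) = 1 := by
    rw [hr, div_pow, Real.sq_sqrt hβN.le]; field_simp
  -- with a single pattern all the mass sits on `p i`
  by_cases hall : ∀ j, j = i
  · have : 1 - softmaxWeight β p x i = 0 := by
      rw [one_sub_softmaxWeight]
      refine Finset.sum_eq_zero fun j hj => absurd (hall j) (Finset.ne_of_mem_erase hj)
    rw [this]
    refine ⟨by simpa using hr0, by rw [mul_zero]; positivity⟩
  push Not at hall
  obtain ⟨j₀, hj₀⟩ := hall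
  set L := (N : ℝ) ^ 3 * β * K with hLdef
  have hK0 : 0 < K := lt_of_lt_of_le (by positivity) hK
  have hL0 : 0 < L := by positivity
  have hL1 : 1 ≤ L := by
    rw [← Real.log_nonneg_iff hL0]; linarith
  have hD : ∀ j, ‖p i - p j‖ ≤ 2 * M := fun j => by
    linarith [norm_sub_le (p i) (p j), hM j, hM i]
  -- two separated patterns in a ball of radius `M` force `β M²` and `N` to be large
  have hβM : 2 < β * M ^ 2 := by
    have h1 := hsep j₀ hj₀
    have h2 : ‖p i - p j₀‖ ^ 2 ≤ (2 * M) ^ 2 := pow_le_pow_left₀ (norm_nonneg _) (hD j₀) 2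
    have h3 := mul_le_mul_of_nonneg_left h2 hβ.le
    nlinarith
  have hN2 : 288 < (N : ℝ) := by
    rw [div_lt_one (by positivity)] at hκ; nlinarith
  have h4r : ∀ j, j ≠ i → 4 * r ≤ ‖p i - p j‖ := by
    intro j hj
    rw [← pow_le_pow_iff_left₀ (by positivity) (norm_nonneg _) two_ne_zero]
    refine le_of_mul_le_mul_right ?_ hβN
    nlinarith [hsep j hj]
  have hq : 1 - softmaxWeight β p x i ≤ N * L⁻¹ := by
    rw [one_sub_softmaxWeight]
    calc _ ≤ ∑ j ∈ univ.erase i, L⁻¹ := Finset.sum_le_sum fun j hj =>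
          softmaxWeight_le_inv hβ hL1 (hsep j (Finset.ne_of_mem_erase hj))
            (h4r j (Finset.ne_of_mem_erase hj)) hx
      _ ≤ ∑ j : Fin N, L⁻¹ := Finset.sum_le_univ_sum_of_nonneg fun _ => by positivity
      _ = N * L⁻¹ := by simp
  have hq' : (1 - softmaxWeight β p x i) * (4 * (β * M ^ 2) * N ^ 2) ≤ 1 := by
    calc _ ≤ N * L⁻¹ * (β * K * N ^ 2) := by
          refine mul_le_mul hq ?_ (by positivity) (by positivity)
          nlinarith [mul_le_mul_of_nonneg_left hK (by positivity : 0 ≤ β * (N : ℝ) ^ 2)]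
      _ = 1 := by rw [hLdef]; field_simp
  have hq0 : 0 ≤ 1 - softmaxWeight β p x i := by
    rw [one_sub_softmaxWeight]
    exact Finset.sum_nonneg fun j _ => (softmaxWeight_pos i β p x j).le
  generalize 1 - softmaxWeight β p x i = q at hq' hq0
  constructor
  · refine lt_of_pow_lt_pow_left₀ 2 hr0.le ?_
    refine lt_of_mul_lt_mul_right ?_ hβN.le
    rw [hr2]
    have hq1 : q ≤ 1 := by
      refine le_trans (le_mul_of_one_le_right hq0 ?_) hq'
      nlinarith [mul_le_mul hN' hN' zero_le_one (by positivity)]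
    have h1 : (2 * M * q) ^ 2 * (β * N) * N ≤ 1 := by
      calc _ = q * (q * (4 * (β * M ^ 2) * N ^ 2)) := by ring
        _ ≤ 1 * 1 := mul_le_mul hq1 hq' (by positivity) zero_le_one
        _ = 1 := one_mul 1
    have h2 : 0 ≤ (2 * M * q) ^ 2 * (β * N) := by positivity
    nlinarith
  · rw [le_div_iff₀ (by positivity)]
    calc 8 * β * M ^ 2 * q * N ≤ 8 * β * M ^ 2 * q * N * N :=
          le_mul_of_one_le_right (by positivity) hN'
      _ = 2 * (q * (4 * (β * M ^ 2) * N ^ 2)) := by ring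
      _ ≤ 144 * β * M ^ 2 := by nlinarith

/-- The softmax map has a unique fixed point near a well separated pattern, and its iterates
converge to it geometrically. -/
theorem exists_softmaxMap_fixedPoint [CompleteSpace V] (i : Fin N) (hβ : 0 < β) (hM0 : 0 < M)
    (hM : ∀ j, ‖p j‖ ≤ M) {K : ℝ} (hK : 4 * M ^ 2 ≤ K) (hL : 2 < Real.log (N ^ 3 * β * K))
    (hsep : ∀ j, j ≠ i → 4 * Real.log (N ^ 3 * β * K) ≤ β * ‖p i - p j‖ ^ 2)
    (hκ : 144 * β * M ^ 2 / N < 1) {r : ℝ} (hr : r = 1 / √(β * N)) :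
    ∃ x, ‖x - p i‖ < r ∧ softmaxMap β p x = x ∧
      (∀ y, ‖y - p i‖ < r → softmaxMap β p y = y → y = x) ∧
      ∀ y, ‖y - p i‖ < r → ∀ n : ℕ,
        ‖(softmaxMap β p)^[n] y - x‖ ≤ (144 * β * M ^ 2 / N) ^ n * ‖y - x‖ := by
  set κ := 144 * β * M ^ 2 / N with hκdef
  have hκ0 : 0 ≤ κ := by positivity
  let s : Set V := Metric.closedBall (p i) r
  have hs : ∀ {x}, x ∈ s ↔ ‖x - p i‖ ≤ r := by simp [s, dist_eq_norm]
  have key := fun x (hx : x ∈ s) =>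
    softmaxMap_contraction i hβ hM0 hM hK hL hsep hκ hr (hs.1 hx)
  have hlip : ∀ x ∈ s, ∀ y ∈ s, ‖softmaxMap β p x - softmaxMap β p y‖ ≤ κ * ‖x - y‖ :=
    fun x hx y hy => norm_softmaxMap_sub_softmaxMap_le i hβ.le hM (convex_closedBall _ _)
      (fun z hz => (key z hz).2) hx hy
  have hlt : ∀ x ∈ s, ‖softmaxMap β p x - p i‖ < r := fun x hx =>
    (norm_softmaxMap_sub_le i hM x).trans_lt (key x hx).1
  have hmaps : Set.MapsTo (softmaxMap β p) s s := fun x hx => hs.2 (hlt x hx).le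
  have hr0 : 0 ≤ r := by rw [hr]; positivity
  have hcon : ContractingWith κ.toNNReal (hmaps.restrict (softmaxMap β p) s s) := by
    refine ⟨by simpa using hκ, LipschitzWith.of_dist_le_mul fun x y => ?_⟩
    rw [Real.coe_toNNReal _ hκ0, Subtype.dist_eq, Subtype.dist_eq, dist_eq_norm, dist_eq_norm]
    exact hlip _ x.2 _ y.2
  obtain ⟨x, hxs, hfix, -⟩ := hcon.exists_fixedPoint' Metric.isClosed_closedBall.isComplete hmaps
    (Metric.mem_closedBall_self hr0) (edist_ne_top _ _)
  have hfix' : softmaxMap β p x = x := hfix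
  refine ⟨x, ?_, hfix', fun y hy hfy => ?_, fun y hy n => ?_⟩
  · have := hlt x hxs
    rwa [hfix'] at this
  · have h := hlip y (hs.2 hy.le) x hxs
    rw [hfix', hfy] at h
    have : ‖y - x‖ = 0 := by nlinarith [norm_nonneg (y - x)]
    exact sub_eq_zero.1 (norm_eq_zero.1 this)
  · have hmem : ∀ n, (softmaxMap β p)^[n] y ∈ s := fun n => hmaps.iterate n (hs.2 hy.le)
    induction n with
    | zero => simp
    | succ n ih =>
      rw [Function.iterate_succ_apply']
      have h := hlip _ (hmem n) x hxs
      rw [hfix'] at h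
      calc _ ≤ κ * ‖(softmaxMap β p)^[n] y - x‖ := h
        _ ≤ κ * (κ ^ n * ‖y - x‖) := mul_le_mul_of_nonneg_left ih hκ0
        _ = _ := by ring

end Softmax

/-! ### Wasserstein retrieval in parameter space -/

section Retrieval

variable {d N : ℕ}

/-- The mean and the columns of the operator of a Gaussian measure, as a point of a Hilbert space.
On Gaussian measures with commuting covariances the Wasserstein distance is the distance of these
points. -/
noncomputable def gaussianParam (m : RSpace d) (P : RSpace d →L[ℝ] RSpace d) :
    WithLp 2 (RSpace d × PiLp 2 (fun _ : Fin d => RSpace d)) :=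
  WithLp.toLp 2 (m, WithLp.toLp 2 fun k => P (EuclideanSpace.basisFun (Fin d) ℝ k))

lemma norm_gaussianParam_sq (m : RSpace d) (P : RSpace d →L[ℝ] RSpace d) :
    ‖gaussianParam m P‖ ^ 2 = ‖m‖ ^ 2 + hsInner P P := by
  have h := PiLp.norm_sq_eq_of_L2 (fun _ : Fin d => RSpace d)
    (WithLp.toLp 2 fun k => P (EuclideanSpace.basisFun (Fin d) ℝ k))
  refine (WithLp.prod_norm_sq_eq_of_L2 _).trans ?_
  simp only [hsInner, real_inner_self_eq_norm_sq]
  exact congrArg (‖m‖ ^ 2 + ·) h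

lemma gaussianParam_sub (m m' : RSpace d) (P R : RSpace d →L[ℝ] RSpace d) :
    gaussianParam m P - gaussianParam m' R = gaussianParam (m - m') (P - R) := rfl

lemma norm_gaussianParam_sub_sq (m m' : RSpace d) (P R : RSpace d →L[ℝ] RSpace d) :
    ‖gaussianParam m P - gaussianParam m' R‖ ^ 2 = ‖m - m'‖ ^ 2 + hsInner (P - R) (P - R) := by
  rw [gaussianParam_sub, norm_gaussianParam_sq]

lemma sum_smul_gaussianParam (w : Fin N → ℝ) (μ : Fin N → RSpace d)
    (P : Fin N → RSpace d →L[ℝ] RSpace d) :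
    ∑ j, w j • gaussianParam (μ j) (P j) = gaussianParam (∑ j, w j • μ j) (∑ j, w j • P j) := by
  have hadd : ∀ m m' (P R : RSpace d →L[ℝ] RSpace d),
      gaussianParam (m + m') (P + R) = gaussianParam m P + gaussianParam m' R := fun _ _ _ _ => rfl
  have hsmul : ∀ (c : ℝ) m (P : RSpace d →L[ℝ] RSpace d),
      gaussianParam (c • m) (c • P) = c • gaussianParam m P := fun _ _ _ => rfl
  have hzero : gaussianParam (0 : RSpace d) 0 = 0 := rfl
  have : ∀ s : Finset (Fin N), ∑ j ∈ s, w j • gaussianParam (μ j) (P j) =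
      gaussianParam (∑ j ∈ s, w j • μ j) (∑ j ∈ s, w j • P j) := by
    intro s
    induction s using Finset.induction_on with
    | empty => simp [hzero]
    | insert j s hj ih => rw [Finset.sum_insert hj, Finset.sum_insert hj, Finset.sum_insert hj,
        hadd, hsmul, ih]
  exact this univ

variable {m m' : RSpace d} {P R : Matrix (Fin d) (Fin d) ℝ}

lemma W2_affineGaussian_le (m m' : RSpace d) (P R : RSpace d →L[ℝ] RSpace d) :
    W2 (affineGaussian m P) (affineGaussian m' R) ≤
      ENNReal.ofReal ‖gaussianParam m P - gaussianParam m' R‖ := by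
  rw [← ENNReal.pow_le_pow_left_iff two_ne_zero, ← ENNReal.ofReal_pow (norm_nonneg _),
    norm_gaussianParam_sub_sq]
  exact W2_sq_affineGaussian_le m m' P R

lemma W2_affineGaussian (hP : P.PosDef) (hR : R.PosDef) (hPR : Commute P R) :
    W2 (affineGaussian m (op P)) (affineGaussian m' (op R)) =
      ENNReal.ofReal ‖gaussianParam m (op P) - gaussianParam m' (op R)‖ := by
  refine (ENNReal.pow_right_strictMono two_ne_zero).injective ?_
  rw [W2_sq_affineGaussian hP hR hPR, ← ENNReal.ofReal_pow (norm_nonneg _),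
    norm_gaussianParam_sub_sq]

variable {β : ℝ} {μ : Fin N → RSpace d} {σ : Fin N → Matrix (Fin d) (Fin d) ℝ}
  {X : Fin N → Measure (RSpace d)}

lemma commute_sum_smul (hP : ∀ j, Commute (σ j) P) (w : Fin N → ℝ) :
    Commute P (∑ j, w j • σ j) :=
  Commute.sum_right _ _ _ fun j _ => (hP j).symm.smul_right (w j)

lemma gibbsWeight_affineGaussian (hX : ∀ j, X j = affineGaussian (μ j) (op (σ j)))
    (hσ : ∀ j, (σ j).PosDef) (hP : P.PosDef) (hσP : ∀ j, Commute (σ j) P) (j : Fin N) :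
    gibbsWeight β X (affineGaussian m (op P)) j =
      softmaxWeight β (fun j => gaussianParam (μ j) (op (σ j))) (gaussianParam m (op P)) j := by
  simp only [gibbsWeight, softmaxWeight, hX, norm_gaussianParam_sub_sq,
    toReal_W2_affineGaussian_sq (hσ _) hP (hσP _)]

/-- On a Gaussian measure whose covariance commutes with those of the patterns, retrieval is the
softmax map in parameter space. -/
lemma retrieval_affineGaussian (hX : ∀ j, X j = affineGaussian (μ j) (op (σ j)))
    (hσ : ∀ j, (σ j).PosDef) (hP : P.PosDef) (hσP : ∀ j, Commute (σ j) P) {w : Fin N → ℝ}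
    (hw : ∀ j, w j = softmaxWeight β (fun j => gaussianParam (μ j) (op (σ j)))
      (gaussianParam m (op P)) j) :
    retrieval β X (affineGaussian m (op P)) =
      affineGaussian (∑ j, w j • μ j) (op (∑ j, w j • σ j)) := by
  have h : ∃ T : Fin N → RSpace d → RSpace d,
      ∀ j, IsOptimalTransportMap (T j) (affineGaussian m (op P)) (X j) :=
    ⟨fun j x => μ j + op (σ j) (op P⁻¹ (x - m)), fun j => by
      rw [hX j]; exact isOptimalTransportMap_affineGaussian hP (hσ j) (hσP j).symm⟩
  rw [retrieval, dif_pos h]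
  refine (Measure.map_congr ?_).trans (map_affineGaussian hP)
  -- the chosen optimal maps agree almost everywhere with the affine ones
  have hT : ∀ᵐ x ∂(affineGaussian m (op P)), ∀ j,
      h.choose j x = μ j + op (σ j) (op P⁻¹ (x - m)) := by
    refine ae_all_iff.2 fun j => ?_
    have := h.choose_spec j
    rw [hX j] at this
    exact ae_eq_affine_of_optimal hP (hσ j) (hσP j).symm this
  filter_upwards [hT] with x hx
  simp only [hx, gibbsWeight_affineGaussian hX hσ hP hσP, ← hw, smul_add, Finset.sum_add_distrib,
    op_sum_smul]
  simp only [_root_.sum_apply, smul_apply]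

lemma iterate_retrieval_affineGaussian (i : Fin N)
    (hX : ∀ j, X j = affineGaussian (μ j) (op (σ j)))
    (hσ : ∀ j, (σ j).PosDef) (hcomm : ∀ j k, Commute (σ j) (σ k)) (hP : P.PosDef)
    (hσP : ∀ j, Commute (σ j) P) (n : ℕ) :
    ∃ (m' : RSpace d) (P' : Matrix (Fin d) (Fin d) ℝ), P'.PosDef ∧ (∀ j, Commute (σ j) P') ∧
      (retrieval β X)^[n] (affineGaussian m (op P)) = affineGaussian m' (op P') ∧
      gaussianParam m' (op P') = (softmaxMap β fun j => gaussianParam (μ j) (op (σ j)))^[n]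
        (gaussianParam m (op P)) := by
  induction n with
  | zero => exact ⟨m, P, hP, hσP, rfl, rfl⟩
  | succ n ih =>
    obtain ⟨m', P', hP', hσP', h1, h2⟩ := ih
    set w := softmaxWeight β (fun j => gaussianParam (μ j) (op (σ j))) (gaussianParam m' (op P'))
      with hw
    refine ⟨∑ j, w j • μ j, ∑ j, w j • σ j, posDef_sum_smul i hσ (softmaxWeight_pos i β _ _),
      fun j => commute_sum_smul (hcomm · j) _, ?_, ?_⟩
    · rw [Function.iterate_succ_apply', h1]
      exact retrieval_affineGaussian hX hσ hP' hσP' fun _ => rfl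
    · rw [Function.iterate_succ_apply', ← h2, softmaxMap, sum_smul_gaussianParam, op_sum_smul]

/-- A fixed point of the retrieval map that is absolutely continuous is the Gaussian measure
whose parameters are the averages of those of the patterns. -/
lemma eq_affineGaussian_of_retrieval_eq_self (i : Fin N)
    (hX : ∀ j, X j = affineGaussian (μ j) (op (σ j)))
    (hσ : ∀ j, (σ j).PosDef) (hcomm : ∀ j k, Commute (σ j) (σ k)) {ν : Measure (RSpace d)}
    (hν : InP2 ν) (hac : ν ≪ volume) (hfix : retrieval β X ν = ν) :
    ∃ w : Fin N → ℝ, (∀ j, w j = gibbsWeight β X ν j) ∧ (∀ j, 0 < w j) ∧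
      ν = affineGaussian (∑ j, w j • μ j) (op (∑ j, w j • σ j)) := by
  have := hν.1
  by_cases h : ∃ T : Fin N → RSpace d → RSpace d, ∀ j, IsOptimalTransportMap (T j) ν (X j)
  swap
  -- otherwise the retrieval is the zero measure, which is not a probability measure
  · rw [retrieval, dif_neg h] at hfix
    exact absurd hfix.symm (IsProbabilityMeasure.ne_zero ν)
  rw [retrieval, dif_pos h] at hfix
  obtain ⟨T, hTdef⟩ : ∃ T, T = h.choose := ⟨_, rfl⟩
  have hT : ∀ j, IsOptimalTransportMap (T j) ν (X j) := hTdef ▸ h.choose_spec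
  rw [← hTdef] at hfix
  set w : Fin N → ℝ := gibbsWeight β X ν with hw
  have hwpos : ∀ j, 0 < w j := fun j =>
    div_pos (Real.exp_pos _) (Finset.sum_pos (fun _ _ => Real.exp_pos _) ⟨i, Finset.mem_univ i⟩)
  refine ⟨w, fun _ => rfl, hwpos, ?_⟩
  have hTl : ∀ j, ν.map (T j) = affineGaussian (μ j) (op (σ j)) := fun j =>
    (hT j).2.1.trans (hX j)
  have hL := memLp_id_of_inP2 hν
  have hS : ∀ j, ∃ s, MeasurableSet s ∧ ν sᶜ = 0 ∧ CyclicallyMonotoneOn (T j) s := fun j => by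
    refine exists_cyclicallyMonotoneOn_of_optimal (hT j) ?_
    have := lintegral_edist_sq (X := id) (Y := T j) hL
      (memLp_of_map_eq_affineGaussian (hT j).1 (hTl j))
    simp only [id] at this
    rw [this]
    exact ENNReal.ofReal_ne_top
  choose s hsm hs0 hscm using hS
  have hTwm : Measurable fun x => ∑ j, w j • T j x :=
    Finset.measurable_fun_sum _ fun j _ => (hT j).1.const_smul (w j)
  have hI0 : ν (⋂ j, s j)ᶜ = 0 := by
    rw [Set.compl_iInter]; exact measure_iUnion_null hs0
  have hcm : ∀ j, CyclicallyMonotoneOn (T j) (⋂ j, s j) := fun j =>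
    (hscm j).mono (Set.iInter_subset s j)
  -- the barycentric map is cyclically monotone and preserves `ν`, hence is the identity
  have hid := (CyclicallyMonotoneOn.weightedSum (fun j => (hwpos j).le) hcm).ae_eq_self hI0
    ⟨hTwm, hfix⟩ hL
  have hEm : MeasurableSet {x | ∑ j, w j • T j x = x} := measurableSet_eq_fun hTwm measurable_id
  refine eq_affineGaussian_of_barycenter (S := (⋂ j, s j) ∩ {x | ∑ j, w j • T j x = x}) i hσ hcomm
    hwpos (fun j => (hT j).1) hTl hac ((MeasurableSet.iInter hsm).inter hEm) ?_
    (fun j => (hcm j).mono Set.inter_subset_left) fun x hx => hx.2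
  rw [Set.compl_inter]
  exact measure_union_null hI0 hid

/-- The retrieval theorem in terms of the parameters of the patterns. -/
theorem exists_retrieval_fixedPoint (i : Fin N)
    (hX : ∀ j, X j = affineGaussian (μ j) (op (σ j)))
    (hσ : ∀ j, (σ j).PosDef) (hcomm : ∀ j k, Commute (σ j) (σ k)) {M : ℝ} (hβ : 0 < β)
    (hM0 : 0 < M) (hM : ∀ j, ‖gaussianParam (μ j) (op (σ j))‖ ≤ M) {K : ℝ} (hK : 4 * M ^ 2 ≤ K)
    (hL : 2 < Real.log (N ^ 3 * β * K))
    (hsep : ∀ j, j ≠ i → 4 * Real.log (N ^ 3 * β * K) ≤ β * ‖μ i - μ j‖ ^ 2)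
    (hκ : 144 * β * M ^ 2 / N < 1) {r : ℝ} (hr : r = 1 / √(β * N)) :
    ∃ Xs : Measure (RSpace d),
      (Xs ∈ wassersteinBall (X i) r ∧ Xs ≪ volume ∧ retrieval β X Xs = Xs) ∧
      (∀ ν ∈ wassersteinBall (X i) r, ν ≪ volume → retrieval β X ν = ν → ν = Xs) ∧
      ∀ (m : RSpace d) (P : Matrix (Fin d) (Fin d) ℝ), P.PosDef → (∀ j, Commute (σ j) P) →
        W2 (X i) (affineGaussian m (op P)) < ENNReal.ofReal r → ∀ n : ℕ,
          W2 ((retrieval β X)^[n] (affineGaussian m (op P))) Xs <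
            ENNReal.ofReal ((144 * β * M ^ 2 / N) ^ n * (2 * r)) := by
  set p := fun j => gaussianParam (μ j) (op (σ j)) with hp
  have hsep' : ∀ j, j ≠ i → 4 * Real.log (N ^ 3 * β * K) ≤ β * ‖p i - p j‖ ^ 2 := by
    intro j hj
    refine (hsep j hj).trans (mul_le_mul_of_nonneg_left ?_ hβ.le)
    rw [hp]
    simp only [norm_gaussianParam_sub_sq]
    linarith [hsInner_self_nonneg (op (σ i) - op (σ j))]
  have hN : 0 < N := i.pos
  have hr0 : 0 < r := by rw [hr]; positivity
  obtain ⟨x, hxr, hxfix, huniq, hconv⟩ :=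
    exists_softmaxMap_fixedPoint i hβ hM0 hM hK hL hsep' hκ hr
  set w := softmaxWeight β p x with hw
  have hwpos : ∀ j, 0 < w j := softmaxWeight_pos i β p x
  have hB := posDef_sum_smul i hσ hwpos
  have hBc : ∀ j, Commute (σ j) (∑ k, w k • σ k) := fun j => commute_sum_smul (hcomm · j) w
  have hx : gaussianParam (∑ j, w j • μ j) (op (∑ j, w j • σ j)) = x := by
    rw [op_sum_smul, ← sum_smul_gaussianParam]
    exact hxfix
  refine ⟨affineGaussian (∑ j, w j • μ j) (op (∑ j, w j • σ j)),
    ⟨⟨inP2_affineGaussian _ _, ?_⟩, affineGaussian_absolutelyContinuous _ hB, ?_⟩, ?_, ?_⟩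
  · rw [hX i]
    refine (W2_affineGaussian_le _ _ _ _).trans_lt ?_
    rw [hx]
    exact (ENNReal.ofReal_lt_ofReal_iff hr0).2 hxr
  · refine retrieval_affineGaussian hX hσ hB hBc fun j => ?_
    rw [hx]
  · rintro ν ⟨hν, hνr⟩ hac hfix
    obtain ⟨v, hv, hvpos, hνv⟩ :=
      eq_affineGaussian_of_retrieval_eq_self i hX hσ hcomm hν hac hfix
    have hC := posDef_sum_smul i hσ hvpos
    have hCc : ∀ j, Commute (σ j) (∑ k, v k • σ k) := fun j => commute_sum_smul (hcomm · j) v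
    have hv' : ∀ j, v j = softmaxWeight β p
        (gaussianParam (∑ j, v j • μ j) (op (∑ j, v j • σ j))) j := fun j => by
      rw [hv j]
      conv_lhs => rw [hνv]
      exact gibbsWeight_affineGaussian hX hσ hC hCc j
    have hy : gaussianParam (∑ j, v j • μ j) (op (∑ j, v j • σ j)) = x := by
      refine huniq _ ?_ ?_
      · rw [hνv, hX i, W2_affineGaussian hC (hσ i) (hCc i).symm,
          ENNReal.ofReal_lt_ofReal_iff hr0] at hνr
        exact hνr
      · rw [softmaxMap, op_sum_smul, ← sum_smul_gaussianParam]
        refine Finset.sum_congr rfl fun j _ => ?_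
        rw [sum_smul_gaussianParam, ← op_sum_smul, ← hv' j]
    have hvw : v = w := by
      funext j
      rw [hv' j, hy]
    rw [hνv, hvw]
  · intro m P hP hσP hW n
    obtain ⟨m', P', -, -, h1, h2⟩ :=
      iterate_retrieval_affineGaussian (β := β) (m := m) i hX hσ hcomm hP hσP n
    rw [hX i, W2_affineGaussian (hσ i) hP (hσP i), ENNReal.ofReal_lt_ofReal_iff hr0] at hW
    rw [h1]
    have hκ0 : 0 < (144 * β * M ^ 2 / N) ^ n := by positivity
    refine (W2_affineGaussian_le _ _ _ _).trans_lt
      ((ENNReal.ofReal_lt_ofReal_iff (by positivity)).2 ?_)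
    rw [hx, h2]
    have hW' : ‖gaussianParam m (op P) - p i‖ < r := by rwa [norm_sub_rev]
    refine (hconv _ hW' n).trans_lt (mul_lt_mul_of_pos_left ?_ hκ0)
    have := norm_sub_le (gaussianParam m (op P) - p i) (x - p i)
    rw [sub_sub_sub_cancel_right] at this
    linarith

lemma norm_gaussianParam_le_maxW2 (hX : ∀ j, X j = affineGaussian (μ j) (op (σ j))) (j : Fin N) :
    ‖gaussianParam (μ j) (op (σ j))‖ ≤ maxW2 X := by
  have key : ∀ j, W2 (Measure.dirac 0) (X j) =
      ENNReal.ofReal ‖gaussianParam (μ j) (op (σ j))‖ := by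
    intro j
    refine (ENNReal.pow_right_strictMono two_ne_zero).injective ?_
    rw [hX j, W2_dirac_affineGaussian_sq, ← ENNReal.ofReal_pow (norm_nonneg _),
      norm_gaussianParam_sq]
  have hfin : ⨆ j, W2 (Measure.dirac 0) (X j) ≠ ∞ := by
    have : ⨆ j, W2 (Measure.dirac 0) (X j) ≤
        ENNReal.ofReal (∑ j, ‖gaussianParam (μ j) (op (σ j))‖) := by
      refine iSup_le fun j => ?_
      rw [key j]
      exact ENNReal.ofReal_le_ofReal (Finset.single_le_sum
        (f := fun j => ‖gaussianParam (μ j) (op (σ j))‖) (fun _ _ => norm_nonneg _) (mem_univ j))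
    exact ne_top_of_le_ne_top ENNReal.ofReal_ne_top this
  rw [maxW2, ← ENNReal.ofReal_le_iff_le_toReal hfin, ← key j]
  exact le_iSup (fun j => W2 (Measure.dirac 0) (X j)) j

lemma norm_gaussianParam_pos (hd : 0 < d) (hP : P.PosDef) :
    0 < ‖gaussianParam m (op P)‖ := by
  refine (sq_pos_iff.1 ?_ : ‖gaussianParam m (op P)‖ ≠ 0).symm.lt_of_le (norm_nonneg _)
  rw [norm_gaussianParam_sq]
  refine add_pos_of_nonneg_of_pos (by positivity) ?_
  refine Finset.sum_pos (fun k _ => ?_) ⟨⟨0, hd⟩, mem_univ _⟩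
  rw [real_inner_self_eq_norm_sq]
  have : op P (EuclideanSpace.basisFun (Fin d) ℝ k) ≠ 0 := fun h0 => by
    have h1 := op_inv_apply_op hP (EuclideanSpace.basisFun (Fin d) ℝ k)
    rw [h0, map_zero] at h1
    exact (EuclideanSpace.basisFun (Fin d) ℝ).orthonormal.ne_zero k h1.symm
  positivity

/-- The separation condition of the densities separates the means. -/
lemma le_norm_sub_sq_of_le_neg_log_l2Inner {A B : Matrix (Fin d) (Fin d) ℝ} (hA : A.PosSemidef)
    (hB : B.PosSemidef) (hAB : Commute A B) {a b c : ℝ} (ha : 0 < a) (hb : 0 < b)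
    (hAs : spectrum ℝ A ⊆ Set.Icc a b) (hBs : spectrum ℝ B ⊆ Set.Icc a b) (hβ : 0 < β)
    (h : d / 2 * Real.log (4 * Real.pi * b) + 1 / (β * a) * c ≤
      -Real.log (l2Inner (multivariateGaussian m A) (multivariateGaussian m' B))) :
    4 * c ≤ β * ‖m - m'‖ ^ 2 := by
  have hA' := posDef_of_spectrum_pos hA fun t ht => ha.trans_le (hAs ht).1
  have hB' := posDef_of_spectrum_pos hB fun t ht => ha.trans_le (hBs ht).1
  have hle := le_l2Inner_affineGaussian m m' (posDef_covSqrt hA') (posDef_covSqrt hB')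
    (commute_covSqrt hAB) ha hb
    (fun x => by
      rw [norm_op_covSqrt_sq hA]
      exact le_inner_op_of_le_spectrum hA (fun t ht => (hAs ht).1) x)
    (fun x => by
      rw [norm_op_covSqrt_sq hB]
      exact le_inner_op_of_le_spectrum hB (fun t ht => (hBs ht).1) x)
    (fun x => by
      rw [norm_op_covSqrt_sq hA]
      exact inner_op_le_of_spectrum_le hA (fun t ht => (hAs ht).2) x)
    (fun x => by
      rw [norm_op_covSqrt_sq hB]
      exact inner_op_le_of_spectrum_le hB (fun t ht => (hBs ht).2) x)
  have hpi := Real.pi_pos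
  have hlog := Real.log_le_log (by positivity) hle
  rw [Real.log_mul (by positivity) (by positivity), Real.log_exp,
    Real.log_rpow (by positivity)] at hlog
  rw [multivariateGaussian_eq_affineGaussian, multivariateGaussian_eq_affineGaussian] at h
  have h1 : 1 / (β * a) * c ≤ ‖m - m'‖ ^ 2 / (4 * a) := by
    rw [neg_div] at hlog
    linarith
  have h2 := mul_le_mul_of_nonneg_right h1 (by positivity : 0 ≤ 4 * a * β)
  have e1 : 1 / (β * a) * c * (4 * a * β) = 4 * c := by field_simp
  have e2 : ‖m - m'‖ ^ 2 / (4 * a) * (4 * a * β) = β * ‖m - m'‖ ^ 2 := by field_simp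
  linarith

/-- The stated number of iterations makes the geometric error bound smaller than `ε`. -/
lemma pow_mul_le_of_ceil_log_le {κ r ε : ℝ} (hκ0 : 0 < κ) (hκ1 : κ < 1) (hr : 0 < r) (hε : 0 < ε)
    {n : ℕ} (hn : ⌈Real.log (ε / (2 * r)) / Real.log κ⌉ ≤ (n : ℤ)) :
    κ ^ n * (2 * r) ≤ ε := by
  have h1 : Real.log (ε / (2 * r)) / Real.log κ ≤ n := by
    exact_mod_cast Int.ceil_le.1 hn
  rw [div_le_iff_of_neg (Real.log_neg hκ0 hκ1)] at h1
  have h2 : Real.log (κ ^ n) ≤ Real.log (ε / (2 * r)) := by rwa [Real.log_pow]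
  rw [Real.log_le_log_iff (by positivity) (by positivity)] at h2
  rwa [le_div_iff₀ (by positivity)] at h2

end Retrieval

end WassersteinRetrieval

theorem theorem2 (d N : ℕ) (hd : 0 < d)
    (μ : Fin N → RSpace d) (S : Fin N → Matrix (Fin d) (Fin d) ℝ)
    (lmin lmax β : ℝ) (hlmin : 0 < lmin) (hβ : 0 < β)
    (hS : ∀ j, (S j).PosSemidef)
    (hspec : ∀ j, spectrum ℝ (S j) ⊆ Set.Icc lmin lmax)
    (hcomm : ∀ j k, S j * S k = S k * S j)
    (X : Fin N → Measure (RSpace d)) (hX : ∀ j, X j = multivariateGaussian (μ j) (S j))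
    (M : ℝ) (hM : M = maxW2 X)
    (i : Fin N)
    -- the separation condition
    (hsep : ∀ j, j ≠ i →
      d / 2 * Real.log (4 * Real.pi * lmax)
          + 1 / (β * lmin) * Real.log (N ^ 3 * β * (4 * M ^ 2 + 2 * d * (lmax + lmin)))
        ≤ - Real.log (l2Inner (X i) (X j)))
    -- the constraint on the temperature parameter
    (hβ' : Real.exp 2 / ((4 * M ^ 2 + 2 * d * (lmax + lmin)) * N ^ 3) < β)
    -- the contraction constant is less than one
    (hκ : 144 * β * M ^ 2 / N < 1)
    (r : ℝ) (hr : r = 1 / √(β * N)) :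
    ∃ Xs : Measure (RSpace d),
      -- (1) `Xs` is the unique fixed point in the ball
      (Xs ∈ wassersteinBall (X i) r ∧ Xs ≪ volume ∧ retrieval β X Xs = Xs) ∧
      (∀ ν ∈ wassersteinBall (X i) r, ν ≪ volume → retrieval β X ν = ν → ν = Xs) ∧
      -- (2) the rate of convergence of the iterates to `Xs`
      ∀ (m : RSpace d) (Ω : Matrix (Fin d) (Fin d) ℝ), Ω.PosDef →
        (∀ j, S j * Ω = Ω * S j) →
        W2 (X i) (multivariateGaussian m Ω) < ENNReal.ofReal r →
        ∀ ε : ℝ, 0 < ε → ε < r →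
        ∀ n : ℕ, ⌈Real.log (ε / 2 * √(β * N)) / Real.log (144 * β * M ^ 2 / N)⌉ ≤ (n : ℤ) →
          W2 ((retrieval β X)^[n] (multivariateGaussian m Ω)) Xs < ENNReal.ofReal ε := by
  have hN : 0 < N := i.pos
  have hpd : ∀ j, (S j).PosDef := fun j =>
    WassersteinRetrieval.posDef_of_spectrum_pos (hS j) fun t ht => hlmin.trans_le (hspec j ht).1
  have hσ : ∀ j, (WassersteinRetrieval.covSqrt (S j)).PosDef := fun j =>
    WassersteinRetrieval.posDef_covSqrt (hpd j)
  have hXσ : ∀ j, X j = WassersteinRetrieval.affineGaussian (μ j)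
      (WassersteinRetrieval.op (WassersteinRetrieval.covSqrt (S j))) := fun j => hX j
  -- since `0 < d`, the matrix `S i` has an eigenvalue
  have hlmax : 0 < lmax := by
    have h := hspec i ((hS i).isHermitian.eigenvalues_mem_spectrum_real ⟨0, hd⟩)
    exact hlmin.trans_le (h.1.trans h.2)
  have hMle := fun j => hM ▸ WassersteinRetrieval.norm_gaussianParam_le_maxW2 hXσ j
  have hM0 : 0 < M := (WassersteinRetrieval.norm_gaussianParam_pos hd (hσ i)).trans_le (hMle i)
  -- the lower bound on `β` says that the logarithm in the separation condition exceeds `2`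
  have hL : 2 < Real.log (N ^ 3 * β * (4 * M ^ 2 + 2 * d * (lmax + lmin))) := by
    rw [Real.lt_log_iff_exp_lt (by positivity)]
    rw [div_lt_iff₀ (by positivity)] at hβ'
    linarith
  have hr0 : 0 < r := by rw [hr]; positivity
  obtain ⟨Xs, h1, h2, h3⟩ := WassersteinRetrieval.exists_retrieval_fixedPoint i hXσ hσ
    (fun j k => WassersteinRetrieval.commute_covSqrt (hcomm j k)) hβ hM0 hMle
    (le_add_of_nonneg_right (by positivity)) hL (fun j hj =>
      WassersteinRetrieval.le_norm_sub_sq_of_le_neg_log_l2Inner (hS i) (hS j) (hcomm i j) hlmin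
        hlmax (hspec i) (hspec j) hβ (by rw [← hX i, ← hX j]; exact hsep j hj)) hκ hr
  refine ⟨Xs, h1, h2, fun m Ω hΩ hSΩ hW ε hε _ n hn => ?_⟩
  refine (h3 m (WassersteinRetrieval.covSqrt Ω) (WassersteinRetrieval.posDef_covSqrt hΩ)
    (fun j => WassersteinRetrieval.commute_covSqrt (hSΩ j)) hW n).trans_le
    (ENNReal.ofReal_le_ofReal ?_)
  refine WassersteinRetrieval.pow_mul_le_of_ceil_log_le (by positivity) hκ hr0 hε ?_
  have hε' : ε / (2 * r) = ε / 2 * √(β * N) := by rw [hr]; field_simp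
  rwa [hε']
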